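/- Theorem 1.2. A *two-component link* is a pair $L=K_1\cup K_2$ of disjoint oriented simple closed polygons in $\mathbb{R}^3$. Links are considered up to sequences of triangle moves and their inverses, where a triangle move replaces an edge $[a,b]$ of $L$ by $[a,c]\cup[c,b]$ if the triangle $abc$ meets $L$ only in $[a,b]$ (or if $c$ is a new vertex inside $[a,b]$). $L$ is *trivial* if it is equivalent to the union of the boundaries of two disjoint flat triangles. A *diagram* $D$ of a two-component link consists of two oriented closed polygons in $\mathbb{R}^2$ whose only multiple points are finitely many transverse double points (the *crossings*), none of them at a vertex, together with the choice of the upper strand at each crossing. It is a diagram of $L$ if $L$, possibly after subdivision of the edges of $D$, projects onto $D$ so that no vertex of $L$ lies over a crossing and the upper strand at each crossing is the projection of the higher strand of $L$. The linking number $lk(K_1,K_2)$ is the sum of the signs of the crossings of $D$ at which $K_1$ passes over $K_2$ (equivalently, half the sum of the signs of all crossings between $K_1$ and $K_2$). A *region* of $D$ is a connected component of the complement of (the underlying set of) $D$ in $\mathbb{R}^2$, and a *region crossing change* at a region $R$ changes all crossings of $D$ that lie on the boundary of $R$, each of them once. Let $D$ be a diagram of a two-component link $K_1\cup K_2$ that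 is non-split, i.e. whose underlying subset of $\mathbb{R}^2$ is connected. Then region crossing change is an unknotting operation on $D$, i.e. some finite sequence of region crossing changes turns $D$ into a diagram of a trivial link, if and only if $lk(K_1,K_2)$ is even. -/

import Mathlib

/-!
Polygonal two-component links in `ℝ³ = ℝ² × ℝ`, their diagrams in `ℝ²`, region crossing change,
the linking number of a diagram, and triviality of a link (up to triangle moves).
-/

namespace RegionCrossing

/-- The plane of projection. -/
abbrev Plane : Type := ℝ × ℝ

/-- Three-space; the link is projected along the last coordinate, which serves as height. -/
abbrev Space : Type := Plane × ℝ

/-- A closed oriented polygon, possibly self-intersecting, as a nonempty cyclic sequence of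
vertices; its edges run from `vertex i` to `vertex (i + 1)`. -/
structure ClosedPolygon (V : Type) where
  n : ℕ
  neZero : NeZero n
  vertex : ZMod n → V

attribute [instance] ClosedPolygon.neZero

/-- An ordered pair of closed polygons. -/
structure PolygonPair (V : Type) where
  comp : Fin 2 → ClosedPolygon V

namespace PolygonPair

variable {V : Type}

/-- Parameters of the points of a pair of closed polygons: `⟨k, i, t⟩` stands for the point at time
`t ∈ [0, 1)` on the `i`-th edge of component `k`. Edges are half-open, so that every point on the
abstract pair of closed curves has exactly one parameter. -/
abbrev Param (P : PolygonPair V) : Type := Σ k : Fin 2, ZMod (P.comp k).n × Set.Ico (0 : ℝ) 1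

variable [AddCommGroup V] [Module ℝ V]

/-- The point with a given parameter. -/
noncomputable def point (P : PolygonPair V) (p : P.Param) : V :=
  AffineMap.lineMap ((P.comp p.1).vertex p.2.1) ((P.comp p.1).vertex (p.2.1 + 1)) (p.2.2 : ℝ)

/-- The direction vector of the `i`-th edge of component `k`. -/
def dir (P : PolygonPair V) (k : Fin 2) (i : ZMod (P.comp k).n) : V :=
  (P.comp k).vertex (i + 1) - (P.comp k).vertex i

/-- The union of the two polygons as a set of points. -/
def support (P : PolygonPair V) : Set V := Set.range P.point

/-- The multiple points of a pair of polygons. -/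
def multiplePoints (P : PolygonPair V) : Set V :=
  {x | ∃ p q : P.Param, p ≠ q ∧ P.point p = x ∧ P.point q = x}

end PolygonPair

/-- The determinant of two plane vectors. -/
def det (u w : Plane) : ℝ := u.1 * w.2 - u.2 * w.1

/-! ### Links in three-space -/

/-- An (ordered, oriented, polygonal) two-component link: two disjoint simple closed polygons. -/
structure PolygonalLink extends PolygonPair Space where
  injective : Function.Injective toPolygonPair.point

namespace PolygonalLink

/-- `L'` arises from `L` by a triangle move: in one component an edge from `a` to `b` is replaced by
the two edges from `a` to `c` and from `c` to `b`, where the (possibly degenerate) triangle `a b c`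
meets the link `L` only in the edge from `a` to `b`. The other component stays as it is. In the
degenerate case the vertex `c` is inserted inside the edge, as `L'` has to be a link.

The vertices of the changed component of `L` are `P s, P (s + 1), …, P (s - 1)` in cyclic order, and
those of `L'` are the same followed by `c`; so `a = P (s - 1)`, `b = P s` and `c = Q (r - 1)`. -/
def TriangleMove (L L' : PolygonalLink) : Prop :=
  ∃ k : Fin 2, (∀ l, l ≠ k → L'.comp l = L.comp l) ∧
    (L'.comp k).n = (L.comp k).n + 1 ∧
    ∃ (s : ZMod (L.comp k).n) (r : ZMod (L'.comp k).n),
      (∀ i : ℕ, i < (L.comp k).n → (L'.comp k).vertex (r + i) = (L.comp k).vertex (s + i)) ∧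
      convexHull ℝ {(L.comp k).vertex (s - 1), (L'.comp k).vertex (r - 1), (L.comp k).vertex s}
          ∩ L.support
        ⊆ segment ℝ ((L.comp k).vertex (s - 1)) ((L.comp k).vertex s)

/-- Equivalence of polygonal links: a finite sequence of triangle moves and inverse ones. -/
def Equivalent : PolygonalLink → PolygonalLink → Prop := Relation.EqvGen TriangleMove

/-- A link is trivial if it is equivalent to one whose components are the boundaries of two
disjoint flat triangular disks. -/
def IsTrivial (L : PolygonalLink) : Prop :=
  ∃ L₀ : PolygonalLink, L.Equivalent L₀ ∧ (∀ k, (L₀.comp k).n = 3) ∧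
    Disjoint (convexHull ℝ (Set.range (L₀.comp 0).vertex))
      (convexHull ℝ (Set.range (L₀.comp 1).vertex))

end PolygonalLink

/-! ### Diagrams -/

/-- A diagram of a two-component link: two closed polygons in the plane whose multiple points are
transverse double points away from the vertices, with the information which of the two strands is
the upper one at every double point. -/
structure LinkDiagram extends PolygonPair Plane where
  /-- Multiple points are not vertices, and the edges crossing there are not parallel. (In
  particular edges have positive length and do not overlap.) -/
  transverse : ∀ p q : toPolygonPair.Param, p ≠ q →
    toPolygonPair.point p = toPolygonPair.point q →
      0 < (p.2.2 : ℝ) ∧ 0 < (q.2.2 : ℝ) ∧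
        det (toPolygonPair.dir p.1 p.2.1) (toPolygonPair.dir q.1 q.2.1) ≠ 0
  /-- There are no triple points. -/
  double : ∀ p q r : toPolygonPair.Param, p ≠ q → p ≠ r → q ≠ r →
    ¬ (toPolygonPair.point p = toPolygonPair.point q ∧
      toPolygonPair.point p = toPolygonPair.point r)
  /-- The parameters of the overcrossings. -/
  upper : Set toPolygonPair.Param
  upper_mem : ∀ p ∈ upper, toPolygonPair.point p ∈ toPolygonPair.multiplePoints
  upper_iff : ∀ p q : toPolygonPair.Param, p ≠ q →
    toPolygonPair.point p = toPolygonPair.point q → (p ∈ upper ↔ q ∉ upper)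

namespace LinkDiagram

/-- The crossing points of a diagram. -/
def crossings (D : LinkDiagram) : Set Plane := D.multiplePoints

/-- Crossing changes at all crossings of the diagram that lie in `S`. -/
def crossingChange (D : LinkDiagram) (S : Set Plane) : LinkDiagram where
  toPolygonPair := D.toPolygonPair
  transverse := D.transverse
  double := D.double
  upper := {p | D.point p ∈ D.crossings ∧ (p ∈ D.upper ↔ D.point p ∉ S)}
  upper_mem := fun _ hp => hp.1
  upper_iff := by
    intro p q hpq h
    have hq : D.point q ∈ D.crossings := ⟨p, q, hpq, h, rfl⟩
    have hp : D.point p ∈ D.crossings := h ▸ hq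
    have h1 := D.upper_iff p q hpq h
    simp only [Set.mem_ofPred_eq, h, hq, true_and]
    tauto

/-- The regions into which the diagram divides the plane. -/
def regions (D : LinkDiagram) : Set (Set Plane) :=
  {R | ∃ x ∈ D.supportᶜ, R = connectedComponentIn D.supportᶜ x}

/-- `D'` arises from `D` by a region crossing change: the crossing changes at all the crossings on
the boundary of one region. -/
def RegionCrossingChange (D D' : LinkDiagram) : Prop :=
  ∃ R ∈ D.regions, D' = D.crossingChange (frontier R)

open Classical in
/-- The linking number of the two components: the sum of the signs of the crossings at which
component `0` passes over component `1`. The sign of a crossing is that of `det u w`, for `u` the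
direction of the upper strand and `w` that of the lower one. (Two edges cross at most once. This
number is also half the sum of the signs of all crossings between the two components.) -/
noncomputable def linkingNumber (D : LinkDiagram) : ℤ :=
  ∑ i : ZMod (D.comp 0).n, ∑ j : ZMod (D.comp 1).n,
    if ∃ s t : Set.Ico (0 : ℝ) 1, D.point ⟨0, i, s⟩ = D.point ⟨1, j, t⟩ ∧
        (⟨0, i, s⟩ : D.Param) ∈ D.upper
    then (SignType.sign (det (D.dir 0 i) (D.dir 1 j)) : ℤ) else 0

/-- The way in which a link in space projects to a diagram. An edge of the diagram may be covered
by several edges of the link (bending in the vertical direction). -/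
structure Projection (D : LinkDiagram) (L : PolygonalLink) where
  /-- The edge of the diagram over which an edge of the link lies. -/
  edge : ∀ k, ZMod (L.comp k).n → ZMod (D.comp k).n
  /-- The times on that edge at which the projected edge of the link starts and ends. -/
  start : ∀ k, ZMod (L.comp k).n → ℝ
  finish : ∀ k, ZMod (L.comp k).n → ℝ
  start_nonneg : ∀ k j, 0 ≤ start k j
  start_lt : ∀ k j, start k j < finish k j
  finish_le : ∀ k j, finish k j ≤ 1
  start_eq : ∀ k j, ((L.comp k).vertex j).1 = AffineMap.lineMap
    ((D.comp k).vertex (edge k j)) ((D.comp k).vertex (edge k j + 1)) (start k j)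
  finish_eq : ∀ k j, ((L.comp k).vertex (j + 1)).1 = AffineMap.lineMap
    ((D.comp k).vertex (edge k j)) ((D.comp k).vertex (edge k j + 1)) (finish k j)
  /-- Consecutive edges of the link cover consecutive parts of the component of the diagram. -/
  succ : ∀ k j, (edge k (j + 1) = edge k j ∧ start k (j + 1) = finish k j) ∨
    (edge k (j + 1) = edge k j + 1 ∧ finish k j = 1 ∧ start k (j + 1) = 0)

/-- The parameter in the diagram of the projection of a point of the link. -/
def Projection.toParam {D : LinkDiagram} {L : PolygonalLink} (π : Projection D L) (p : L.Param) :
    D.Param :=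
  ⟨p.1, π.edge p.1 p.2.1,
    π.start p.1 p.2.1 + (p.2.2 : ℝ) * (π.finish p.1 p.2.1 - π.start p.1 p.2.1), by
      have h0 := π.start_nonneg p.1 p.2.1
      have h1 := π.start_lt p.1 p.2.1
      have h2 := π.finish_le p.1 p.2.1
      have h3 := p.2.2.2.1
      have h4 := p.2.2.2.2
      constructor
      · have := mul_nonneg h3 (sub_nonneg.2 h1.le)
        linarith
      · have := mul_lt_mul_of_pos_right h4 (sub_pos.2 h1)
        linarith⟩

/-- `D` is a diagram of `L`: the link projects onto the diagram, running through it exactly once,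
no vertex of the link lies over a crossing, and at every crossing the upper strand of the diagram is
the projection of the higher strand of the link. -/
def IsDiagramOf (D : LinkDiagram) (L : PolygonalLink) : Prop :=
  ∃ π : Projection D L, Function.Bijective π.toParam ∧
    (∀ k j, ((L.comp k).vertex j).1 ∉ D.crossings) ∧
    ∀ p q : L.Param, p ≠ q → (L.point p).1 = (L.point q).1 →
      (π.toParam p ∈ D.upper ↔ (L.point q).2 < (L.point p).2)

/-- Region crossing change is an unknotting operation on `D`: finitely many region crossing changes
turn `D` into a diagram of a trivial link. -/
def Unknottable (D : LinkDiagram) : Prop :=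
  ∃ D' : LinkDiagram, Relation.ReflTransGen RegionCrossingChange D D' ∧
    ∃ L : PolygonalLink, D'.IsDiagramOf L ∧ L.IsTrivial

end LinkDiagram

end RegionCrossing

open Filter Topology

/-! ### Parity of a segment: counting modulo two to the right of a point -/

namespace RegionCrossing

/-! Everything is counted modulo two. Call a crossing of the two components mixed. Since signs are
odd, the linking number has the parity of the number of mixed crossings at which component `0` is
above, the over-parity (`linkingNumber_cast`). Three facts carry the proof: region crossing changes
preserve the over-parity; on a connected diagram they realize every set of crossings with an even
number of mixed ones; diagrams of trivial links have over-parity zero, and every diagram turns into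
one of these by suitable crossing changes.

The first two facts rest on colourings, that is, functions `f` to `ZMod 2` that are locally constant
off the diagram, and on the corner sum of `f` at a crossing, the sum of its values in the four
corners. The jump of `f` across an edge is constant between crossings, is the same for the two edges
at a vertex, and changes by the corner sum at a crossing. Following it once around component `0`
shows that the corner sums at mixed crossings add up to zero (`sum_mixed_cornerSums`), as a
self-crossing is passed twice or never. At a mixed crossing the four corners lie in different
regions, so for the indicator of a region the corner sum is the incidence with that region; thus a
region has an even number of mixed crossings on its boundary.

For the realization, two chains of arcs of the diagram with the same boundary modulo two define a
colouring, with corner sums that detect where the arcs end (`Homologous.cornerSum`). Arcs of one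
component to the two passages through a self-crossing single out this crossing; arcs of both
components to `x`, compared with arcs of both components to `y`, single out a pair of mixed
crossings. Changing the crossings of all regions of colour one realizes the corner sums, except
where one region fills two opposite corners of a crossing, because it changes that crossing only
once. Such a crossing can be changed alone (`Separates.single_mem`): a closed curve inside the
region and through the crossing cuts the diagram in two, and a checkerboard colouring on one side of
the curve has corner sum one at this crossing and zero elsewhere. The errors come from crossings of
the same kind on that side; connectedness makes the sides nested (`side_subset_side`), so an
induction removes them.

A trivial link over a given projection is obtained by lifting both polygons to towers, one above the
other, with heights increasing except along the last edge (`Towers.isTrivial`). Conversely, the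
parity of crossings with component `0` above does not change in a triangle move: the triangle is
disjoint from the edges of the other component, and each such edge crosses its sides in a way that
depends only on the two ends of the edge (`crosses_parity`), which cancels around the closed
polygon. As intermediate links need not project generically, they are all sheared by a small amount
first; a small shear does not affect the crossings of the diagram itself. -/

theorem det_sub_sub_comm (a b z : Plane) : det (a - b) (z - b) = -det (b - a) (z - a) := by
  simp only [det, Prod.fst_sub, Prod.snd_sub]; ring

theorem continuous_det {X : Type*} [TopologicalSpace X] {f g : X → Plane} (hf : Continuous f)
    (hg : Continuous g) : Continuous fun x => det (f x) (g x) := by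
  unfold det; fun_prop

open Classical in
/-- Indicator of the half-open strip to the left of the segment from `a` to `b`. -/
noncomputable def sweep (a b z : Plane) : ZMod 2 :=
  if (a.2 ≤ z.2 ∧ z.2 < b.2 ∧ 0 < det (b - a) (z - a)) ∨
    (b.2 ≤ z.2 ∧ z.2 < a.2 ∧ det (b - a) (z - a) < 0) then 1 else 0

open Classical in
/-- The contribution of an end point `a` of a segment to the jumps of `sweep` near `z₀`. -/
noncomputable def levelJump (z₀ a z : Plane) : ZMod 2 :=
  if a.2 = z₀.2 ∧ z₀.1 < a.1 ∧ a.2 ≤ z.2 then 1 else 0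

theorem sweep_comm (a b z : Plane) : sweep a b z = sweep b a z := by
  unfold sweep
  rw [det_sub_sub_comm a b z]
  congr 1
  simp only [Left.neg_pos_iff, Left.neg_neg_iff, eq_iff_iff]
  tauto

theorem mem_segment_of_level {a b z : Plane} (h : a.2 < b.2) (h1 : a.2 ≤ z.2) (h2 : z.2 ≤ b.2)
    (h3 : det (b - a) (z - a) = 0) : z ∈ segment ℝ a b := by
  have hp : 0 < b.2 - a.2 := sub_pos.2 h
  rw [segment_eq_image_lineMap]
  refine ⟨(z.2 - a.2) / (b.2 - a.2), ⟨div_nonneg (by linarith) hp.le, ?_⟩, ?_⟩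
  · rw [div_le_one hp]; linarith
  · simp only [det, Prod.fst_sub, Prod.snd_sub] at h3
    ext
    · simp [AffineMap.lineMap_apply]
      field_simp
      linarith
    · simp [AffineMap.lineMap_apply]
      field_simp
      ring

theorem mem_segment_of_horizontal {a b z : Plane} (h : a.2 = b.2) (h1 : z.2 = a.2)
    (h2 : a.1 ≤ z.1) (h3 : z.1 ≤ b.1) : z ∈ segment ℝ a b := by
  rcases eq_or_lt_of_le (h2.trans h3) with hab | hab
  · have : z = a := Prod.ext (by linarith) h1
    rw [this]; exact left_mem_segment ℝ a b
  · have hp : 0 < b.1 - a.1 := sub_pos.2 hab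
    rw [segment_eq_image_lineMap]
    refine ⟨(z.1 - a.1) / (b.1 - a.1), ⟨div_nonneg (by linarith) hp.le, ?_⟩, ?_⟩
    · rw [div_le_one hp]; linarith
    · ext
      · simp [AffineMap.lineMap_apply]
        field_simp
        ring
      · simp [AffineMap.lineMap_apply, h, h1]

/-- Away from the segment, `sweep` is locally constant up to the jumps of the two end points. -/
theorem sweep_eventually {a b z₀ : Plane} (hz : z₀ ∉ segment ℝ a b) :
    ∃ κ : ZMod 2, ∀ᶠ z in 𝓝 z₀, sweep a b z = κ + levelJump z₀ a z + levelJump z₀ b z := by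
  wlog h : a.2 ≤ b.2 generalizing a b
  · obtain ⟨κ, hκ⟩ := this (by rwa [segment_symm]) (le_of_not_ge h)
    refine ⟨κ, hκ.mono fun z hz => ?_⟩
    rw [sweep_comm, hz]; ring
  have c2 : Continuous fun z : Plane => z.2 := continuous_snd
  have cd : Continuous fun z : Plane => det (b - a) (z - a) :=
    continuous_det continuous_const (by fun_prop)
  -- A horizontal segment sweeps nothing. If `z₀` is at its height but not on it, both end points
  -- are on the same side of `z₀`, and their level jumps cancel.
  rcases eq_or_lt_of_le h with h | h
  · have hs : ∀ z, sweep a b z = 0 := fun z => if_neg (by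
      rintro (⟨h1, h2, -⟩ | ⟨h1, h2, -⟩) <;> linarith)
    refine ⟨0, .of_forall fun z => ?_⟩
    have : levelJump z₀ a z = levelJump z₀ b z := by
      unfold levelJump
      congr 1
      rw [h]
      by_cases h0 : b.2 = z₀.2
      · have : z₀.1 < a.1 ↔ z₀.1 < b.1 := by
          constructor
          · intro h1
            by_contra! h2
            rw [segment_symm] at hz
            exact hz (mem_segment_of_horizontal h.symm h0.symm h2 h1.le)
          · intro h1
            by_contra! h2
            exact hz (mem_segment_of_horizontal h (by rw [h, h0]) h2 h1.le)
        simp [this]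
      · simp [h0]
    rw [hs, this, zero_add, CharTwo.add_self_eq_zero]
  have key : ∀ z, sweep a b z = if a.2 ≤ z.2 ∧ z.2 < b.2 ∧ 0 < det (b - a) (z - a) then 1 else 0 := by
    intro z
    unfold sweep
    congr 1
    rw [eq_iff_iff, or_iff_left]
    rintro ⟨h1, h2, -⟩; linarith
  have hJ : ∀ v : Plane, v.2 ≠ z₀.2 → ∀ z, levelJump z₀ v z = 0 := fun v hv z =>
    if_neg fun h => hv h.1
  -- Only at the height of an end point can there be a jump off the segment, and only if this end
  -- point lies to the right of `z₀`.
  rcases lt_trichotomy z₀.2 a.2 with h1 | h1 | h1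
  · refine ⟨0, ?_⟩
    filter_upwards [c2.continuousAt.eventually_lt continuousAt_const h1] with z hz
    rw [key, hJ a h1.ne', hJ b (by linarith), if_neg (by intro h; linarith)]
    rfl
  · refine ⟨0, ?_⟩
    have hd : det (b - a) (z₀ - a) = (b.2 - a.2) * (a.1 - z₀.1) := by
      simp only [det, Prod.fst_sub, Prod.snd_sub, h1]; ring
    rcases lt_trichotomy z₀.1 a.1 with h3 | h3 | h3
    · have : 0 < det (b - a) (z₀ - a) := hd ▸ mul_pos (sub_pos.2 h) (sub_pos.2 h3)
      filter_upwards [c2.continuousAt.eventually_lt continuousAt_const (h1.trans_lt h),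
        continuousAt_const.eventually_lt cd.continuousAt this] with z hz1 hz2
      rw [key, hJ b (by linarith)]
      simp [levelJump, hz1, hz2, h1, h3]
    · have : z₀ = a := Prod.ext h3 h1
      exact absurd (this ▸ left_mem_segment ℝ a b) hz
    · have : det (b - a) (z₀ - a) < 0 :=
        hd ▸ mul_neg_of_pos_of_neg (sub_pos.2 h) (sub_neg.2 h3)
      filter_upwards [cd.continuousAt.eventually_lt continuousAt_const this] with z hz2
      rw [key, hJ b (by linarith)]
      simp [levelJump, hz2.not_gt, h3.not_gt]
  rcases lt_trichotomy z₀.2 b.2 with h2 | h2 | h2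
  · rcases lt_trichotomy 0 (det (b - a) (z₀ - a)) with h3 | h3 | h3
    · refine ⟨1, ?_⟩
      filter_upwards [c2.continuousAt.eventually_lt continuousAt_const h2,
        continuousAt_const.eventually_lt c2.continuousAt h1,
        continuousAt_const.eventually_lt cd.continuousAt h3] with z hz1 hz2 hz3
      rw [key, hJ a (by linarith), hJ b (by linarith), if_pos ⟨hz2.le, hz1, hz3⟩]
      rfl
    · exact absurd (mem_segment_of_level h h1.le h2.le h3.symm) hz
    · refine ⟨0, ?_⟩
      filter_upwards [cd.continuousAt.eventually_lt continuousAt_const h3] with z hz3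
      rw [key, hJ a (by linarith), hJ b (by linarith), if_neg (by intro h; linarith)]
      rfl
  · have hd : det (b - a) (z₀ - a) = (b.2 - a.2) * (b.1 - z₀.1) := by
      simp only [det, Prod.fst_sub, Prod.snd_sub, h2]; ring
    rcases lt_trichotomy z₀.1 b.1 with h3 | h3 | h3
    · refine ⟨1, ?_⟩
      have : 0 < det (b - a) (z₀ - a) := hd ▸ mul_pos (sub_pos.2 h) (sub_pos.2 h3)
      filter_upwards [continuousAt_const.eventually_lt c2.continuousAt h1,
        continuousAt_const.eventually_lt cd.continuousAt this] with z hz1 hz2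
      rw [key, hJ a (by linarith)]
      by_cases h4 : b.2 ≤ z.2
      · simp [levelJump, hz1.le, hz2, h4, h4.not_gt, h2, h3]; rfl
      · simp [levelJump, hz1.le, hz2, h4, not_le.1 h4, h2, h3]
    · have : z₀ = b := Prod.ext h3 h2
      exact absurd (this ▸ right_mem_segment ℝ a b) hz
    · refine ⟨0, ?_⟩
      have : det (b - a) (z₀ - a) < 0 :=
        hd ▸ mul_neg_of_pos_of_neg (sub_pos.2 h) (sub_neg.2 h3)
      filter_upwards [cd.continuousAt.eventually_lt continuousAt_const this] with z hz2
      rw [key, hJ a (by linarith)]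
      simp [levelJump, hz2.not_gt, h3.not_gt]
  · refine ⟨0, ?_⟩
    filter_upwards [continuousAt_const.eventually_lt c2.continuousAt h2] with z hz
    rw [key, hJ a (by linarith), hJ b (by linarith), if_neg (by intro h; linarith)]
    rfl

/-- `sweep` changes across the segment, up to the jumps of the two end points. -/
theorem sweep_jump {a b z₀ η : Plane} (hz : z₀ ∈ openSegment ℝ a b) (hη : det (b - a) η ≠ 0) :
    ∀ᶠ δ : ℝ in 𝓝[>] 0, sweep a b (z₀ + δ • η) + sweep a b (z₀ - δ • η) =
      1 + (levelJump z₀ a (z₀ + δ • η) + levelJump z₀ b (z₀ + δ • η)) +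
        (levelJump z₀ a (z₀ - δ • η) + levelJump z₀ b (z₀ - δ • η)) := by
  wlog h : a.2 ≤ b.2 generalizing a b
  · have := this (a := b) (b := a) (by rwa [openSegment_symm]) (by
      have : det (a - b) η = - det (b - a) η := by
        simp only [det, Prod.fst_sub, Prod.snd_sub]; ring
      rwa [this, neg_ne_zero]) (le_of_not_ge h)
    refine this.mono fun δ hδ => ?_
    rw [sweep_comm a b, sweep_comm a b, hδ]; ring
  rw [openSegment_eq_image_lineMap] at hz
  obtain ⟨l, ⟨hl0, hl1⟩, rfl⟩ := hz
  set z₀ := AffineMap.lineMap a b l with hz₀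
  have e1 : z₀.1 = a.1 + l * (b.1 - a.1) := by simp [hz₀, AffineMap.lineMap_apply]; ring
  have e2 : z₀.2 = a.2 + l * (b.2 - a.2) := by simp [hz₀, AffineMap.lineMap_apply]; ring
  rcases eq_or_lt_of_le h with h | h
  · have hs : ∀ z, sweep a b z = 0 := fun z => if_neg (by
      rintro (⟨h1, h2, -⟩ | ⟨h1, h2, -⟩) <;> linarith)
    have hb : b.2 = z₀.2 := by rw [e2, h]; ring
    have ha : a.2 = z₀.2 := h.trans hb
    have hd : (b.1 - a.1) * η.2 ≠ 0 := by
      simpa [det, h] using hη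
    have h1 := left_ne_zero_of_mul hd
    have h2 := right_ne_zero_of_mul hd
    filter_upwards [self_mem_nhdsWithin] with δ hδ
    replace hδ : 0 < δ := hδ
    -- For a horizontal segment `sweep` vanishes and the jump comes from the end points: exactly one
    -- of them lies to the right of `z₀`, and exactly one of `z₀ ± δ • η` is at the height of `z₀`
    -- or above.
    have hx : (z₀.1 < a.1 ↔ ¬ z₀.1 < b.1) := by
      rcases lt_or_gt_of_ne h1 with h1 | h1
      · have := mul_neg_of_pos_of_neg hl0 h1
        have := mul_neg_of_pos_of_neg (sub_pos.2 hl1) h1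
        constructor <;> intro _ <;> linarith
      · have := mul_pos hl0 h1
        have := mul_pos (sub_pos.2 hl1) h1
        constructor
        · intro _; linarith
        · intro h; exact absurd (by linarith) h
    have hy : (0 ≤ δ * η.2 ↔ ¬ δ * η.2 ≤ 0) := by
      rcases lt_or_gt_of_ne (mul_ne_zero hδ.ne' h2) with h1 | h1
      · simp [h1.le, h1]
      · simp [h1.le, h1]
    rw [hs, hs]
    simp only [levelJump, ha, hb, Prod.snd_add, Prod.snd_sub, Prod.smul_snd, smul_eq_mul,
      le_add_iff_nonneg_right, le_sub_self_iff, true_and, hx, hy]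
    by_cases c1 : z₀.1 < b.1 <;> by_cases c2 : δ * η.2 ≤ 0 <;> simp [c1, c2] <;> rfl
  · have h1 : a.2 < z₀.2 := by rw [e2]; nlinarith
    have h2 : z₀.2 < b.2 := by rw [e2]; nlinarith
    have hJ : ∀ v : Plane, v.2 ≠ z₀.2 → ∀ z, levelJump z₀ v z = 0 := fun v hv z =>
      if_neg fun h => hv h.1
    have hp : Tendsto (fun δ : ℝ => (z₀ + δ • η).2) (𝓝[>] 0) (𝓝 z₀.2) := by
      have : Continuous fun δ : ℝ => (z₀ + δ • η).2 := by fun_prop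
      simpa using (this.tendsto 0).mono_left nhdsWithin_le_nhds
    have hm : Tendsto (fun δ : ℝ => (z₀ - δ • η).2) (𝓝[>] 0) (𝓝 z₀.2) := by
      have : Continuous fun δ : ℝ => (z₀ - δ • η).2 := by fun_prop
      simpa using (this.tendsto 0).mono_left nhdsWithin_le_nhds
    filter_upwards [self_mem_nhdsWithin, hp.eventually_lt_const h2, hp.eventually_const_lt h1,
      hm.eventually_lt_const h2, hm.eventually_const_lt h1] with δ hδ q1 q2 q3 q4
    replace hδ : 0 < δ := hδ
    have d1 : det (b - a) (z₀ + δ • η - a) = δ * det (b - a) η := by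
      simp only [det, Prod.fst_sub, Prod.snd_sub, Prod.fst_add, Prod.snd_add, Prod.smul_fst,
        Prod.smul_snd, e1, e2, smul_eq_mul]; ring
    have d2 : det (b - a) (z₀ - δ • η - a) = -(δ * det (b - a) η) := by
      simp only [det, Prod.fst_sub, Prod.snd_sub, Prod.smul_fst,
        Prod.smul_snd, e1, e2, smul_eq_mul]; ring
    rw [hJ a h1.ne, hJ b h2.ne', hJ a h1.ne, hJ b h2.ne']
    simp only [sweep, d1, d2, q1, q2.le, q3, q4.le, true_and, q1.not_ge, q3.not_ge, false_and, or_false,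
      Left.neg_pos_iff]
    rcases lt_or_gt_of_ne (mul_ne_zero hδ.ne' hη) with h3 | h3
    · simp [h3, h3.not_gt]
    · simp [h3, h3.not_gt]

end RegionCrossing

/-! ### Edges and parameters of a diagram, and charts at its crossings -/

namespace RegionCrossing

namespace PolygonPair

variable {V : Type}

/-- The edges of a pair of closed polygons. -/
abbrev Edge (P : PolygonPair V) : Type := Σ k : Fin 2, ZMod (P.comp k).n

/-- The initial vertex of an edge. -/
def src (P : PolygonPair V) (e : P.Edge) : V := (P.comp e.1).vertex e.2

/-- The next edge of the polygon. -/
def next (P : PolygonPair V) (e : P.Edge) : P.Edge := ⟨e.1, e.2 + 1⟩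

/-- The edge of a parameter. -/
def edgeOf (P : PolygonPair V) (p : P.Param) : P.Edge := ⟨p.1, p.2.1⟩

/-- The parameter at a given time on a given edge. -/
def param (P : PolygonPair V) (e : P.Edge) (t : ℝ) (h : t ∈ Set.Ico (0 : ℝ) 1) : P.Param :=
  ⟨e.1, e.2, t, h⟩

variable (P : PolygonPair V)

@[simp] theorem edgeOf_param (e : P.Edge) (t : ℝ) (h) : P.edgeOf (P.param e t h) = e := rfl

theorem param_ext {p q : P.Param} (h : P.edgeOf p = P.edgeOf q) (h' : (p.2.2 : ℝ) = q.2.2) :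
    p = q := by
  obtain ⟨k, i, t⟩ := p
  obtain ⟨l, j, s⟩ := q
  simp only [edgeOf, Sigma.mk.injEq] at h
  obtain ⟨rfl, h⟩ := h
  obtain rfl := eq_of_heq h
  obtain rfl := Subtype.ext h'
  rfl

variable [AddCommGroup V] [Module ℝ V]

/-- The point at time `t` on the line through an edge. -/
noncomputable def along (e : P.Edge) (t : ℝ) : V :=
  AffineMap.lineMap ((P.comp e.1).vertex e.2) ((P.comp e.1).vertex (e.2 + 1)) t

/-- The direction of an edge. -/
def vec (e : P.Edge) : V := P.dir e.1 e.2

theorem along_eq (e : P.Edge) (t : ℝ) : P.along e t = P.src e + t • P.vec e := by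
  simp [along, src, vec, dir, AffineMap.lineMap_apply, add_comm]

theorem point_eq_along (p : P.Param) : P.point p = P.along (P.edgeOf p) p.2.2 := rfl

@[simp] theorem point_param (e : P.Edge) (t : ℝ) (h) : P.point (P.param e t h) = P.along e t := rfl

theorem along_zero (e : P.Edge) : P.along e 0 = P.src e := by simp [along, src]

theorem along_one (e : P.Edge) : P.along e 1 = P.src (P.next e) := by simp [along, src, next]

theorem src_mem_support (e : P.Edge) : P.src e ∈ P.support :=
  ⟨P.param e 0 (by simp), P.along_zero e⟩

theorem along_mem_support (e : P.Edge) {t : ℝ} (ht : t ∈ Set.Icc (0 : ℝ) 1) :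
    P.along e t ∈ P.support := by
  rcases eq_or_lt_of_le ht.2 with rfl | h
  · rw [along_one]; exact P.src_mem_support _
  · exact ⟨P.param e t ⟨ht.1, h⟩, rfl⟩

/-- The closed edge as a set of points. -/
def edgeSet (e : P.Edge) : Set V := segment ℝ (P.src e) (P.src (P.next e))

theorem edgeSet_eq (e : P.Edge) : P.edgeSet e = P.along e '' Set.Icc 0 1 :=
  segment_eq_image_lineMap ℝ _ _

theorem point_mem_edgeSet (p : P.Param) : P.point p ∈ P.edgeSet (P.edgeOf p) := by
  rw [edgeSet_eq]
  exact ⟨p.2.2, ⟨p.2.2.2.1, p.2.2.2.2.le⟩, rfl⟩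

theorem edgeSet_subset (e : P.Edge) : P.edgeSet e ⊆ P.support := by
  rw [edgeSet_eq]
  rintro _ ⟨t, ht, rfl⟩
  exact P.along_mem_support e ht

/-- A point on a closed edge has a parameter on that edge, or one at the start of the next edge. -/
theorem exists_param_of_mem_edgeSet {e : P.Edge} {z : V} (hz : z ∈ P.edgeSet e) :
    ∃ p : P.Param, P.point p = z ∧ (P.edgeOf p = e ∨
      P.edgeOf p = P.next e ∧ (p.2.2 : ℝ) = 0) := by
  rw [edgeSet_eq] at hz
  obtain ⟨t, ht, rfl⟩ := hz
  rcases eq_or_lt_of_le ht.2 with rfl | h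
  · exact ⟨P.param (P.next e) 0 (by simp), by simp [along_zero, along_one], Or.inr ⟨rfl, rfl⟩⟩
  · exact ⟨P.param e t ⟨ht.1, h⟩, rfl, Or.inl rfl⟩

end PolygonPair

theorem isClosed_edgeSet (P : PolygonPair Plane) (e : P.Edge) : IsClosed (P.edgeSet e) := by
  rw [P.edgeSet_eq]
  refine (isCompact_Icc.image ?_).isClosed
  simp only [funext (P.along_eq e)]
  fun_prop

/-- Near a point, only the edges through that point are visible. -/
theorem eventually_mem_edgeSet (P : PolygonPair Plane) (z₀ : Plane) :
    ∀ᶠ z in 𝓝 z₀, ∀ e, z ∈ P.edgeSet e → z₀ ∈ P.edgeSet e := by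
  refine eventually_all.2 fun e => ?_
  by_cases h : z₀ ∈ P.edgeSet e
  · exact .of_forall fun _ _ => h
  · filter_upwards [(isClosed_edgeSet P e).isOpen_compl.mem_nhds h] with z hz hz'
    exact absurd hz' hz

theorem support_eq_iUnion (P : PolygonPair Plane) : P.support = ⋃ e, P.edgeSet e := by
  refine subset_antisymm ?_ (Set.iUnion_subset P.edgeSet_subset)
  rintro _ ⟨p, rfl⟩
  exact Set.mem_iUnion.2 ⟨_, P.point_mem_edgeSet p⟩

theorem isCompact_support (P : PolygonPair Plane) : IsCompact P.support := by
  rw [support_eq_iUnion]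
  refine isCompact_iUnion fun e => ?_
  rw [P.edgeSet_eq]
  refine isCompact_Icc.image ?_
  simp only [funext (P.along_eq e)]
  fun_prop

theorem isOpen_compl_support (P : PolygonPair Plane) : IsOpen P.supportᶜ :=
  (isCompact_support P).isClosed.isOpen_compl

theorem det_add_left (a b c : Plane) : det (a + b) c = det a c + det b c := by
  simp [det]; ring

theorem det_smul_left (r : ℝ) (b c : Plane) : det (r • b) c = r * det b c := by
  simp [det]; ring

theorem det_add_right (a b c : Plane) : det a (b + c) = det a b + det a c := by
  simp [det]; ring

theorem det_smul_right (r : ℝ) (b c : Plane) : det b (r • c) = r * det b c := by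
  simp [det]; ring

theorem det_self (a : Plane) : det a a = 0 := by
  simp [det]; ring

theorem det_comm (a b : Plane) : det a b = -det b a := by
  simp [det]; ring

theorem coord_unique {u w : Plane} (h : det u w ≠ 0) {s t s' t' : ℝ}
    (he : s • u + t • w = s' • u + t' • w) : s = s' ∧ t = t' := by
  have h1 := congrArg (fun z => det z w) he
  have h2 := congrArg (fun z => det u z) he
  simp only [det_add_left, det_smul_left, det_add_right, det_smul_right, det_self, mul_zero,
    add_zero, zero_add] at h1 h2
  exact ⟨mul_right_cancel₀ h h1, mul_right_cancel₀ h h2⟩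

theorem eq_coord {u w : Plane} (h : det u w ≠ 0) (z : Plane) :
    z = (det z w / det u w) • u + (det u z / det u w) • w := by
  ext
  all_goals
    simp only [Prod.fst_add, Prod.snd_add, Prod.smul_fst, Prod.smul_snd, smul_eq_mul]
    rw [div_mul_eq_mul_div, div_mul_eq_mul_div, ← add_div, eq_div_iff h]
    simp only [det]
    ring

namespace LinkDiagram

variable (D : LinkDiagram)

/-- On an edge of length zero all parameters would give one point, so its initial vertex would be a
multiple point. -/
theorem vec_ne_zero (e : D.Edge) : D.vec e ≠ 0 := by
  intro h
  have h0 : (0 : ℝ) ∈ Set.Ico (0 : ℝ) 1 := by simp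
  have h1 : (1 / 2 : ℝ) ∈ Set.Ico (0 : ℝ) 1 := by constructor <;> norm_num
  have := (D.transverse (D.param e 0 h0) (D.param e (1 / 2) h1) ?_ ?_).1
  · exact lt_irrefl _ this
  · intro h
    have : (0 : ℝ) = 1 / 2 := congrArg (fun p : D.Param => (p.2.2 : ℝ)) h
    norm_num at this
  · simp [D.along_eq, h]

theorem along_injective (e : D.Edge) : Function.Injective (D.along e) := by
  intro s t h
  rw [D.along_eq, D.along_eq, add_right_inj] at h
  exact smul_left_injective ℝ (D.vec_ne_zero e) h

/-- `p` and `q` are the two strands at a crossing. -/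
def Cross (p q : D.Param) : Prop := p ≠ q ∧ D.point p = D.point q

variable {D}

theorem Cross.symm {p q : D.Param} (h : D.Cross p q) : D.Cross q p := ⟨h.1.symm, h.2.symm⟩

theorem Cross.mem {p q : D.Param} (h : D.Cross p q) : D.point p ∈ D.crossings :=
  ⟨p, q, h.1, rfl, h.2.symm⟩

theorem mem_crossings {x : Plane} : x ∈ D.crossings ↔ ∃ p q, D.Cross p q ∧ D.point p = x :=
  ⟨fun ⟨p, q, h, hp, hq⟩ => ⟨p, q, ⟨h, hp.trans hq.symm⟩, hp⟩,
    fun ⟨p, q, h, hp⟩ => ⟨p, q, h.1, hp, h.2 ▸ hp⟩⟩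

theorem Cross.pos {p q : D.Param} (h : D.Cross p q) : 0 < (p.2.2 : ℝ) :=
  (D.transverse p q h.1 h.2).1

theorem Cross.det_ne {p q : D.Param} (h : D.Cross p q) :
    det (D.vec (D.edgeOf p)) (D.vec (D.edgeOf q)) ≠ 0 :=
  (D.transverse p q h.1 h.2).2.2

theorem Cross.eq_or_eq {p q r : D.Param} (h : D.Cross p q) (hr : D.point r = D.point p) :
    r = p ∨ r = q := by
  by_contra! hc
  exact D.double p q r h.1 hc.1.symm hc.2.symm ⟨h.2, hr.symm⟩

theorem Cross.eq_of_left {p q r : D.Param} (h : D.Cross p q) (hr : D.Cross p r) : r = q := by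
  rcases h.eq_or_eq hr.2.symm with h' | h'
  · exact absurd h'.symm hr.1
  · exact h'

theorem crossings_subset : D.crossings ⊆ D.support := by
  rintro _ ⟨p, q, -, rfl, -⟩
  exact ⟨p, rfl⟩

/-- Both strands at a crossing have positive time, whereas a vertex has a parameter of time `0`,
which would be a third one. -/
theorem src_notMem_crossings (e : D.Edge) : D.src e ∉ D.crossings := by
  intro h
  obtain ⟨p, q, h, hp⟩ := mem_crossings.1 h
  have h0 : (0 : ℝ) ∈ Set.Ico (0 : ℝ) 1 := by simp
  rcases h.eq_or_eq (r := D.param e 0 h0) (by rw [hp, D.point_param, D.along_zero]) with h' | h'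
  · exact lt_irrefl _ (h' ▸ h.pos : (0 : ℝ) < (D.param e 0 h0).2.2)
  · exact lt_irrefl _ (h' ▸ h.symm.pos : (0 : ℝ) < (D.param e 0 h0).2.2)

/-- The chart at a crossing: within distance `ε` of the crossing in the coordinates given by its two
strands, only those two strands are visible. -/
def Chart (D : LinkDiagram) (p q : D.Param) (ε : ℝ) : Prop :=
  0 < ε ∧ (∀ r, r = p ∨ r = q → ε < (r.2.2 : ℝ) ∧ (r.2.2 : ℝ) + ε < 1) ∧ ∀ s t : ℝ, |s| < ε → |t| < ε → ∀ r : D.Param,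
    D.point r = D.point p + (s • D.vec (D.edgeOf p) + t • D.vec (D.edgeOf q)) →
      (D.edgeOf r = D.edgeOf p ∧ (r.2.2 : ℝ) = p.2.2 + s ∧ t = 0) ∨
      (D.edgeOf r = D.edgeOf q ∧ (r.2.2 : ℝ) = q.2.2 + t ∧ s = 0)

theorem Chart.symm {p q : D.Param} {ε : ℝ} (h : D.Chart p q ε) (hpq : D.point p = D.point q) :
    D.Chart q p ε :=
  ⟨h.1, fun r hr => h.2.1 r hr.symm, fun s t hs ht r hr =>
    (h.2.2 t s ht hs r (by rw [hr, hpq, add_comm (s • _)])).symm⟩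

theorem eventually_coord (x u w : Plane) {P : Plane → Prop} (h : ∀ᶠ z in 𝓝 x, P z) :
    ∃ ε > 0, ∀ s t : ℝ, |s| < ε → |t| < ε → P (x + (s • u + t • w)) := by
  have hc : Continuous fun st : ℝ × ℝ => x + (st.1 • u + st.2 • w) := by fun_prop
  have := (hc.tendsto (0, 0)).eventually (p := P) (by simpa using h)
  obtain ⟨ε, hε, H⟩ := Metric.eventually_nhds_iff.1 this
  refine ⟨ε, hε, fun s t hs ht => @H (s, t) ?_⟩
  simp [Prod.dist_eq, hs, ht]

/-- Near a point only the closed edges through that point are visible, and through a crossing there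
are just the two edges of its strands. Points on these are located by uniqueness of coordinates. The
radius is also kept below the distance, in time, of both strands to the ends of their edges. -/
theorem Cross.exists_chart {p q : D.Param} (h : D.Cross p q) : ∃ ε, D.Chart p q ε := by
  obtain ⟨ε, hε, H⟩ := eventually_coord _ (D.vec (D.edgeOf p)) (D.vec (D.edgeOf q))
    (eventually_mem_edgeSet D.toPolygonPair (D.point p))
  obtain ⟨ε', hε', H'⟩ : ∃ ε' : ℝ, 0 < ε' ∧ ∀ r, r = p ∨ r = q →
      ε' < (r.2.2 : ℝ) ∧ (r.2.2 : ℝ) + ε' < 1 := by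
    have h1 := h.pos
    have h2 := h.symm.pos
    have h3 := p.2.2.2.2
    have h4 := q.2.2.2.2
    have : ∀ᶠ e : ℝ in 𝓝[>] 0, e ∈ Set.Ioi (0 : ℝ) ∧ e < (p.2.2 : ℝ) ∧ e < 1 - (p.2.2 : ℝ) ∧
        e < (q.2.2 : ℝ) ∧ e < 1 - (q.2.2 : ℝ) := by
      refine eventually_mem_nhdsWithin.and (nhdsWithin_le_nhds ?_)
      exact (eventually_lt_nhds h1).and ((eventually_lt_nhds (sub_pos.2 h3)).and
        ((eventually_lt_nhds h2).and (eventually_lt_nhds (sub_pos.2 h4))))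
    obtain ⟨e, he, e1, e2, e3, e4⟩ := this.exists
    refine ⟨e, he, fun r hr => ?_⟩
    rcases hr with rfl | rfl
    · exact ⟨e1, by linarith⟩
    · exact ⟨e3, by linarith⟩
  refine ⟨min ε ε', lt_min hε hε', fun r hr => ⟨(min_le_right _ _).trans_lt (H' r hr).1, by
    linarith [(H' r hr).2, min_le_right ε ε']⟩, fun s t hs ht r hr => ?_⟩
  have hs := hs.trans_le (min_le_left _ _)
  have ht := ht.trans_le (min_le_left _ _)
  have h1 := H s t hs ht (D.edgeOf r) (hr ▸ D.point_mem_edgeSet r)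
  obtain ⟨r', hr', hr''⟩ := D.exists_param_of_mem_edgeSet h1
  have h2 : D.edgeOf r = D.edgeOf p ∨ D.edgeOf r = D.edgeOf q := by
    rcases h.eq_or_eq hr' with rfl | rfl
    · exact Or.inl (hr''.resolve_right fun h' => h.pos.ne' h'.2).symm
    · exact Or.inr (hr''.resolve_right fun h' => h.symm.pos.ne' h'.2).symm
  refine h2.imp (fun he => ?_) (fun he => ?_)
  · rw [D.point_eq_along, D.point_eq_along, he, D.along_eq, D.along_eq, add_assoc,
      add_right_inj, ← add_assoc, ← add_smul] at hr
    have := coord_unique h.det_ne (s := r.2.2) (t := 0) (s' := p.2.2 + s) (t' := t) (by rw [zero_smul, add_zero]; exact hr)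
    exact ⟨he, this.1, this.2.symm⟩
  · rw [h.2, D.point_eq_along, D.point_eq_along, he, D.along_eq, D.along_eq, add_assoc,
      add_right_inj, add_left_comm, ← add_smul] at hr
    have := coord_unique h.det_ne (s := 0) (t := r.2.2) (s' := s) (t' := q.2.2 + t) (by rw [zero_smul, zero_add]; exact hr)
    exact ⟨he, this.2, this.1.symm⟩

/-- The crossings of a diagram are finite in number. -/
theorem finite_crossings : D.crossings.Finite := by
  classical
  have hsub : D.crossings ⊆ ⋃ ef : D.Edge × D.Edge,
      {x | ∃ p q, D.Cross p q ∧ D.edgeOf p = ef.1 ∧ D.edgeOf q = ef.2 ∧ D.point p = x} := by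
    intro x hx
    obtain ⟨p, q, h, hp⟩ := mem_crossings.1 hx
    exact Set.mem_iUnion.2 ⟨(D.edgeOf p, D.edgeOf q), p, q, h, rfl, rfl, hp⟩
  -- Non-parallel lines meet once, so each pair of edges contributes at most one crossing.
  refine (Set.finite_iUnion fun ef => Set.Subsingleton.finite ?_).subset hsub
  rintro _ ⟨p, q, h, hp, hq, rfl⟩ _ ⟨p', q', h', hp', hq', rfl⟩
  have e1 := h.2
  have e2 := h'.2
  have hd := h.det_ne
  rw [D.point_eq_along p, D.point_eq_along q, D.along_eq, D.along_eq, hp, hq] at e1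
  rw [D.point_eq_along p', D.point_eq_along q', D.along_eq, D.along_eq, hp', hq'] at e2
  rw [hp, hq] at hd
  have := coord_unique hd (s := (p.2.2 : ℝ) - p'.2.2) (t := (q'.2.2 : ℝ) - q.2.2) (s' := 0) (t' := 0) (by
    have e3 : ((p.2.2 : ℝ) - p'.2.2) • D.vec ef.1 + ((q'.2.2 : ℝ) - q.2.2) • D.vec ef.2 =
      (D.src ef.1 + (p.2.2 : ℝ) • D.vec ef.1 - (D.src ef.2 + (q.2.2 : ℝ) • D.vec ef.2)) -
      (D.src ef.1 + (p'.2.2 : ℝ) • D.vec ef.1 - (D.src ef.2 + (q'.2.2 : ℝ) • D.vec ef.2)) := by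
      module
    rw [e3, e1, e2]; simp)
  rw [D.point_eq_along, D.point_eq_along, hp, hp', sub_eq_zero.1 this.1]

end LinkDiagram

end RegionCrossing

/-! ### Colourings of the plane from chains of arcs modulo two -/

namespace RegionCrossing

namespace LinkDiagram

/-- A function that is locally constant on the complement of the diagram. -/
def LocConst (D : LinkDiagram) (f : Plane → ZMod 2) : Prop :=
  ∀ z ∈ D.supportᶜ, ∀ᶠ z' in 𝓝 z, f z' = f z

/-- The region containing a point. -/
def region (D : LinkDiagram) (z : Plane) : Set Plane := connectedComponentIn D.supportᶜ z

variable {D : LinkDiagram}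

theorem mem_region {z : Plane} (hz : z ∈ D.supportᶜ) : z ∈ D.region z := mem_connectedComponentIn hz

theorem isOpen_region (z : Plane) : IsOpen (D.region z) :=
  (isOpen_compl_support D.toPolygonPair).connectedComponentIn

theorem region_subset (z : Plane) : D.region z ⊆ D.supportᶜ := connectedComponentIn_subset _ _

theorem region_eq_of_mem {z z' : Plane} (h : z' ∈ D.region z) : D.region z' = D.region z :=
  (connectedComponentIn_eq h).symm

theorem eq_region_of_mem {R : Set Plane} (hR : R ∈ D.regions) {z : Plane} (h : z ∈ R) :
    R = D.region z := by
  obtain ⟨x, hx, rfl⟩ := hR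
  exact (region_eq_of_mem h).symm

theorem region_eq_of_segment {z z' : Plane} (h : segment ℝ z z' ⊆ D.supportᶜ) :
    D.region z = D.region z' := by
  refine (region_eq_of_mem ?_).symm
  exact (convex_segment z z').isPreconnected.subset_connectedComponentIn (left_mem_segment ℝ z z') h
    (right_mem_segment ℝ z z')

theorem LocConst.eq_of_region_eq {f : Plane → ZMod 2} (hf : D.LocConst f) {z z' : Plane}
    (hz : z ∈ D.supportᶜ) (hz' : z' ∈ D.supportᶜ) (h : D.region z = D.region z') : f z = f z' := by
  let _ : TopologicalSpace (ZMod 2) := ⊥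
  have : DiscreteTopology (ZMod 2) := ⟨rfl⟩
  have hc : ContinuousOn f (D.region z) := by
    intro y hy
    have := hf y (region_subset z hy)
    exact (tendsto_nhds_of_eventually_eq this).mono_left nhdsWithin_le_nhds
  exact isPreconnected_connectedComponentIn.constant hc (mem_region hz)
    (show z' ∈ D.region z by rw [h]; exact mem_region hz')

/-! ### Parity functions of chains of edges -/

/-- The parity of the chain consisting of the initial parts up to time `τ e` of all edges `e`. -/
noncomputable def cutSweep (D : LinkDiagram) (τ : D.Edge → ℝ) (z : Plane) : ZMod 2 :=
  ∑ e, sweep (D.src e) (D.along e (τ e)) z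

/-- The boundary of the chain of `cutSweep`, as a functional on functions of points. -/
noncomputable def cutBoundary (D : LinkDiagram) (τ : D.Edge → ℝ) (φ : Plane → ZMod 2) : ZMod 2 :=
  ∑ e, (φ (D.src e) + φ (D.along e (τ e)))

theorem segment_along_subset (e : D.Edge) {t : ℝ} (ht : t ∈ Set.Icc (0 : ℝ) 1) :
    segment ℝ (D.src e) (D.along e t) ⊆ D.edgeSet e := by
  refine (convex_segment _ _).segment_subset (left_mem_segment ℝ _ _) ?_
  rw [← PolygonPair.edgeSet, D.edgeSet_eq]
  exact ⟨t, ht, rfl⟩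

/-- A point off the diagram is off every segment of the chain, so that only the level jumps of end
points remain. They add up to the boundary of the chain. -/
theorem cutSweep_eventually {τ : D.Edge → ℝ} (hτ : ∀ e, τ e ∈ Set.Icc (0 : ℝ) 1) {z₀ : Plane}
    (hz : z₀ ∈ D.supportᶜ) : ∃ κ, ∀ᶠ z in 𝓝 z₀,
      D.cutSweep τ z = κ + D.cutBoundary τ fun a => levelJump z₀ a z := by
  have : ∀ e, ∃ κ : ZMod 2, ∀ᶠ z in 𝓝 z₀, sweep (D.src e) (D.along e (τ e)) z =
      κ + levelJump z₀ (D.src e) z + levelJump z₀ (D.along e (τ e)) z := fun e =>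
    sweep_eventually fun h => hz (D.edgeSet_subset e (segment_along_subset e (hτ e) h))
  choose κ hκ using this
  refine ⟨∑ e, κ e, (eventually_all.2 hκ).mono fun z hz => ?_⟩
  simp only [cutSweep, cutBoundary, ← Finset.sum_add_distrib]
  exact Finset.sum_congr rfl fun e _ => by rw [hz e, add_assoc]

theorem notMem_edgeSet_of_notMem_crossings {p : D.Param} (h0 : 0 < (p.2.2 : ℝ))
    (hp : D.point p ∉ D.crossings) {e : D.Edge} (he : e ≠ D.edgeOf p) : D.point p ∉ D.edgeSet e := by
  intro h
  obtain ⟨r, hr, hr'⟩ := D.exists_param_of_mem_edgeSet h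
  have : r = p := by
    by_contra hne
    exact hp (Cross.mem ⟨fun h => hne h.symm, hr.symm⟩)
  subst this
  rcases hr' with h | h
  · exact he h.symm
  · exact h0.ne' h.2

open Classical in
-- Only the edge of `p` matters. If it is cut beyond `p`, then `p` is interior to the segment and
-- `sweep_jump` yields the `1`; if it is cut before `p`, and for all other edges, the point is off
-- the segment.
theorem cutSweep_jump {τ : D.Edge → ℝ} (hτ : ∀ e, τ e ∈ Set.Icc (0 : ℝ) 1) {p : D.Param}
    (h0 : 0 < (p.2.2 : ℝ)) (hp : D.point p ∉ D.crossings) {η : Plane}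
    (hη : det (D.vec (D.edgeOf p)) η ≠ 0) (hne : τ (D.edgeOf p) ≠ p.2.2) :
    ∀ᶠ δ : ℝ in 𝓝[>] 0,
      D.cutSweep τ (D.point p + δ • η) + D.cutSweep τ (D.point p - δ • η) =
        (if (p.2.2 : ℝ) < τ (D.edgeOf p) then 1 else 0) +
          (D.cutBoundary τ fun a => levelJump (D.point p) a (D.point p + δ • η)) +
          (D.cutBoundary τ fun a => levelJump (D.point p) a (D.point p - δ • η)) := by
  set x := D.point p with hx
  have hpl : Tendsto (fun δ : ℝ => x + δ • η) (𝓝[>] 0) (𝓝 x) := by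
    have : Continuous fun δ : ℝ => x + δ • η := by fun_prop
    simpa using (this.tendsto 0).mono_left nhdsWithin_le_nhds
  have hmi : Tendsto (fun δ : ℝ => x - δ • η) (𝓝[>] 0) (𝓝 x) := by
    have : Continuous fun δ : ℝ => x - δ • η := by fun_prop
    simpa using (this.tendsto 0).mono_left nhdsWithin_le_nhds
  have off : ∀ e, x ∉ segment ℝ (D.src e) (D.along e (τ e)) → ∀ᶠ δ : ℝ in 𝓝[>] 0,
      sweep (D.src e) (D.along e (τ e)) (x + δ • η) + sweep (D.src e) (D.along e (τ e)) (x - δ • η) =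
      (levelJump x (D.src e) (x + δ • η) + levelJump x (D.along e (τ e)) (x + δ • η)) +
      (levelJump x (D.src e) (x - δ • η) + levelJump x (D.along e (τ e)) (x - δ • η)) := by
    intro e he
    obtain ⟨κ, hκ⟩ := sweep_eventually he
    filter_upwards [hpl.eventually hκ, hmi.eventually hκ] with δ h1 h2
    rw [h1, h2]
    have := CharTwo.add_self_eq_zero κ
    linear_combination this
  have key : ∀ e, ∀ᶠ δ : ℝ in 𝓝[>] 0,
      sweep (D.src e) (D.along e (τ e)) (x + δ • η) + sweep (D.src e) (D.along e (τ e)) (x - δ • η) =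
      (if e = D.edgeOf p ∧ (p.2.2 : ℝ) < τ e then 1 else 0) +
      (levelJump x (D.src e) (x + δ • η) + levelJump x (D.along e (τ e)) (x + δ • η)) +
      (levelJump x (D.src e) (x - δ • η) + levelJump x (D.along e (τ e)) (x - δ • η)) := by
    intro e
    by_cases he : e = D.edgeOf p
    · have hv : D.along e (τ e) - D.src e = τ e • D.vec e := by rw [D.along_eq]; simp
      have hxe : x = D.along e p.2.2 := by rw [hx, D.point_eq_along, he]
      rcases lt_or_gt_of_ne hne with h | h
      · rw [← he] at h
        rw [if_neg (by intro h'; linarith [h'.2])]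
        simp only [zero_add]
        refine off e ?_
        rw [segment_eq_image_lineMap]
        rintro ⟨l, hl, h'⟩
        rw [AffineMap.lineMap_apply, vsub_eq_sub, hv, vadd_eq_add, smul_smul, add_comm, ← D.along_eq,
          hxe] at h'
        have := D.along_injective e h'
        have := hl.2
        nlinarith [(hτ e).1]
      · rw [← he] at h
        rw [if_pos ⟨he, h⟩]
        refine sweep_jump ?_ ?_
        · rw [openSegment_eq_image_lineMap]
          refine ⟨p.2.2 / τ e, ⟨div_pos h0 (h0.trans h), (div_lt_one (h0.trans h)).2 h⟩, ?_⟩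
          rw [AffineMap.lineMap_apply, vsub_eq_sub, hv, vadd_eq_add, smul_smul, add_comm, ← D.along_eq,
            hxe, div_mul_cancel₀ _ (h0.trans h).ne']
        · rw [hv, det_smul_left, he]
          rw [he] at h
          exact mul_ne_zero (h0.trans h).ne' hη
    · simp only [he, false_and, if_false, zero_add]
      exact off e fun h => notMem_edgeSet_of_notMem_crossings h0 hp he
        (segment_along_subset e (hτ e) h)
  filter_upwards [eventually_all.2 key] with δ hδ
  simp only [cutSweep, cutBoundary, ← Finset.sum_add_distrib]
  rw [Finset.sum_congr rfl fun e _ => hδ e, add_assoc, ← Finset.sum_add_distrib]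
  simp only [add_assoc]
  rw [Finset.sum_add_distrib]
  congr 1
  simp only [ite_and]
  rw [Finset.sum_ite_eq' Finset.univ (D.edgeOf p)]
  simp

/-- Two chains of initial parts of edges with the same boundary. -/
structure Homologous (D : LinkDiagram) (τ τ' : D.Edge → ℝ) : Prop where
  left : ∀ e, τ e ∈ Set.Icc (0 : ℝ) 1
  right : ∀ e, τ' e ∈ Set.Icc (0 : ℝ) 1
  boundary : ∀ φ, D.cutBoundary τ φ = D.cutBoundary τ' φ

/-- The colouring of the plane defined by two chains with the same boundary. -/
noncomputable def coloring (D : LinkDiagram) (τ τ' : D.Edge → ℝ) (z : Plane) : ZMod 2 :=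
  D.cutSweep τ z + D.cutSweep τ' z

/-- The level jumps of the two chains are their boundaries evaluated at one function, so they cancel
modulo two. The same happens in `Homologous.jump`. -/
theorem Homologous.locConst {τ τ' : D.Edge → ℝ} (h : D.Homologous τ τ') :
    D.LocConst (D.coloring τ τ') := by
  intro z hz
  obtain ⟨κ, hκ⟩ := cutSweep_eventually h.left hz
  obtain ⟨κ', hκ'⟩ := cutSweep_eventually h.right hz
  have : ∀ᶠ z' in 𝓝 z, D.coloring τ τ' z' = κ + κ' := by
    filter_upwards [hκ, hκ'] with z' h1 h2
    rw [coloring, h1, h2, h.boundary]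
    have := CharTwo.add_self_eq_zero (D.cutBoundary τ' fun a => levelJump z a z')
    linear_combination this
  filter_upwards [this] with z' h'
  rw [h', this.self_of_nhds]

open Classical in
theorem Homologous.jump {τ τ' : D.Edge → ℝ} (h : D.Homologous τ τ') {p : D.Param}
    (h0 : 0 < (p.2.2 : ℝ)) (hp : D.point p ∉ D.crossings) {η : Plane}
    (hη : det (D.vec (D.edgeOf p)) η ≠ 0) (hne : τ (D.edgeOf p) ≠ p.2.2)
    (hne' : τ' (D.edgeOf p) ≠ p.2.2) :
    ∀ᶠ δ : ℝ in 𝓝[>] 0,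
      D.coloring τ τ' (D.point p + δ • η) + D.coloring τ τ' (D.point p - δ • η) =
        (if (p.2.2 : ℝ) < τ (D.edgeOf p) then 1 else 0) +
        (if (p.2.2 : ℝ) < τ' (D.edgeOf p) then 1 else 0) := by
  filter_upwards [cutSweep_jump h.left h0 hp hη hne, cutSweep_jump h.right h0 hp hη hne'] with δ h1 h2
  simp only [h.boundary] at h1
  have a1 := CharTwo.add_self_eq_zero
    (D.cutBoundary τ' fun a => levelJump (D.point p) a (D.point p + δ • η))
  have a2 := CharTwo.add_self_eq_zero
    (D.cutBoundary τ' fun a => levelJump (D.point p) a (D.point p - δ • η))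
  simp only [coloring]
  linear_combination h1 + h2 + a1 + a2

/-! ### The corners of a crossing -/

/-- The point with given coordinates with respect to the strands at a crossing. -/
noncomputable def corner (D : LinkDiagram) (p q : D.Param) (s t : ℝ) : Plane :=
  D.point p + (s • D.vec (D.edgeOf p) + t • D.vec (D.edgeOf q))

theorem corner_comm {p q : D.Param} (h : D.point p = D.point q) (s t : ℝ) :
    D.corner p q s t = D.corner q p t s := by
  rw [corner, corner, h, add_comm (s • _)]

theorem corner_notMem {p q : D.Param} {ε : ℝ} (hc : D.Chart p q ε) {s t : ℝ} (hs : |s| < ε)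
    (ht : |t| < ε) (hs0 : s ≠ 0) (ht0 : t ≠ 0) : D.corner p q s t ∈ D.supportᶜ := by
  rintro ⟨r, hr⟩
  rcases hc.2.2 s t hs ht r hr with h | h
  · exact ht0 h.2.2
  · exact hs0 h.2.2

/-- An open quadrant of the chart is convex and contains no point of the diagram. -/
theorem region_corner_eq {p q : D.Param} {ε : ℝ} (hc : D.Chart p q ε) {s t s' t' : ℝ} (hs : |s| < ε)
    (ht : |t| < ε) (hs' : |s'| < ε) (ht' : |t'| < ε) (hss : 0 < s * s') (htt : 0 < t * t') :
    D.region (D.corner p q s t) = D.region (D.corner p q s' t') := by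
  refine region_eq_of_segment ?_
  rw [segment_eq_image_lineMap]
  rintro _ ⟨l, ⟨hl0, hl1⟩, rfl⟩
  have key : ∀ a b : ℝ, |a| < ε → |b| < ε → 0 < a * b →
      |(1 - l) * a + l * b| < ε ∧ (1 - l) * a + l * b ≠ 0 := by
    intro a b ha hb hab
    rw [abs_lt] at ha hb ⊢
    have h1 : 0 ≤ 1 - l := sub_nonneg.2 hl1
    refine ⟨convex_Ioo (-ε) ε ha hb h1 hl0 (by ring), ?_⟩
    rcases lt_trichotomy a 0 with h | h | h
    · exact (convex_Iio (0 : ℝ) h (show b < 0 by by_contra! hb0; nlinarith) h1 hl0 (by ring)).ne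
    · simp [h] at hab
    · exact (convex_Ioi (0 : ℝ) h (show 0 < b by by_contra! hb0; nlinarith) h1 hl0 (by ring)).ne'
  have : AffineMap.lineMap (D.corner p q s t) (D.corner p q s' t') l =
      D.corner p q ((1 - l) * s + l * s') ((1 - l) * t + l * t') := by
    rw [AffineMap.lineMap_apply_module]
    simp only [corner]
    module
  rw [this]
  exact corner_notMem hc (key s s' hs hs' hss).1 (key t t' ht ht' htt).1 (key s s' hs hs' hss).2
    (key t t' ht ht' htt).2

theorem LocConst.corner_eq {f : Plane → ZMod 2} (hf : D.LocConst f) {p q : D.Param} {ε : ℝ}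
    (hc : D.Chart p q ε) {s t s' t' : ℝ} (hs : |s| < ε)
    (ht : |t| < ε) (hs' : |s'| < ε) (ht' : |t'| < ε) (hss : 0 < s * s') (htt : 0 < t * t') :
    f (D.corner p q s t) = f (D.corner p q s' t') :=
  hf.eq_of_region_eq (corner_notMem hc hs ht (left_ne_zero_of_mul hss.ne') (left_ne_zero_of_mul htt.ne'))
    (corner_notMem hc hs' ht' (right_ne_zero_of_mul hss.ne') (right_ne_zero_of_mul htt.ne'))
    (region_corner_eq hc hs ht hs' ht' hss htt)

theorem Chart.param_mem {p q : D.Param} {ε : ℝ} (hc : D.Chart p q ε) {s : ℝ} (hs : |s| < ε) :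
    0 < p.2.2 + s ∧ p.2.2 + s < (1 : ℝ) := by
  have := hc.2.1 p (Or.inl rfl)
  rw [abs_lt] at hs
  constructor <;> linarith

/-- The parameter obtained by moving along the first strand. -/
noncomputable def Chart.shift {p q : D.Param} {ε : ℝ} (hc : D.Chart p q ε) {s : ℝ} (hs : |s| < ε) :
    D.Param := D.param (D.edgeOf p) (p.2.2 + s)
    (Set.mem_Ico.2 ⟨(hc.param_mem hs).1.le, (hc.param_mem hs).2⟩)

theorem Chart.point_shift {p q : D.Param} {ε : ℝ} (hc : D.Chart p q ε) {s : ℝ} (hs : |s| < ε) :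
    D.point (hc.shift hs) = D.point p + s • D.vec (D.edgeOf p) := by
  rw [shift, D.point_param, D.along_eq, D.point_eq_along, D.along_eq]
  module

theorem Chart.shift_notMem {p q : D.Param} {ε : ℝ} (hc : D.Chart p q ε) {s : ℝ} (hs : |s| < ε)
    (hs0 : s ≠ 0) : D.point (hc.shift hs) ∉ D.crossings := by
  intro h
  obtain ⟨a, b, hab, ha⟩ := mem_crossings.1 h
  rw [hc.point_shift] at ha
  have key : ∀ r, D.point r = D.point p + s • D.vec (D.edgeOf p) → r = hc.shift hs := by
    intro r hr
    rcases hc.2.2 s 0 hs (by simpa using hc.1) r (by simpa using hr) with h | h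
    · exact D.param_ext h.1 h.2.1
    · exact absurd h.2.2 hs0
  exact hab.1 ((key a ha).trans (key b (hab.2 ▸ ha)).symm)

/-- The jump of a locally constant function across the first strand is that at corners. -/
theorem LocConst.eventually_corner {f : Plane → ZMod 2} (hf : D.LocConst f) {p q : D.Param} {ε : ℝ}
    (hc : D.Chart p q ε) {s t : ℝ} (hs : |s| < ε) (hs0 : s ≠ 0) (ht : |t| < ε) (ht0 : 0 < t) :
    ∀ᶠ δ : ℝ in 𝓝[>] 0,
      f (D.point (hc.shift hs) + δ • D.vec (D.edgeOf q)) = f (D.corner p q s t) ∧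
      f (D.point (hc.shift hs) - δ • D.vec (D.edgeOf q)) = f (D.corner p q s (-t)) := by
  filter_upwards [self_mem_nhdsWithin, nhdsWithin_le_nhds (eventually_lt_nhds hc.1)] with δ hδ hδ'
  replace hδ : 0 < δ := hδ
  have h1 : |δ| < ε := by rwa [abs_of_pos hδ]
  have h2 : 0 < s * s := mul_self_pos.2 hs0
  rw [hc.point_shift]
  constructor
  · rw [add_assoc]
    exact hf.corner_eq hc hs h1 hs ht h2 (mul_pos hδ ht0)
  · rw [sub_eq_add_neg, ← neg_smul, add_assoc]
    exact hf.corner_eq hc hs (by rwa [abs_neg]) hs (by rwa [abs_neg]) h2 (by nlinarith)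

open Classical in
theorem Homologous.corner_jump {τ τ' : D.Edge → ℝ} (h : D.Homologous τ τ') {p q : D.Param}
    (hx : D.Cross p q) {ε : ℝ} (hc : D.Chart p q ε) {s t : ℝ} (hs : |s| < ε) (hs0 : s ≠ 0)
    (ht : |t| < ε) (ht0 : 0 < t) (hne : τ (D.edgeOf p) ≠ p.2.2 + s)
    (hne' : τ' (D.edgeOf p) ≠ p.2.2 + s) :
    D.coloring τ τ' (D.corner p q s t) + D.coloring τ τ' (D.corner p q s (-t)) =
      (if p.2.2 + s < τ (D.edgeOf p) then 1 else 0) +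
      (if p.2.2 + s < τ' (D.edgeOf p) then 1 else 0) := by
  have h1 := h.locConst.eventually_corner hc hs hs0 ht ht0
  have h2 := h.jump (p := hc.shift hs) (hc.param_mem hs).1 (hc.shift_notMem hs hs0)
    (η := D.vec (D.edgeOf q)) hx.det_ne hne hne'
  obtain ⟨δ, ⟨e1, e2⟩, e3⟩ := (h1.and h2).exists
  rw [e1, e2] at e3
  exact e3

/-- The sum of the values of a function at the four corners of a crossing. -/
noncomputable def cornerSum (D : LinkDiagram) (f : Plane → ZMod 2) (p q : D.Param) (h : ℝ) : ZMod 2 :=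
  f (D.corner p q h h) + f (D.corner p q h (-h)) +
    (f (D.corner p q (-h) h) + f (D.corner p q (-h) (-h)))

theorem LocConst.cornerSum_eq {f : Plane → ZMod 2} (hf : D.LocConst f) {p q : D.Param} {ε : ℝ}
    (hc : D.Chart p q ε) {h h' : ℝ} (h0 : 0 < h) (h1 : h < ε) (h0' : 0 < h') (h1' : h' < ε) :
    D.cornerSum f p q h = D.cornerSum f p q h' := by
  have a : |h| < ε := by rwa [abs_of_pos h0]
  have a' : |h'| < ε := by rwa [abs_of_pos h0']
  have b : |-h| < ε := by rwa [abs_neg]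
  have b' : |-h'| < ε := by rwa [abs_neg]
  have c : 0 < h * h' := mul_pos h0 h0'
  have d : 0 < -h * -h' := by rwa [neg_mul_neg]
  rw [cornerSum, cornerSum, hf.corner_eq hc a a a' a' c c, hf.corner_eq hc a b a' b' c d,
    hf.corner_eq hc b a b' a' d c, hf.corner_eq hc b b b' b' d d]

open Classical in
/-- The sum over the corners is the change along the first strand of the jump across it. -/
theorem Homologous.cornerSum {τ τ' : D.Edge → ℝ} (h : D.Homologous τ τ') {p q : D.Param}
    (hx : D.Cross p q) {ε : ℝ} (hc : D.Chart p q ε) {l : ℝ} (h0 : 0 < l) (h1 : l < ε) :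
    D.cornerSum (D.coloring τ τ') p q l =
      (if τ (D.edgeOf p) = p.2.2 then 1 else 0) + (if τ' (D.edgeOf p) = p.2.2 then 1 else 0) := by
  -- The corners are moved so close that a cut of this edge has time within `k` of the crossing only
  -- if it is exactly at the crossing.
  obtain ⟨k, hk0, hkε, hk⟩ : ∃ k, 0 < k ∧ k < ε ∧ ∀ σ, σ = τ ∨ σ = τ' →
      σ (D.edgeOf p) ≠ p.2.2 → k < |σ (D.edgeOf p) - p.2.2| := by
    have : ∀ σ : D.Edge → ℝ, ∀ᶠ k in 𝓝[>] (0 : ℝ),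
        σ (D.edgeOf p) ≠ p.2.2 → k < |σ (D.edgeOf p) - p.2.2| := by
      intro σ
      by_cases hσ : σ (D.edgeOf p) = p.2.2
      · exact .of_forall fun _ h => absurd hσ h
      · filter_upwards [nhdsWithin_le_nhds (eventually_lt_nhds (abs_pos.2 (sub_ne_zero.2 hσ)))]
          with k hk _ using hk
    have h1 : ∀ᶠ k in 𝓝[>] (0 : ℝ), k < ε := nhdsWithin_le_nhds (eventually_lt_nhds hc.1)
    obtain ⟨k, hk0, hk1, hk2, hk3⟩ := ((eventually_mem_nhdsWithin (a := (0 : ℝ)) (s := Set.Ioi 0)).and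
      (h1.and ((this τ).and (this τ')))).exists
    refine ⟨k, hk0, hk1, fun σ hσ => ?_⟩
    rcases hσ with rfl | rfl
    exacts [hk2, hk3]
  rw [h.locConst.cornerSum_eq hc h0 h1 hk0 hkε]
  have hka : |k| < ε := by rwa [abs_of_pos hk0]
  have hkn : |-k| < ε := by rwa [abs_neg]
  have key : ∀ σ, σ = τ ∨ σ = τ' → σ (D.edgeOf p) ≠ p.2.2 + k ∧ σ (D.edgeOf p) ≠ p.2.2 + -k ∧
      (if p.2.2 + k < σ (D.edgeOf p) then (1 : ZMod 2) else 0) +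
      (if p.2.2 + -k < σ (D.edgeOf p) then 1 else 0) =
      if σ (D.edgeOf p) = p.2.2 then 1 else 0 := by
    intro σ hσ
    have := hk σ hσ
    by_cases he : σ (D.edgeOf p) = p.2.2
    · refine ⟨by linarith, by linarith, ?_⟩
      simp [he, hk0, hk0.le]
    · have := this he
      rcases lt_or_gt_of_ne he with h' | h'
      · rw [abs_of_neg (sub_neg.2 h')] at this
        refine ⟨by linarith, by linarith, ?_⟩
        rw [if_neg (by linarith), if_neg (by linarith), if_neg he]; rfl
      · rw [abs_of_pos (sub_pos.2 h')] at this
        refine ⟨by linarith, by linarith, ?_⟩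
        rw [if_pos (by linarith), if_pos (by linarith), if_neg he]; rfl
  have k1 := key τ (Or.inl rfl)
  have k2 := key τ' (Or.inr rfl)
  rw [LinkDiagram.cornerSum, h.corner_jump hx hc hka hk0.ne' hka hk0 k1.1 k2.1,
    h.corner_jump hx hc hkn (neg_ne_zero.2 hk0.ne') hka hk0 k1.2.1 k2.2.1]
  linear_combination k1.2.2 + k2.2.2

end LinkDiagram

end RegionCrossing

/-! ### Arcs, checkerboard colourings and the regions at a crossing -/

namespace RegionCrossing

/-- A telescoping sum along an arc: steps before `J` are taken entirely, step `J` ends at `b`, and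
the terms of later steps are doubled and vanish. -/
theorem sum_initial_part {n J : ℕ} (hJ : J < n) (a : ℕ → ZMod 2) (b : ZMod 2) :
    ∑ m ∈ Finset.range n, (a m + if m < J then a (m + 1) else if m = J then b else a m) = a 0 + b := by
  have : ∀ N, ∑ m ∈ Finset.range N, (a m + if m < J then a (m + 1) else if m = J then b else a m) =
      if N ≤ J then a 0 + a N else a 0 + b := by
    intro N
    induction N with
    | zero => simp [CharTwo.add_self_eq_zero]
    | succ N ih =>
      rw [Finset.sum_range_succ, ih]
      rcases lt_trichotomy N J with h | h | h
      · rw [if_pos h.le, if_pos h, if_pos (show N + 1 ≤ J from h)]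
        linear_combination CharTwo.add_self_eq_zero (a N)
      · rw [if_pos h.le, if_neg (by omega), if_pos h, if_neg (by omega)]
        linear_combination CharTwo.add_self_eq_zero (a N)
      · rw [if_neg (by omega), if_neg (by omega), if_neg (by omega), if_neg (by omega)]
        linear_combination CharTwo.add_self_eq_zero (a N)
  rw [this, if_neg (by omega)]

theorem sum_zmod {n : ℕ} [NeZero n] {M : Type*} [AddCommMonoid M] (F : ZMod n → M) :
    ∑ i, F i = ∑ m ∈ Finset.range n, F (m : ZMod n) := by
  refine Finset.sum_bij' (fun i _ => i.val) (fun m _ => (m : ZMod n)) ?_ ?_ ?_ ?_ ?_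
  · intro i _; exact Finset.mem_range.2 (ZMod.val_lt i)
  · intro m _; exact Finset.mem_univ _
  · intro i _; exact ZMod.natCast_zmod_val i
  · intro m hm; exact ZMod.val_cast_of_lt (Finset.mem_range.1 hm)
  · intro i _; rw [ZMod.natCast_zmod_val]

namespace LinkDiagram

variable {D : LinkDiagram}

/-! ### Chains of initial arcs -/

/-- The chain consisting of the arcs of both components from the base vertex to a given parameter. -/
noncomputable def cut (D : LinkDiagram) (c : ∀ k, ZMod (D.comp k).n × Set.Ico (0 : ℝ) 1)
    (e : D.Edge) : ℝ :=
  if e.2.val < (c e.1).1.val then 1 else if e.2.val = (c e.1).1.val then (c e.1).2 else 0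

theorem cut_mem (c : ∀ k, ZMod (D.comp k).n × Set.Ico (0 : ℝ) 1) (e : D.Edge) :
    D.cut c e ∈ Set.Icc (0 : ℝ) 1 := by
  have := (c e.1).2.2
  unfold cut
  split_ifs
  · simp
  · exact ⟨this.1, this.2.le⟩
  · simp

/-- By telescoping, an arc is bounded by the base vertex and its end point. The base vertices do not
depend on `c`, so for `homologous_cut` only the end points have to be compared. -/
theorem cutBoundary_cut (c : ∀ k, ZMod (D.comp k).n × Set.Ico (0 : ℝ) 1) (φ : Plane → ZMod 2) :
    D.cutBoundary (D.cut c) φ = ∑ k, (φ (D.src ⟨k, 0⟩) + φ (D.point ⟨k, c k⟩)) := by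
  rw [cutBoundary, Fintype.sum_sigma]
  refine Finset.sum_congr rfl fun k _ => ?_
  rw [sum_zmod]
  have h := sum_initial_part (ZMod.val_lt (c k).1) (fun m => φ (D.src ⟨k, (m : ZMod (D.comp k).n)⟩))
    (φ (D.point ⟨k, c k⟩))
  rw [Nat.cast_zero] at h
  rw [← h]
  refine Finset.sum_congr rfl fun m hm => ?_
  have hv : ((m : ZMod (D.comp k).n)).val = m := ZMod.val_cast_of_lt (Finset.mem_range.1 hm)
  congr 1
  unfold cut
  simp only [hv]
  split_ifs with h1 h2
  · rw [D.along_one]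
    simp [PolygonPair.next]
  · have : (m : ZMod (D.comp k).n) = (c k).1 := by rw [h2, ZMod.natCast_zmod_val]
    rw [this]; rfl
  · rw [D.along_zero]

/-- A cut at a time strictly between `0` and `1` occurs only where an arc ends. Thus the corner sums
of a colouring by arcs detect exactly the end points of the arcs. -/
theorem cut_eq_iff (c : ∀ k, ZMod (D.comp k).n × Set.Ico (0 : ℝ) 1) {p : D.Param}
    (hp : 0 < (p.2.2 : ℝ)) : D.cut c (D.edgeOf p) = p.2.2 ↔ p = ⟨p.1, c p.1⟩ := by
  obtain ⟨k, i, t⟩ := p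
  simp only at hp
  have h1 := t.2.2
  unfold cut PolygonPair.edgeOf
  simp only [Sigma.mk.injEq, heq_eq_eq, true_and]
  constructor
  · intro h
    split_ifs at h with h2 h3
    · linarith
    · exact Prod.ext (ZMod.val_injective _ h3) (Subtype.ext h.symm)
    · linarith
  · intro h
    rw [← h]; simp

theorem homologous_cut {c c' : ∀ k, ZMod (D.comp k).n × Set.Ico (0 : ℝ) 1}
    (h : ∀ φ : Plane → ZMod 2, ∑ k, φ (D.point ⟨k, c k⟩) = ∑ k, φ (D.point ⟨k, c' k⟩)) :
    D.Homologous (D.cut c) (D.cut c') where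
  left := cut_mem c
  right := cut_mem c'
  boundary φ := by
    rw [cutBoundary_cut, cutBoundary_cut, Finset.sum_add_distrib, Finset.sum_add_distrib, h]

open Classical in
/-- The chain of all edges of a set of components. -/
noncomputable def whole (D : LinkDiagram) (A : Set (Fin 2)) (e : D.Edge) : ℝ := if e.1 ∈ A then 1 else 0

theorem whole_mem (A : Set (Fin 2)) (e : D.Edge) : D.whole A e ∈ Set.Icc (0 : ℝ) 1 := by
  unfold whole; split_ifs <;> simp

/-- A closed polygon is a cycle: its final vertices are its initial ones, shifted by one. The empty
chain `whole ∅` serves as the second chain. -/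
theorem homologous_whole (A : Set (Fin 2)) : D.Homologous (D.whole A) (D.whole ∅) where
  left := whole_mem A
  right := whole_mem ∅
  boundary φ := by
    unfold cutBoundary
    rw [Fintype.sum_sigma, Fintype.sum_sigma]
    refine Finset.sum_congr rfl fun k _ => ?_
    have h0 : ∀ i, D.along ⟨k, i⟩ (D.whole ∅ ⟨k, i⟩) = D.src ⟨k, i⟩ := fun i => by
      simp [whole, D.along_zero]
    simp only [h0]
    by_cases hk : k ∈ A
    · have h1 : ∀ i, D.along ⟨k, i⟩ (D.whole A ⟨k, i⟩) = D.src ⟨k, i + 1⟩ := fun i => by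
        simp [whole, D.along_one, hk, PolygonPair.next]
      simp only [h1]
      rw [Finset.sum_add_distrib, Finset.sum_add_distrib]
      congr 1
      exact Equiv.sum_comp (Equiv.addRight (1 : ZMod (D.comp k).n)) fun i => φ (D.src ⟨k, i⟩)
    · have h1 : ∀ i, D.along ⟨k, i⟩ (D.whole A ⟨k, i⟩) = D.src ⟨k, i⟩ := fun i => by
        simp [whole, D.along_zero, hk]
      simp only [h1]

/-- The parity colouring of the plane with respect to a set of components. -/
noncomputable def checker (D : LinkDiagram) (A : Set (Fin 2)) : Plane → ZMod 2 :=
  D.coloring (D.whole A) (D.whole ∅)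

theorem locConst_checker (A : Set (Fin 2)) : D.LocConst (D.checker A) := (homologous_whole A).locConst

open Classical in
theorem checker_jump (A : Set (Fin 2)) {p q : D.Param}
    (hx : D.Cross p q) {ε : ℝ} (hc : D.Chart p q ε) {s t : ℝ} (hs : |s| < ε) (hs0 : s ≠ 0)
    (ht : |t| < ε) (ht0 : t ≠ 0) :
    D.checker A (D.corner p q s t) + D.checker A (D.corner p q s (-t)) = if p.1 ∈ A then 1 else 0 := by
  wlog ht1 : 0 < t generalizing t
  · have := this (t := -t) (by rwa [abs_neg]) (neg_ne_zero.2 ht0)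
      (by rcases lt_or_gt_of_ne ht0 with h | h <;> [linarith; exact absurd h ht1])
    rw [neg_neg] at this
    rw [← this, add_comm]
  have := hc.param_mem hs
  have hw : ∀ B : Set (Fin 2), D.whole B (D.edgeOf p) = 1 ∨ D.whole B (D.edgeOf p) = 0 := fun B => by
    unfold whole; split_ifs <;> simp
  have hw' : ∀ B : Set (Fin 2), D.whole B (D.edgeOf p) ≠ p.2.2 + s := fun B h => by
    rcases hw B with h' | h' <;> linarith
  rw [checker, (homologous_whole A).corner_jump hx hc hs hs0 ht ht1 (hw' A) (hw' ∅)]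
  by_cases hA : p.1 ∈ A
  · simp [whole, PolygonPair.edgeOf, hA, this.2, this.1.not_gt]
  · simp [whole, PolygonPair.edgeOf, hA, this.1.not_gt]

open Classical in
theorem checker_cornerSum (A : Set (Fin 2)) {p q : D.Param}
    (hx : D.Cross p q) {ε : ℝ} (hc : D.Chart p q ε) {l : ℝ} (h0 : 0 < l) (h1 : l < ε) :
    D.cornerSum (D.checker A) p q l = 0 := by
  have a : |l| < ε := by rwa [abs_of_pos h0]
  have b : |-l| < ε := by rwa [abs_neg]
  rw [cornerSum, checker_jump A hx hc a h0.ne' a h0.ne',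
    checker_jump A hx hc b (neg_ne_zero.2 h0.ne') a h0.ne']
  exact CharTwo.add_self_eq_zero _

/-! ### Regions at a crossing -/

theorem eventually_corner_coord {p q : D.Param} (hx : D.Cross p q) {ε : ℝ} (hε : 0 < ε) :
    ∀ᶠ z in 𝓝 (D.point p), ∃ s t : ℝ, |s| < ε ∧ |t| < ε ∧ z = D.corner p q s t := by
  set u := D.vec (D.edgeOf p)
  set w := D.vec (D.edgeOf q)
  have c1 : Continuous fun z => det (z - D.point p) w / det u w :=
    (continuous_det (by fun_prop) continuous_const).div_const _
  have c2 : Continuous fun z => det u (z - D.point p) / det u w :=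
    (continuous_det continuous_const (by fun_prop)).div_const _
  have t1 := (c1.tendsto (D.point p)).eventually (Metric.ball_mem_nhds _ hε)
  have t2 := (c2.tendsto (D.point p)).eventually (Metric.ball_mem_nhds _ hε)
  filter_upwards [t1, t2] with z h1 h2
  refine ⟨det (z - D.point p) w / det u w, det u (z - D.point p) / det u w, ?_, ?_, ?_⟩
  rotate_left 2
  · rw [corner, ← eq_coord hx.det_ne (z - D.point p)]; simp
  · simpa [det, abs_div, Metric.mem_ball, dist_eq_norm] using h1
  · simpa [det, abs_div, Metric.mem_ball, dist_eq_norm] using h2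

theorem corner_mem_support {p q : D.Param} (hx : D.Cross p q) {ε : ℝ} (hc : D.Chart p q ε)
    {s t : ℝ} (hs : |s| < ε) (ht : |t| < ε) (h : s = 0 ∨ t = 0) : D.corner p q s t ∈ D.support := by
  rcases h with rfl | rfl
  · rw [corner_comm hx.2]
    exact ⟨(hc.symm hx.2).shift ht, by simp [Chart.point_shift, corner]⟩
  · exact ⟨hc.shift hs, by simp [Chart.point_shift, corner]⟩

/-- Near the crossing the complement of the diagram consists of the four open quadrants of the
chart, each contained in one region; conversely, every quadrant accumulates at the crossing. -/
theorem mem_frontier_iff {p q : D.Param} (hx : D.Cross p q) {ε : ℝ} (hc : D.Chart p q ε) {l : ℝ}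
    (h0 : 0 < l) (h1 : l < ε) {R : Set Plane} (hR : R ∈ D.regions) :
    D.point p ∈ frontier R ↔ R = D.region (D.corner p q l l) ∨ R = D.region (D.corner p q l (-l)) ∨
      R = D.region (D.corner p q (-l) l) ∨ R = D.region (D.corner p q (-l) (-l)) := by
  have a : |l| < ε := by rwa [abs_of_pos h0]
  have b : |-l| < ε := by rwa [abs_neg]
  have hRo : IsOpen R := by obtain ⟨z, -, rfl⟩ := hR; exact isOpen_region z
  have hRs : R ⊆ D.supportᶜ := by obtain ⟨z, -, rfl⟩ := hR; exact region_subset z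
  have hpR : D.point p ∉ R := fun h => hRs h ⟨p, rfl⟩
  rw [frontier, hRo.interior_eq, Set.mem_sdiff, and_iff_left hpR]
  constructor
  · intro h
    obtain ⟨z, ⟨s, t, hs, ht, rfl⟩, hz⟩ := mem_closure_iff_nhds.1 h _ (eventually_corner_coord hx hc.1)
    have hst : s ≠ 0 ∧ t ≠ 0 := by
      rw [← not_or]
      exact fun h' => hRs hz (corner_mem_support hx hc hs ht h')
    rw [eq_region_of_mem hR hz]
    have key : ∀ s' t', |s'| < ε → |t'| < ε → 0 < s * s' → 0 < t * t' →
        D.region (D.corner p q s t) = D.region (D.corner p q s' t') := fun s' t' =>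
      region_corner_eq hc hs ht
    rcases lt_or_gt_of_ne hst.1 with hs0 | hs0 <;> rcases lt_or_gt_of_ne hst.2 with ht0 | ht0
    · exact Or.inr (Or.inr (Or.inr (key _ _ b b (by nlinarith) (by nlinarith))))
    · exact Or.inr (Or.inr (Or.inl (key _ _ b a (by nlinarith) (by nlinarith))))
    · exact Or.inr (Or.inl (key _ _ a b (by nlinarith) (by nlinarith)))
    · exact Or.inl (key _ _ a a (by nlinarith) (by nlinarith))
  · have key : ∀ s t : ℝ, |s| < ε → |t| < ε → s ≠ 0 → t ≠ 0 → R = D.region (D.corner p q s t) →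
        D.point p ∈ closure R := by
      intro s t hs ht hs0 ht0 hRe
      have hcont : Continuous fun δ : ℝ => D.corner p q (δ * s) (δ * t) := by
        unfold corner; fun_prop
      have ht' : Tendsto (fun δ : ℝ => D.corner p q (δ * s) (δ * t)) (𝓝[>] 0) (𝓝 (D.point p)) := by
        have := (hcont.tendsto 0).mono_left (nhdsWithin_le_nhds (s := Set.Ioi 0))
        simpa [corner] using this
      refine mem_closure_of_tendsto ht' ?_
      filter_upwards [self_mem_nhdsWithin, nhdsWithin_le_nhds (eventually_lt_nhds (zero_lt_one' ℝ))]
        with δ hδ hδ1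
      replace hδ : 0 < δ := hδ
      have bd : ∀ r : ℝ, |r| < ε → |δ * r| < ε := fun r hr => by
        rw [abs_mul, abs_of_pos hδ]
        nlinarith [abs_nonneg r]
      have h1 := mem_region (corner_notMem hc (bd s hs) (bd t ht) (mul_ne_zero hδ.ne' hs0)
        (mul_ne_zero hδ.ne' ht0))
      rwa [hRe, region_corner_eq hc hs ht (bd s hs) (bd t ht)
        (by nlinarith [mul_pos hδ (mul_self_pos.2 hs0)]) (by nlinarith [mul_pos hδ (mul_self_pos.2 ht0)])]
    have hn := neg_ne_zero.2 h0.ne'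
    rintro (h | h | h | h)
    · exact key _ _ a a h0.ne' h0.ne' h
    · exact key _ _ a b h0.ne' hn h
    · exact key _ _ b a hn h0.ne' h
    · exact key _ _ b b hn hn h

/-- Adjacent corners of a crossing lie in different regions. -/
theorem region_corner_ne {p q : D.Param} (hx : D.Cross p q) {ε : ℝ} (hc : D.Chart p q ε)
    {s t : ℝ} (hs : |s| < ε) (hs0 : s ≠ 0) (ht : |t| < ε) (ht0 : t ≠ 0) :
    D.region (D.corner p q s t) ≠ D.region (D.corner p q s (-t)) := by
  intro h
  -- The checkerboard colouring of the whole diagram is constant on regions but changes across every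
  -- strand.
  have h1 := checker_jump Set.univ hx hc hs hs0 ht ht0
  rw [(locConst_checker Set.univ).eq_of_region_eq (corner_notMem hc hs ht hs0 ht0)
    (corner_notMem hc hs (by rwa [abs_neg]) hs0 (neg_ne_zero.2 ht0)) h,
    CharTwo.add_self_eq_zero] at h1
  simp at h1

/-- Opposite corners of a crossing of both components lie in different regions. -/
theorem region_corner_ne_opposite {p q : D.Param} (hx : D.Cross p q) (hpq : p.1 ≠ q.1) {ε : ℝ}
    (hc : D.Chart p q ε) {s t : ℝ} (hs : |s| < ε) (hs0 : s ≠ 0) (ht : |t| < ε) (ht0 : t ≠ 0) :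
    D.region (D.corner p q s t) ≠ D.region (D.corner p q (-s) (-t)) := by
  intro h
  have ht' : |-t| < ε := by rwa [abs_neg]
  -- The colouring by the component of `p` alone changes across the strand `p` but not across the
  -- strand `q`, hence between opposite corners.
  have h1 := checker_jump {p.1} hx hc hs hs0 ht ht0
  have h2 := checker_jump {p.1} hx.symm (hc.symm hx.2) ht' (neg_ne_zero.2 ht0) hs hs0
  rw [← corner_comm hx.2, ← corner_comm hx.2, ← (locConst_checker {p.1}).eq_of_region_eq
    (corner_notMem hc hs ht hs0 ht0) (corner_notMem hc (by rwa [abs_neg]) ht' (neg_ne_zero.2 hs0)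
    (neg_ne_zero.2 ht0)) h, add_comm, h1] at h2
  simp [hpq.symm] at h2

end LinkDiagram

end RegionCrossing

/-! ### Realizable sets of crossing changes, and curves inside one region -/

namespace RegionCrossing

/-- A region at two opposite corners is counted once on the left but cancels in the sum over the
corners; the last bracket puts it back. By the hypotheses, adjacent corners never coincide. -/
theorem sum_four_corners {α : Type*} [DecidableEq α] (v : α → ZMod 2) {a b c d : α} (hab : a ≠ b)
    (hac : a ≠ c) (hbd : b ≠ d) (hcd : c ≠ d) :
    ∑ x ∈ ({a, b, c, d} : Finset α), v x =
      v a + v b + (v c + v d) + ((if a = d then v a else 0) + (if b = c then v b else 0)) := by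
  by_cases h1 : a = d <;> by_cases h2 : b = c
  · subst h1 h2
    rw [Finset.insert_comm b b, Finset.insert_idem, Finset.insert_comm]
    simp [hbd]
    have := CharTwo.add_self_eq_zero (v a)
    have := CharTwo.add_self_eq_zero (v b)
    grind
  · subst h1
    rw [Finset.insert_eq_of_mem (by simp)]
    simp [h2, hbd, hac.symm]
    have := CharTwo.add_self_eq_zero (v a)
    grind
  · subst h2
    rw [Finset.insert_eq_of_mem (s := {b, d}) (by simp)]
    simp [h1, hbd, hab]
    have := CharTwo.add_self_eq_zero (v b)
    grind
  · simp [*]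
    grind

theorem zmod_two_eq_zero_or_one (a : ZMod 2) : a = 0 ∨ a = 1 := by
  revert a; decide

theorem zmod_two_ne_iff {a b : ZMod 2} : a ≠ b ↔ a = b + 1 := by
  revert a b; decide

/-- `w` plays the role of the parity function of a polygonal path in `U` from `a` to `b`. Instead of
constructing the path, one notes that the existence of `w` is a transitive relation which holds
between nearby points in both orders, hence between all points of a preconnected set. -/
theorem exists_path_parity {U : Set Plane} (hU : IsOpen U) (hc : IsPreconnected U) {a b : Plane}
    (ha : a ∈ U) (hb : b ∈ U) : ∃ w : Plane → ZMod 2, ∀ z₀ ∉ U, ∃ κ, ∀ᶠ z in 𝓝 z₀,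
      w z = κ + levelJump z₀ a z + levelJump z₀ b z := by
  refine hc.induction₂' (fun a b => ∃ w : Plane → ZMod 2, ∀ z₀ ∉ U, ∃ κ, ∀ᶠ z in 𝓝 z₀,
      w z = κ + levelJump z₀ a z + levelJump z₀ b z) ?_ ?_ ha hb
  · intro x hx
    obtain ⟨r, hr, hrU⟩ := Metric.isOpen_iff.1 hU x hx
    filter_upwards [nhdsWithin_le_nhds (Metric.ball_mem_nhds x hr)] with y hy
    have hs : segment ℝ x y ⊆ U :=
      ((convex_ball x r).segment_subset (Metric.mem_ball_self hr) hy).trans hrU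
    exact ⟨⟨sweep x y, fun z₀ hz => sweep_eventually fun h => hz (hs h)⟩,
      ⟨sweep y x, fun z₀ hz => sweep_eventually fun h => hz (hs (by rwa [segment_symm]))⟩⟩
  · rintro x y z - - - ⟨w, hw⟩ ⟨w', hw'⟩
    refine ⟨w + w', fun z₀ hz => ?_⟩
    obtain ⟨κ, hκ⟩ := hw z₀ hz
    obtain ⟨κ', hκ'⟩ := hw' z₀ hz
    refine ⟨κ + κ', ?_⟩
    filter_upwards [hκ, hκ'] with y' h1 h2
    rw [Pi.add_apply, h1, h2]
    linear_combination CharTwo.add_self_eq_zero (levelJump z₀ y y')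

namespace LinkDiagram

variable {D : LinkDiagram}

/-- The radius of the chart is twice the coordinate chosen for the corners, so that the corners lie
well inside it. -/
theorem exists_corner_data (x : D.crossings) : ∃ d : D.Param × D.Param × ℝ,
    D.Cross d.1 d.2.1 ∧ D.point d.1 = x ∧ D.Chart d.1 d.2.1 (2 * d.2.2) := by
  obtain ⟨p, q, h, hp⟩ := mem_crossings.1 x.2
  obtain ⟨ε, hε⟩ := h.exists_chart
  exact ⟨(p, q, ε / 2), h, hp, by simpa [mul_div_cancel₀] using hε⟩

/-- A strand at a crossing. -/
noncomputable def strand (x : D.crossings) : D.Param := (exists_corner_data x).choose.1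

/-- The other strand at a crossing. -/
noncomputable def strand' (x : D.crossings) : D.Param := (exists_corner_data x).choose.2.1

/-- The coordinate of the points chosen in the corners of a crossing. -/
noncomputable def gap (x : D.crossings) : ℝ := (exists_corner_data x).choose.2.2

theorem cross_strand (x : D.crossings) : D.Cross (strand x) (strand' x) :=
  (exists_corner_data x).choose_spec.1

theorem point_strand (x : D.crossings) : D.point (strand x) = x :=
  (exists_corner_data x).choose_spec.2.1

theorem chart_strand (x : D.crossings) : D.Chart (strand x) (strand' x) (2 * gap x) :=
  (exists_corner_data x).choose_spec.2.2

theorem gap_pos (x : D.crossings) : 0 < gap x := by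
  have := (chart_strand x).1
  linarith

theorem gap_lt (x : D.crossings) : gap x < 2 * gap x := by linarith [gap_pos x]

theorem abs_gap_lt (x : D.crossings) : |gap x| < 2 * gap x := by
  rw [abs_of_pos (gap_pos x)]; exact gap_lt x

theorem abs_neg_gap_lt (x : D.crossings) : |-gap x| < 2 * gap x := by
  rw [abs_neg]; exact abs_gap_lt x

/-- The points near a crossing in the coordinates of its strands. -/
noncomputable def nearby (x : D.crossings) (s t : ℝ) : Plane := D.corner (strand x) (strand' x) s t

open Classical in
/-- The incidence vector of the crossings on the boundary of a region. -/
noncomputable def chi (D : LinkDiagram) (R : Set Plane) (x : Plane) : ZMod 2 :=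
  if x ∈ D.crossings ∧ x ∈ frontier R then 1 else 0

/-- The vectors of crossing changes that can be realized by region crossing changes. -/
noncomputable def rccSpan (D : LinkDiagram) : Submodule (ZMod 2) (Plane → ZMod 2) :=
  Submodule.span (ZMod 2) (D.chi '' D.regions)

/-- The sums over the corners of all crossings. -/
noncomputable def cornerSums (f : Plane → ZMod 2) (x : D.crossings) : ZMod 2 :=
  D.cornerSum f (strand x) (strand' x) (gap x)

open Classical in
/-- The values of a function on the regions that occur twice at a crossing. -/
noncomputable def doubled (f : Plane → ZMod 2) (x : D.crossings) : ZMod 2 :=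
  (if D.region (nearby x (gap x) (gap x)) = D.region (nearby x (-gap x) (-gap x))
    then f (nearby x (gap x) (gap x)) else 0) +
  (if D.region (nearby x (gap x) (-gap x)) = D.region (nearby x (-gap x) (gap x))
    then f (nearby x (gap x) (-gap x)) else 0)

open Classical in
/-- Extension of a vector indexed by the crossings to the plane. -/
noncomputable def extend (D : LinkDiagram) (v : D.crossings → ZMod 2) (x : Plane) : ZMod 2 :=
  if hx : x ∈ D.crossings then v ⟨x, hx⟩ else 0

theorem extend_apply (v : D.crossings → ZMod 2) (x : D.crossings) : D.extend v x = v x := by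
  simp [extend]

theorem extend_of_notMem (v : D.crossings → ZMod 2) {x : Plane} (h : x ∉ D.crossings) :
    D.extend v x = 0 := by
  simp [extend, h]

theorem nearby_notMem (x : D.crossings) {s t : ℝ} (hs : |s| < 2 * gap x) (ht : |t| < 2 * gap x)
    (hs0 : s ≠ 0) (ht0 : t ≠ 0) : nearby x s t ∈ D.supportᶜ :=
  corner_notMem (chart_strand x) hs ht hs0 ht0

open Classical in
/-- The sum of the values on the regions at a crossing, each counted once, is realizable. -/
theorem LocConst.extend_mem {f : Plane → ZMod 2} (hf : D.LocConst f) :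
    D.extend (fun x => cornerSums f x + doubled f x) ∈ D.rccSpan := by
  have g0 := fun x : D.crossings => (gap_pos x).ne'
  have gn := fun x : D.crossings => neg_ne_zero.2 (g0 x)
  have ga := fun x : D.crossings => abs_gap_lt x
  have gb := fun x : D.crossings => abs_neg_gap_lt x
  have m1 := fun x : D.crossings => nearby_notMem x (ga x) (ga x) (g0 x) (g0 x)
  have m2 := fun x : D.crossings => nearby_notMem x (ga x) (gb x) (g0 x) (gn x)
  have m3 := fun x : D.crossings => nearby_notMem x (gb x) (ga x) (gn x) (g0 x)
  have m4 := fun x : D.crossings => nearby_notMem x (gb x) (gb x) (gn x) (gn x)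
  have : Finite D.crossings := finite_crossings
  have : Fintype D.crossings := Fintype.ofFinite _
  -- Only regions with a crossing on their boundary contribute, and these are finite in number
  -- because the crossings are.
  let C : D.crossings → Finset (Set Plane) := fun x =>
    {D.region (nearby x (gap x) (gap x)), D.region (nearby x (gap x) (-gap x)),
      D.region (nearby x (-gap x) (gap x)), D.region (nearby x (-gap x) (-gap x))}
  have hC : ∀ x, ∀ R ∈ C x, R ∈ D.regions := by
    intro x R hR
    simp only [C, Finset.mem_insert, Finset.mem_singleton] at hR
    rcases hR with rfl | rfl | rfl | rfl
    exacts [⟨_, m1 x, rfl⟩, ⟨_, m2 x, rfl⟩, ⟨_, m3 x, rfl⟩, ⟨_, m4 x, rfl⟩]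
  let T : Finset (Set Plane) := Finset.univ.biUnion C
  let val : Set Plane → ZMod 2 := fun R => if h : R.Nonempty then f h.some else 0
  have hval : ∀ z ∈ D.supportᶜ, val (D.region z) = f z := by
    intro z hz
    have h : (D.region z).Nonempty := ⟨z, mem_region hz⟩
    simp only [val, h, dif_pos]
    exact hf.eq_of_region_eq (region_subset z h.some_mem) hz (region_eq_of_mem h.some_mem)
  have key : D.extend (fun x => cornerSums f x + doubled f x) = ∑ R ∈ T, val R • D.chi R := by
    funext x
    rw [Finset.sum_apply]
    by_cases hx : x ∈ D.crossings
    · lift x to D.crossings using hx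
      rw [extend_apply]
      simp only [Pi.smul_apply, smul_eq_mul, chi, x.2, true_and, mul_ite, mul_one, mul_zero]
      rw [← Finset.sum_filter]
      have hfil : T.filter (fun R => (x : Plane) ∈ frontier R) = C x := by
        ext R
        rw [Finset.mem_filter]
        have hiff : R ∈ D.regions → ((x : Plane) ∈ frontier R ↔ R ∈ C x) := fun hR => by
          rw [← point_strand x, mem_frontier_iff (cross_strand x) (chart_strand x) (gap_pos x)
            (gap_lt x) hR]
          simp only [C, Finset.mem_insert, Finset.mem_singleton, nearby]
        constructor
        · rintro ⟨h1, h2⟩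
          obtain ⟨y, -, hy⟩ := Finset.mem_biUnion.1 h1
          exact (hiff (hC y R hy)).1 h2
        · intro h
          exact ⟨Finset.mem_biUnion.2 ⟨x, Finset.mem_univ _, h⟩, (hiff (hC x R h)).2 h⟩
      rw [hfil]
      have n1 := region_corner_ne (cross_strand x) (chart_strand x) (ga x) (g0 x) (ga x) (g0 x)
      have n2 := region_corner_ne (cross_strand x) (chart_strand x) (gb x) (gn x) (ga x) (g0 x)
      have n3 := region_corner_ne (cross_strand x).symm ((chart_strand x).symm (cross_strand x).2)
        (ga x) (g0 x) (ga x) (g0 x)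
      have n4 := region_corner_ne (cross_strand x).symm ((chart_strand x).symm (cross_strand x).2)
        (gb x) (gn x) (ga x) (g0 x)
      simp only [← corner_comm (cross_strand x).2] at n3 n4
      -- The finite set of corner regions counts each region once; `doubled` is precisely the
      -- correction to the corner sum.
      refine Eq.trans ?_ (sum_four_corners val n1 n3 n4 n2).symm
      change _ = val (D.region (nearby x _ _)) + val (D.region (nearby x _ _)) +
        (val (D.region (nearby x _ _)) + val (D.region (nearby x _ _))) +
        ((if _ then val (D.region (nearby x _ _)) else 0) +
          (if _ then val (D.region (nearby x _ _)) else 0))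
      rw [hval _ (m1 x), hval _ (m2 x), hval _ (m3 x), hval _ (m4 x)]
      rfl
    · rw [extend_of_notMem _ hx]
      refine (Finset.sum_eq_zero fun R _ => ?_).symm
      simp [chi, hx]
  rw [key]
  refine Submodule.sum_mem _ fun R hR => Submodule.smul_mem _ _ (Submodule.subset_span ⟨R, ?_, rfl⟩)
  obtain ⟨y, -, hy⟩ := Finset.mem_biUnion.1 hR
  exact hC y R hy

open Classical in
/-- The vector of a single crossing. -/
noncomputable def single (x : D.crossings) : Plane → ZMod 2 := Pi.single (x : Plane) 1

open Classical in
theorem extend_eq_sum [Fintype D.crossings] (v : D.crossings → ZMod 2) :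
    D.extend v = ∑ x : D.crossings, v x • single x := by
  funext y
  rw [Finset.sum_apply]
  by_cases hy : y ∈ D.crossings
  · lift y to D.crossings using hy
    rw [extend_apply, Finset.sum_eq_single y]
    · simp [single]
    · intro x _ hx
      simp [single, Subtype.coe_inj, hx.symm]
    · simp
  · rw [extend_of_notMem _ hy]
    refine (Finset.sum_eq_zero fun x _ => ?_).symm
    have : y ≠ x := fun h => hy (h ▸ x.2)
    simp [single, this]

theorem extend_mem_of_single {v : D.crossings → ZMod 2}
    (hv : ∀ x, v x ≠ 0 → single x ∈ D.rccSpan) : D.extend v ∈ D.rccSpan := by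
  have : Finite D.crossings := finite_crossings
  have : Fintype D.crossings := Fintype.ofFinite _
  rw [extend_eq_sum]
  refine Submodule.sum_mem _ fun x _ => ?_
  by_cases h : v x = 0
  · simp [h]
  · exact Submodule.smul_mem _ _ (hv x h)

/-! ### Crossings at which a region occurs twice -/

/-- A path inside the region from one of its corners to the opposite one is closed up by the segment
through the crossing, and `w` is the parity function of this closed curve. The curve meets the
diagram in the crossing only, and there it passes between the other two corners. -/
theorem exists_separating {p q : D.Param} (hx : D.Cross p q) {ε : ℝ} (hc : D.Chart p q ε) {l σ : ℝ}
    (h0 : 0 < l) (h1 : l < ε) (hσ : σ = 1 ∨ σ = -1)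
    (hR : D.region (D.corner p q l (-(σ * l))) = D.region (D.corner p q (-l) (σ * l))) :
    ∃ w : Plane → ZMod 2,
      (∀ z ∉ D.region (D.corner p q l (-(σ * l))), z ≠ D.point p → ∀ᶠ z' in 𝓝 z, w z' = w z) ∧
      ∀ᶠ δ : ℝ in 𝓝[>] 0,
        w (D.corner p q δ (σ * δ)) + w (D.corner p q (-δ) (-(σ * δ))) = 1 := by
  have hσ0 : σ ≠ 0 := by rcases hσ with rfl | rfl <;> norm_num
  have hσσ : 0 < σ * σ := mul_self_pos.2 hσ0
  have hσa : ∀ r : ℝ, |σ * r| = |r| := fun r => by rcases hσ with rfl | rfl <;> simp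
  have la : |l| < ε := by rwa [abs_of_pos h0]
  have lb : |-l| < ε := by rwa [abs_neg]
  have lc : |σ * l| < ε := by rwa [hσa]
  have ld : |-(σ * l)| < ε := by rwa [abs_neg, hσa]
  set b := D.corner p q l (-(σ * l)) with hb
  set c := D.corner p q (-l) (σ * l) with hcc
  have hbR : b ∈ D.region b := mem_region (corner_notMem hc la ld h0.ne'
    (neg_ne_zero.2 (mul_ne_zero hσ0 h0.ne')))
  have hcR : c ∈ D.region b := hR ▸ mem_region (corner_notMem hc lb lc (neg_ne_zero.2 h0.ne')
    (mul_ne_zero hσ0 h0.ne'))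
  obtain ⟨w, hw⟩ := exists_path_parity (isOpen_region b) isPreconnected_connectedComponentIn hbR hcR
  -- At time `m` the coordinates are `1 - 2 * m` times those of `b`: the segment stays in two
  -- opposite quadrants and passes the crossing at `m = 1 / 2`.
  have hseg : ∀ z ∈ segment ℝ b c, z ∈ D.region b ∨ z = D.point p := by
    intro z hz
    rw [segment_eq_image_lineMap] at hz
    obtain ⟨m, ⟨hm0, hm1⟩, rfl⟩ := hz
    have e : AffineMap.lineMap b c m = D.corner p q ((1 - 2 * m) * l) (-(σ * ((1 - 2 * m) * l))) := by
      rw [AffineMap.lineMap_apply_module, hb, hcc]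
      simp only [corner]
      module
    rw [e]
    have k1 : |(1 - 2 * m) * l| < ε := by
      rw [abs_mul, abs_of_pos h0]
      have : |1 - 2 * m| ≤ 1 := abs_le.2 ⟨by linarith, by linarith⟩
      nlinarith
    have k2 : |-(σ * ((1 - 2 * m) * l))| < ε := by rwa [abs_neg, hσa]
    rcases lt_trichotomy (1 - 2 * m) 0 with h | h | h
    · have k3 : (1 - 2 * m) * l < 0 := mul_neg_of_neg_of_pos h h0
      left
      rw [hR, hcc, region_corner_eq hc lb lc k1 k2 (by nlinarith) (by nlinarith [mul_pos hσσ (mul_pos h0 (neg_pos.2 k3))])]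
      exact mem_region (corner_notMem hc k1 k2 k3.ne (neg_ne_zero.2 (mul_ne_zero hσ0 k3.ne)))
    · right; simp [h, corner]
    · have k3 : 0 < (1 - 2 * m) * l := mul_pos h h0
      left
      rw [hb, region_corner_eq hc la ld k1 k2 (by nlinarith) (by nlinarith [mul_pos hσσ (mul_pos h0 k3)])]
      exact mem_region (corner_notMem hc k1 k2 k3.ne' (neg_ne_zero.2 (mul_ne_zero hσ0 k3.ne')))
  have hpR : D.point p ∉ D.region b := fun h => region_subset b h ⟨p, rfl⟩
  refine ⟨w + sweep b c, ?_, ?_⟩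
  · intro z hz hzp
    obtain ⟨κ, hκ⟩ := hw z hz
    obtain ⟨κ', hκ'⟩ := sweep_eventually fun h => (hseg z h).elim hz hzp
    have : ∀ᶠ z' in 𝓝 z, (w + sweep b c) z' = κ + κ' := by
      filter_upwards [hκ, hκ'] with z' e1 e2
      rw [Pi.add_apply, e1, e2]
      linear_combination CharTwo.add_self_eq_zero (levelJump z b z') +
        CharTwo.add_self_eq_zero (levelJump z c z')
    filter_upwards [this] with z' h'
    rw [h', this.self_of_nhds]
  · obtain ⟨κ, hκ⟩ := hw _ hpR
    -- This direction points into the corner not belonging to the region and is transverse to the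
    -- diagonal from `b` to `c`.
    set η := D.vec (D.edgeOf p) + σ • D.vec (D.edgeOf q) with hη
    have hmem : D.point p ∈ openSegment ℝ b c := by
      rw [openSegment_eq_image_lineMap]
      refine ⟨1 / 2, by constructor <;> norm_num, ?_⟩
      rw [AffineMap.lineMap_apply_module, hb, hcc]
      simp only [corner]
      module
    have hdet : det (c - b) η ≠ 0 := by
      have : c - b = (-(2 * l)) • (D.vec (D.edgeOf p) - σ • D.vec (D.edgeOf q)) := by
        rw [hb, hcc]
        simp only [corner]
        module
      rw [this, det_smul_left, hη]
      have e : det (D.vec (D.edgeOf p) - σ • D.vec (D.edgeOf q))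
          (D.vec (D.edgeOf p) + σ • D.vec (D.edgeOf q)) =
          2 * σ * det (D.vec (D.edgeOf p)) (D.vec (D.edgeOf q)) := by
        simp only [det, Prod.fst_sub, Prod.snd_sub, Prod.fst_add, Prod.snd_add, Prod.smul_fst,
          Prod.smul_snd, smul_eq_mul]
        ring
      rw [e]
      exact mul_ne_zero (neg_ne_zero.2 (by positivity))
        (mul_ne_zero (mul_ne_zero two_ne_zero hσ0) hx.det_ne)
    have hcont : Continuous fun δ : ℝ => D.point p + δ • η := by fun_prop
    have hcont' : Continuous fun δ : ℝ => D.point p - δ • η := by fun_prop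
    have t1 := (hcont.tendsto 0).mono_left (nhdsWithin_le_nhds (s := Set.Ioi 0))
    have t2 := (hcont'.tendsto 0).mono_left (nhdsWithin_le_nhds (s := Set.Ioi 0))
    simp only [zero_smul, add_zero, sub_zero] at t1 t2
    filter_upwards [sweep_jump hmem hdet, t1.eventually hκ, t2.eventually hκ] with δ e1 e2 e3
    have c1 : D.corner p q δ (σ * δ) = D.point p + δ • η := by rw [corner, hη]; module
    have c2 : D.corner p q (-δ) (-(σ * δ)) = D.point p - δ • η := by rw [corner, hη]; module
    rw [c1, c2, Pi.add_apply, Pi.add_apply, e2, e3]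
    linear_combination e1 + CharTwo.add_self_eq_zero κ +
      CharTwo.add_self_eq_zero (levelJump (D.point p) b (D.point p + δ • η)) +
      CharTwo.add_self_eq_zero (levelJump (D.point p) b (D.point p - δ • η)) +
      CharTwo.add_self_eq_zero (levelJump (D.point p) c (D.point p + δ • η)) +
      CharTwo.add_self_eq_zero (levelJump (D.point p) c (D.point p - δ • η))

end LinkDiagram

end RegionCrossing

/-! ### Changing a single crossing at which a region occurs twice -/

namespace RegionCrossing

namespace LinkDiagram

variable {D : LinkDiagram}

/-- A function on the plane that separates the two corners of the crossing `x` that do not belong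
to the region `R`, which occurs at the other two corners (their position is given by `σ`). -/
structure Separates (x : D.crossings) (σ : ℝ) (R : Set Plane) (w : Plane → ZMod 2) : Prop where
  sign : σ = 1 ∨ σ = -1
  left : R = D.region (nearby x (gap x) (-(σ * gap x)))
  right : R = D.region (nearby x (-gap x) (σ * gap x))
  locConst : ∀ z ∉ R, z ≠ x → ∀ᶠ z' in 𝓝 z, w z' = w z
  jump : ∀ᶠ δ : ℝ in 𝓝[>] 0, w (nearby x δ (σ * δ)) + w (nearby x (-δ) (-(σ * δ))) = 1

theorem exists_separates {x : D.crossings} {σ : ℝ} (hσ : σ = 1 ∨ σ = -1)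
    (h : D.region (nearby x (gap x) (-(σ * gap x))) = D.region (nearby x (-gap x) (σ * gap x))) :
    ∃ R w, Separates x σ R w := by
  obtain ⟨w, h1, h2⟩ := exists_separating (cross_strand x) (chart_strand x) (gap_pos x) (gap_lt x) hσ h
  exact ⟨_, w, hσ, rfl, h, fun z hz hzx => h1 z hz (by rwa [point_strand]), h2⟩

/-- The sign `σ = 1` stands for the pair of corners with coordinates of different signs, `σ = -1`
for the pair with coordinates of equal signs. -/
theorem exists_separates_of_doubled {f : Plane → ZMod 2} {x : D.crossings} (h : doubled f x ≠ 0) :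
    ∃ σ R w, Separates x σ R w := by
  by_contra! hc
  apply h
  unfold doubled
  rw [if_neg, if_neg, add_zero]
  · intro h'
    obtain ⟨R, w, hw⟩ := exists_separates (x := x) (σ := 1) (Or.inl rfl) (by simpa using h')
    exact hc _ _ _ hw
  · intro h'
    obtain ⟨R, w, hw⟩ := exists_separates (x := x) (σ := -1) (Or.inr rfl) (by simpa using h')
    exact hc _ _ _ hw

theorem Separates.disjoint_support {x : D.crossings} {σ : ℝ} {R : Set Plane} {w : Plane → ZMod 2}
    (h : Separates x σ R w) {z : Plane} (hz : z ∈ D.support) : z ∉ R := by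
  rw [h.left]
  exact fun h' => region_subset _ h' hz

/-- The part of the diagram on one side of a crossing at which a region occurs twice. -/
def side (D : LinkDiagram) (x : Plane) (w : Plane → ZMod 2) (θ : ZMod 2) : Set Plane :=
  {z | z ∈ D.support ∧ z ≠ x ∧ w z = θ + 1}

/-- Of the two sides of `y`, the one without `x` is contained in the side of `x` that contains `y`,
as the diagram is connected. -/
theorem side_subset_side (hD : IsConnected D.support) {x y : D.crossings} {σ σ' : ℝ}
    {R R' : Set Plane} {w w' : Plane → ZMod 2} (hx : Separates x σ R w) (hy : Separates y σ' R' w')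
    {θ : ZMod 2} (hxy : (y : Plane) ∈ D.side x w θ) : D.side y w' (w' x) ⊆ D.side x w θ := by
  classical
  let _ : TopologicalSpace (ZMod 2) := ⊥
  have : DiscreteTopology (ZMod 2) := ⟨rfl⟩
  -- The side of `x` that contains `y` is collapsed to the value of `w'` at `x`. This removes the
  -- only point `y` of the diagram where `w'` may fail to be locally constant, so `h` is continuous
  -- on the connected diagram. A point of the far side of `y` outside the collapsed part would have
  -- the other value.
  let h : Plane → ZMod 2 := fun z => if z ∈ D.side x w θ then w' x else w' z
  have hne : (x : Plane) ≠ y := hxy.2.1.symm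
  have hc : ContinuousOn h D.support := by
    intro z hz
    refine tendsto_nhds_of_eventually_eq ?_
    by_cases hzx : z = x
    · subst hzx
      have h1 := hy.locConst x (hy.disjoint_support hz) hne
      filter_upwards [nhdsWithin_le_nhds h1] with z' h'
      simp only [h]
      split_ifs <;> simp_all
    have h1 := hx.locConst z (hx.disjoint_support hz) hzx
    have h2 : ∀ᶠ z' in 𝓝 z, z' ≠ (x : Plane) := isOpen_ne.mem_nhds hzx
    by_cases hzA : z ∈ D.side x w θ
    · filter_upwards [nhdsWithin_le_nhds h1, nhdsWithin_le_nhds h2, self_mem_nhdsWithin]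
        with z' e1 e2 e3
      have : z' ∈ D.side x w θ := ⟨e3, e2, e1.trans hzA.2.2⟩
      simp only [h, this, hzA, if_true]
    · have hzy : z ≠ y := fun h => hzA (h ▸ hxy)
      filter_upwards [nhdsWithin_le_nhds h1, nhdsWithin_le_nhds h2, self_mem_nhdsWithin,
        nhdsWithin_le_nhds (hy.locConst z (hy.disjoint_support hz) hzy)] with z' e1 e2 e3 e4
      have : z' ∉ D.side x w θ := fun h' => hzA ⟨hz, hzx, e1.symm.trans h'.2.2⟩
      simp only [h, this, hzA, if_false, e4]
  intro z hz
  by_contra hzA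
  have := hD.isPreconnected.constant hc hz.1 (crossings_subset x.2)
  have hxA : (x : Plane) ∉ D.side x w θ := fun h => h.2.1 rfl
  simp only [h, hzA, hxA, if_false] at this
  exact zmod_two_ne_iff.2 hz.2.2 this

theorem tendsto_nearby (x : D.crossings) (a b : ℝ) :
    Tendsto (fun δ : ℝ => nearby x (δ * a) (δ * b)) (𝓝[>] 0) (𝓝 (x : Plane)) := by
  have hcont : Continuous fun δ : ℝ => nearby x (δ * a) (δ * b) := by
    unfold nearby corner; fun_prop
  have := (hcont.tendsto 0).mono_left (nhdsWithin_le_nhds (s := Set.Ioi 0))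
  simpa [nearby, corner, point_strand] using this

open Classical in
/-- The function realizing the change of a single crossing at which a region `R` occurs twice, up to
the changes at the crossings on one side. -/
noncomputable def sideColoring (D : LinkDiagram) (R : Set Plane) (w : Plane → ZMod 2) (θ κ : ZMod 2)
    (z : Plane) : ZMod 2 :=
  if z ∈ R then 0 else (D.checker Set.univ z + κ) * (w z + θ)

theorem Separates.locConst_sideColoring {x : D.crossings} {σ : ℝ} {R : Set Plane}
    {w : Plane → ZMod 2} (h : Separates x σ R w) (θ κ : ZMod 2) :
    D.LocConst (D.sideColoring R w θ κ) := by
  intro z hz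
  by_cases hzR : z ∈ R
  · have hRo : IsOpen R := h.left ▸ isOpen_region _
    filter_upwards [hRo.mem_nhds hzR] with z' hz'
    simp [sideColoring, hzR, hz']
  · have hzR' : ∀ᶠ z' in 𝓝 z, z' ∉ R := by
      have ho : IsOpen (D.region z) := isOpen_region z
      filter_upwards [ho.mem_nhds (mem_region hz)] with z' hz' hR
      apply hzR
      rw [h.left] at hR ⊢
      rw [← region_eq_of_mem hR, region_eq_of_mem hz']
      exact mem_region hz
    have hzx : z ≠ x := fun h' => hz (h' ▸ crossings_subset x.2)
    filter_upwards [hzR', h.locConst z hzR hzx, locConst_checker Set.univ z hz] with z' e1 e2 e3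
    simp [sideColoring, hzR, e1, e2, e3]

theorem LocConst.nearby_eq {f : Plane → ZMod 2} (hf : D.LocConst f) (x : D.crossings)
    {s t s' t' : ℝ} (hs : |s| < 2 * gap x) (ht : |t| < 2 * gap x) (hs' : |s'| < 2 * gap x)
    (ht' : |t'| < 2 * gap x) (hss : 0 < s * s') (htt : 0 < t * t') :
    f (nearby x s t) = f (nearby x s' t') :=
  hf.corner_eq (chart_strand x) hs ht hs' ht' hss htt

theorem exists_small (x : D.crossings) {P : ℝ → Prop} (h : ∀ᶠ δ in 𝓝[>] (0 : ℝ), P δ) :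
    ∃ δ, 0 < δ ∧ δ < 2 * gap x ∧ |δ| < 2 * gap x ∧ |-δ| < 2 * gap x ∧ P δ := by
  have h1 : ∀ᶠ δ in 𝓝[>] (0 : ℝ), δ < 2 * gap x :=
    nhdsWithin_le_nhds (eventually_lt_nhds (chart_strand x).1)
  obtain ⟨δ, h0, h1, h2⟩ := ((eventually_mem_nhdsWithin (a := (0 : ℝ)) (s := Set.Ioi 0)).and
    (h1.and h)).exists
  replace h0 : 0 < δ := h0
  exact ⟨δ, h0, h1, by rwa [abs_of_pos h0], by rwa [abs_neg, abs_of_pos h0], h2⟩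

/-- Near `y` the function `w` is constant, so the colouring is zero there or equals the checkerboard
shifted by `κ`. As `κ` is the checkerboard value on `R`, setting the colour to zero on `R` is
consistent with this. The checkerboard has corner sum zero, and regions can be doubled with colour
one only on the side `w y = θ + 1`. -/
theorem Separates.sideColoring_other {x : D.crossings} {σ : ℝ} {R : Set Plane}
    {w : Plane → ZMod 2} (h : Separates x σ R w) (θ : ZMod 2) {y : D.crossings}
    (hy : (y : Plane) ≠ x) :
    cornerSums (D.sideColoring R w θ (D.checker Set.univ (nearby x (gap x) (-(σ * gap x))))) y = 0 ∧
    (doubled (D.sideColoring R w θ (D.checker Set.univ (nearby x (gap x) (-(σ * gap x))))) y ≠ 0 →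
      w y = θ + 1) := by
  set κ := D.checker Set.univ (nearby x (gap x) (-(σ * gap x)))
  set f := D.sideColoring R w θ κ
  have hf : D.LocConst f := h.locConst_sideColoring θ κ
  have hyR : (y : Plane) ∉ R := h.disjoint_support (crossings_subset y.2)
  have hloc := h.locConst y hyR hy
  have hx : R = D.region (nearby x (gap x) (-(σ * gap x))) := h.left
  have hgσ : nearby x (gap x) (-(σ * gap x)) ∈ D.supportᶜ := by
    refine nearby_notMem x (abs_gap_lt x) ?_ (gap_pos x).ne' ?_
    · rcases h.sign with rfl | rfl
      · simpa using abs_gap_lt x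
      · simpa using abs_gap_lt x
    · have := (gap_pos x).ne'
      rcases h.sign with rfl | rfl <;> simpa
  have key : ∀ z, w z = w y → f z = (D.checker Set.univ z + κ) * (w y + θ) := by
    intro z hz
    simp only [f, sideColoring]
    split_ifs with hzR
    · have : D.checker Set.univ z = κ := by
        rw [hx] at hzR
        exact (locConst_checker _).eq_of_region_eq (region_subset _ hzR) hgσ (region_eq_of_mem hzR)
      rw [this, CharTwo.add_self_eq_zero, zero_mul]
    · rw [hz]
  have ev : ∀ a b : ℝ, ∀ᶠ δ in 𝓝[>] (0 : ℝ), w (nearby y (δ * a) (δ * b)) = w y := fun a b =>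
    (tendsto_nearby y a b).eventually hloc
  obtain ⟨δ, h0, h1, ha, hb, e1, e2, e3, e4⟩ := exists_small y
    ((ev 1 1).and ((ev 1 (-1)).and ((ev (-1) 1).and (ev (-1) (-1)))))
  simp only [mul_one, mul_neg] at e1 e2 e3 e4
  have g0 := gap_pos y
  have ga := abs_gap_lt y
  have gb := abs_neg_gap_lt y
  constructor
  · have hs : cornerSums f y = D.cornerSum f (strand y) (strand' y) δ :=
      hf.cornerSum_eq (chart_strand y) g0 (gap_lt y) h0 h1
    have hch := checker_cornerSum Set.univ (cross_strand y) (chart_strand y) h0 h1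
    rw [hs]
    unfold cornerSum at hch ⊢
    change f (nearby y δ δ) + f (nearby y δ (-δ)) + (f (nearby y (-δ) δ) + f (nearby y (-δ) (-δ))) = 0
    rw [key _ e1, key _ e2, key _ e3, key _ e4]
    change D.checker Set.univ (nearby y δ δ) + D.checker Set.univ (nearby y δ (-δ)) +
      (D.checker Set.univ (nearby y (-δ) δ) + D.checker Set.univ (nearby y (-δ) (-δ))) = 0 at hch
    have k1 := CharTwo.add_self_eq_zero κ
    linear_combination (w y + θ) * hch + 2 * (w y + θ) * k1
  · intro hd
    rw [zmod_two_ne_iff.symm]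
    intro hw
    have hz : ∀ z, w z = w y → f z = 0 := fun z hz => by
      rw [key z hz, hw, CharTwo.add_self_eq_zero, mul_zero]
    apply hd
    have f1 : f (nearby y (gap y) (gap y)) = 0 := by
      rw [hf.nearby_eq y ga ga ha ha (by positivity) (by positivity)]
      exact hz _ e1
    have f2 : f (nearby y (gap y) (-gap y)) = 0 := by
      rw [hf.nearby_eq y ga gb ha hb (by positivity) (by rw [neg_mul_neg]; positivity)]
      exact hz _ e2
    simp [doubled, f1, f2]

/-- Two opposite corners belong to `R` and have colour zero. In the other two the checkerboard
differs from `κ`, so that the colour is `w + θ` there, and `w` takes different values on them.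
Therefore these two corners lie in different regions, and no region of colour one is doubled at `x`.
-/
theorem Separates.sideColoring_self {x : D.crossings} {σ : ℝ} {R : Set Plane}
    {w : Plane → ZMod 2} (h : Separates x σ R w) (θ : ZMod 2) :
    cornerSums (D.sideColoring R w θ (D.checker Set.univ (nearby x (gap x) (-(σ * gap x))))) x +
    doubled (D.sideColoring R w θ (D.checker Set.univ (nearby x (gap x) (-(σ * gap x))))) x = 1 := by
  set κ := D.checker Set.univ (nearby x (gap x) (-(σ * gap x))) with hκ
  set f := D.sideColoring R w θ κ
  have hf : D.LocConst f := h.locConst_sideColoring θ κ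
  have g0 := gap_pos x
  have g0' := (gap_pos x).ne'
  have ga := abs_gap_lt x
  have gb := abs_neg_gap_lt x
  have hσ0 : σ ≠ 0 := by rcases h.sign with rfl | rfl <;> norm_num
  have hσσ : 0 < σ * σ := mul_self_pos.2 hσ0
  have hσa : ∀ r : ℝ, |σ * r| = |r| := fun r => by rcases h.sign with rfl | rfl <;> simp
  have hσa' : ∀ r : ℝ, |-(σ * r)| = |r| := fun r => by rw [abs_neg, hσa]
  have gc : |σ * gap x| < 2 * gap x := by rwa [hσa]
  have gd : |-(σ * gap x)| < 2 * gap x := by rwa [hσa']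
  have m1 := nearby_notMem x ga gc g0' (mul_ne_zero hσ0 g0')
  have m2 := nearby_notMem x ga gd g0' (neg_ne_zero.2 (mul_ne_zero hσ0 g0'))
  have m3 := nearby_notMem x gb gc (neg_ne_zero.2 g0') (mul_ne_zero hσ0 g0')
  have m4 := nearby_notMem x gb gd (neg_ne_zero.2 g0') (neg_ne_zero.2 (mul_ne_zero hσ0 g0'))
  have v2 : f (nearby x (gap x) (-(σ * gap x))) = 0 := by
    have : nearby x (gap x) (-(σ * gap x)) ∈ R := h.left ▸ mem_region m2
    simp [f, sideColoring, this]
  have v3 : f (nearby x (-gap x) (σ * gap x)) = 0 := by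
    have : nearby x (-gap x) (σ * gap x) ∈ R := h.right ▸ mem_region m3
    simp [f, sideColoring, this]
  have j1 := checker_jump Set.univ (cross_strand x) (chart_strand x) ga g0' gc (mul_ne_zero hσ0 g0')
  have j2 := checker_jump Set.univ (cross_strand x) (chart_strand x) gb (neg_ne_zero.2 g0') gc
    (mul_ne_zero hσ0 g0')
  simp only [Set.mem_univ, if_true] at j1 j2
  change D.checker Set.univ (nearby x _ _) + D.checker Set.univ (nearby x _ _) = 1 at j1 j2
  have hκ3 : D.checker Set.univ (nearby x (-gap x) (σ * gap x)) = κ :=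
    (locConst_checker _).eq_of_region_eq m3 m2 (h.right.symm.trans h.left)
  have sum_one : f (nearby x (gap x) (σ * gap x)) + f (nearby x (-gap x) (-(σ * gap x))) = 1 := by
    obtain ⟨δ, h0, h1, ha, hb, hδ⟩ := exists_small x h.jump
    have hc : |σ * δ| < 2 * gap x := by rwa [hσa]
    have hd : |-(σ * δ)| < 2 * gap x := by rwa [hσa']
    have p1 : 0 < gap x * δ := mul_pos g0 h0
    have p2 : 0 < σ * gap x * (σ * δ) := by nlinarith [mul_pos hσσ p1]
    have p3 : 0 < -gap x * -δ := by rwa [neg_mul_neg]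
    have p4 : 0 < -(σ * gap x) * -(σ * δ) := by rwa [neg_mul_neg]
    have d0 := h0.ne'
    rw [hf.nearby_eq x ga gc ha hc p1 p2, hf.nearby_eq x gb gd hb hd p3 p4]
    rw [(locConst_checker Set.univ).nearby_eq x ga gc ha hc p1 p2] at j1
    rw [(locConst_checker Set.univ).nearby_eq x gb gd hb hd p3 p4, hκ3] at j2
    rw [← hκ] at j1
    have notR : ∀ z ∈ D.supportᶜ, D.checker Set.univ z + κ = 1 → z ∉ R := by
      intro z hz hz1 hzR
      rw [h.left] at hzR
      rw [(locConst_checker Set.univ).eq_of_region_eq hz m2 (region_eq_of_mem hzR),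
        CharTwo.add_self_eq_zero] at hz1
      exact zero_ne_one hz1
    rw [add_comm] at j2
    have n1 := notR _ (nearby_notMem x ha hc d0 (mul_ne_zero hσ0 d0)) j1
    have n2 := notR _ (nearby_notMem x hb hd (neg_ne_zero.2 d0) (neg_ne_zero.2 (mul_ne_zero hσ0 d0))) j2
    simp only [f, sideColoring, n1, n2, if_false, j1, j2]
    linear_combination hδ + CharTwo.add_self_eq_zero θ
  have hne : D.region (nearby x (gap x) (σ * gap x)) ≠ D.region (nearby x (-gap x) (-(σ * gap x))) := by
    intro h'
    rw [hf.eq_of_region_eq m1 m4 h', CharTwo.add_self_eq_zero] at sum_one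
    exact zero_ne_one sum_one
  have hc : cornerSums f x = 1 := by
    unfold cornerSums cornerSum
    change f (nearby x _ _) + f (nearby x _ _) + (f (nearby x _ _) + f (nearby x _ _)) = 1
    rcases h.sign with rfl | rfl
    · simp only [one_mul] at *
      rw [v2, v3]
      linear_combination sum_one
    · simp only [neg_one_mul, neg_neg] at *
      rw [v2, v3]
      linear_combination sum_one
  have hd : doubled f x = 0 := by
    unfold doubled
    rcases h.sign with rfl | rfl
    · simp only [one_mul] at *
      rw [if_neg hne, v2]; simp
    · simp only [neg_one_mul, neg_neg] at *
      rw [if_neg hne, v2]; simp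
  rw [hc, hd, add_zero]

/-- If a region occurs twice at a crossing, then that crossing alone can be changed. -/
theorem Separates.single_mem (hD : IsConnected D.support) {x : D.crossings} {σ : ℝ} {R : Set Plane}
    {w : Plane → ZMod 2} (h : Separates x σ R w) : single x ∈ D.rccSpan := by
  classical
  -- The induction is on the number of crossings on one chosen side of `x`, with the separating
  -- curve varying as well.
  suffices H : ∀ (n : ℕ) (x : D.crossings) (σ : ℝ) (R : Set Plane) (w : Plane → ZMod 2) (θ : ZMod 2),
      Separates x σ R w → (D.side x w θ ∩ D.crossings).ncard = n → single x ∈ D.rccSpan from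
    H _ x σ R w 0 h rfl
  intro n
  induction n using Nat.strong_induction_on with
  | _ n ih =>
    intro x σ R w θ h hn
    set κ := D.checker Set.univ (nearby x (gap x) (-(σ * gap x)))
    set f := D.sideColoring R w θ κ
    have hf : D.LocConst f := h.locConst_sideColoring θ κ
    -- The unwanted changes at other crossings. They come from doubled regions on the chosen side of
    -- `x`.
    let v : D.crossings → ZMod 2 := fun y => if y = x then 0 else cornerSums f y + doubled f y
    have hv : D.extend v ∈ D.rccSpan := by
      refine extend_mem_of_single fun y hy => ?_
      have hyx : y ≠ x := fun h => hy (by simp [v, h])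
      have hyx' : (y : Plane) ≠ x := fun h => hyx (Subtype.ext h)
      obtain ⟨h1, h2⟩ := h.sideColoring_other θ hyx'
      simp only [v, hyx, if_false] at hy
      rw [h1, zero_add] at hy
      have hys : (y : Plane) ∈ D.side x w θ := ⟨crossings_subset y.2, hyx', h2 hy⟩
      obtain ⟨σ', R', w', h'⟩ := exists_separates_of_doubled hy
      -- For `y` the side without `x` is taken. It lies in the chosen side of `x` and does not
      -- contain `y`, so it has fewer crossings.
      refine ih _ ?_ y σ' R' w' (w' x) h' rfl
      rw [← hn]
      refine Set.ncard_lt_ncard ⟨Set.inter_subset_inter_left _ (side_subset_side hD h h' hys), ?_⟩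
        (finite_crossings.subset Set.inter_subset_right)
      intro hsub
      exact (hsub ⟨hys, y.2⟩).1.2.1 rfl
    have : single x = D.extend (fun y => cornerSums f y + doubled f y) - D.extend v := by
      funext z
      rw [Pi.sub_apply]
      by_cases hz : z ∈ D.crossings
      · lift z to D.crossings using hz
        rw [extend_apply, extend_apply]
        by_cases hzx : z = x
        · subst hzx
          simp [single, v, f, κ, h.sideColoring_self θ]
        · have : (z : Plane) ≠ x := fun h => hzx (Subtype.ext h)
          simp [single, v, hzx, this]
      · have : z ≠ x := fun h => hz (h ▸ x.2)
        simp [single, extend_of_notMem _ hz, this]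
    rw [this]
    exact Submodule.sub_mem _ hf.extend_mem hv

/-- The doubled terms can be removed crossing by crossing, after which regions may be counted with
the multiplicity of their corners. From here on colourings can be used freely. -/
theorem LocConst.extend_cornerSums_mem (hD : IsConnected D.support) {f : Plane → ZMod 2}
    (hf : D.LocConst f) : D.extend (fun x => cornerSums f x) ∈ D.rccSpan := by
  have h1 : D.extend (fun x => doubled f x) ∈ D.rccSpan := by
    refine extend_mem_of_single fun x hx => ?_
    obtain ⟨σ, R, w, h⟩ := exists_separates_of_doubled hx
    exact h.single_mem hD
  have : D.extend (fun x => cornerSums f x) =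
      D.extend (fun x => cornerSums f x + doubled f x) - D.extend (fun x => doubled f x) := by
    funext z
    by_cases hz : z ∈ D.crossings
    · simp [extend, hz]
    · simp [extend, hz]
  rw [this]
  exact Submodule.sub_mem _ hf.extend_mem h1

end LinkDiagram

end RegionCrossing

/-! ### The sets of crossings that region crossing changes can change -/

namespace RegionCrossing

namespace LinkDiagram

variable {D : LinkDiagram}

/-- A crossing of the two components. -/
def Mixed (D : LinkDiagram) (x : Plane) : Prop :=
  ∃ p q, D.Cross p q ∧ D.point p = x ∧ p.1 = 0 ∧ q.1 = 1

theorem Cross.mixed_iff {p q : D.Param} (h : D.Cross p q) : D.Mixed (D.point p) ↔ p.1 ≠ q.1 := by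
  constructor
  · rintro ⟨p', q', h', hp, h0, h1⟩
    rcases h.eq_or_eq hp with rfl | rfl
    · rw [← h.eq_of_left h', h0, h1]; decide
    · rw [← h.symm.eq_of_left h', h0, h1]; decide
  · intro hne
    have : p.1 = 0 ∧ q.1 = 1 ∨ p.1 = 1 ∧ q.1 = 0 := by omega
    rcases this with ⟨h0, h1⟩ | ⟨h0, h1⟩
    · exact ⟨p, q, h, rfl, h0, h1⟩
    · exact ⟨q, p, h.symm, h.2.symm, h1, h0⟩

theorem mixed_iff_strand (x : D.crossings) : D.Mixed x ↔ (strand x).1 ≠ (strand' x).1 := by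
  rw [← (cross_strand x).mixed_iff, point_strand]

open Classical in
theorem cornerSums_cut {c c' : ∀ k, ZMod (D.comp k).n × Set.Ico (0 : ℝ) 1}
    (h : D.Homologous (D.cut c) (D.cut c')) (x : D.crossings) :
    cornerSums (D.coloring (D.cut c) (D.cut c')) x =
      (if strand x = ⟨_, c (strand x).1⟩ then 1 else 0) +
      (if strand x = ⟨_, c' (strand x).1⟩ then 1 else 0) := by
  rw [cornerSums, h.cornerSum (cross_strand x) (chart_strand x) (gap_pos x) (gap_lt x)]
  simp only [cut_eq_iff _ (cross_strand x).pos]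

/-- A crossing of a component with itself can be changed by region crossing changes. -/
theorem single_mem_of_not_mixed (hD : IsConnected D.support) {x : D.crossings} (hx : ¬ D.Mixed x) :
    single x ∈ D.rccSpan := by
  classical
  rw [mixed_iff_strand, not_not] at hx
  have hcr := cross_strand x
  obtain ⟨⟨k, a⟩, hp⟩ : ∃ p, strand x = p := ⟨_, rfl⟩
  obtain ⟨⟨l, b⟩, hq⟩ : ∃ p, strand' x = p := ⟨_, rfl⟩
  rw [hp, hq] at hx hcr
  obtain rfl : k = l := hx
  -- The two arcs on component `k` end at the two passages through `x`, hence at the same point of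
  -- the plane. On the other component the arc is trivial.
  let o : ∀ k, ZMod (D.comp k).n × Set.Ico (0 : ℝ) 1 := fun k => (0, ⟨0, by simp⟩)
  let c := Function.update o k a
  let c' := Function.update o k b
  have hh : D.Homologous (D.cut c) (D.cut c') := by
    refine homologous_cut fun φ => Finset.sum_congr rfl fun l _ => ?_
    by_cases hl : l = k
    · subst hl
      simp only [c, c', Function.update_self]
      rw [hcr.2]
    · simp only [c, c', Function.update_of_ne hl]
  -- The trivial arc ends at time `0`, but strands at crossings have positive time, so it
  -- contributes to no corner sum.
  have key : ∀ (y : D.crossings) (d : ZMod (D.comp k).n × Set.Ico (0 : ℝ) 1),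
      strand y = ⟨_, Function.update o k d (strand y).1⟩ ↔ strand y = ⟨k, d⟩ := by
    intro y d
    have h0 := (cross_strand y).pos
    generalize strand y = r at h0
    obtain ⟨l, e⟩ := r
    by_cases hl : l = k
    · subst hl; simp
    · simp only [Function.update_of_ne hl, Sigma.mk.injEq, hl, false_and, iff_false, true_and,
        heq_eq_eq]
      rintro rfl
      exact lt_irrefl _ h0
  have := hh.locConst.extend_cornerSums_mem hD
  convert this using 1
  funext z
  by_cases hz : z ∈ D.crossings
  · lift z to D.crossings using hz
    rw [extend_apply, cornerSums_cut hh]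
    simp only [c, c', key]
    by_cases hzx : z = x
    · subst hzx
      rw [hp, if_pos rfl, if_neg hcr.1]
      simp [single]
    · have hne : ∀ r, D.point r = x → strand z ≠ r := fun r hr h => hzx (Subtype.ext (by
        rw [← point_strand z, h, hr]))
      rw [if_neg (hne _ (by rw [← hp, point_strand])),
        if_neg (hne _ (by rw [← hcr.2, ← hp, point_strand]))]
      simp [single, Subtype.coe_inj, hzx]
  · have : z ≠ x := fun h => hz (h ▸ x.2)
    simp [single, extend_of_notMem _ hz, this]

/-- Two crossings of both components can be changed simultaneously by region crossing changes. -/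
theorem single_add_single_mem (hD : IsConnected D.support) {x y : D.crossings} (hx : D.Mixed x)
    (hy : D.Mixed y) : single x + single y ∈ D.rccSpan := by
  classical
  have ex : ∀ x : D.crossings, D.Mixed x → ∀ k, ∃ a, D.point ⟨k, a⟩ = x := by
    rintro x ⟨p, q, h, hp, h0, h1⟩ k
    have : k = 0 ∨ k = 1 := by omega
    rcases this with rfl | rfl
    · rw [← h0]; exact ⟨p.2, hp⟩
    · rw [← h1]; exact ⟨q.2, h.2 ▸ hp⟩
  choose c hc using ex x hx
  choose c' hc' using ex y hy
  -- The arcs of both components end at the same crossing, so that their end points cancel modulo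
  -- two, for `x` as well as for `y`.
  have hh : D.Homologous (D.cut c) (D.cut c') := by
    refine homologous_cut fun φ => ?_
    simp only [hc, hc', Fin.sum_univ_two, CharTwo.add_self_eq_zero]
  have key : ∀ (x : D.crossings) (_ : D.Mixed x) (c : ∀ k, ZMod (D.comp k).n × Set.Ico (0 : ℝ) 1)
      (_ : ∀ k, D.point ⟨k, c k⟩ = x) (z : D.crossings),
      strand z = ⟨_, c (strand z).1⟩ ↔ z = x := by
    intro x hx c hc z
    constructor
    · intro h
      refine Subtype.ext ?_
      rw [← point_strand z, h, hc]
    · rintro rfl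
      rw [mixed_iff_strand] at hx
      rcases (cross_strand z).eq_or_eq (r := ⟨_, c (strand z).1⟩) (by rw [hc, point_strand]) with h | h
      · exact h.symm
      · exact absurd (congrArg Sigma.fst h) hx
  have := hh.locConst.extend_cornerSums_mem hD
  convert this using 1
  funext z
  by_cases hz : z ∈ D.crossings
  · lift z to D.crossings using hz
    rw [extend_apply, cornerSums_cut hh]
    simp only [key x hx c hc, key y hy c' hc']
    simp [single, Pi.single_apply, Subtype.coe_inj]
  · have h1 : z ≠ x := fun h => hz (h ▸ x.2)
    have h2 : z ≠ y := fun h => hz (h ▸ y.2)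
    simp [single, extend_of_notMem _ hz, h1, h2]

open Classical in
/-- Any set of crossings containing an even number of crossings of both components can be changed by
region crossing changes. -/
theorem extend_mem_of_even (hD : IsConnected D.support) [Fintype D.crossings]
    {v : D.crossings → ZMod 2} (hv : ∑ x : D.crossings with D.Mixed x.1, v x = 0) :
    D.extend v ∈ D.rccSpan := by
  by_cases hx : ∃ x : D.crossings, D.Mixed x
  · obtain ⟨x₀, hx₀⟩ := hx
    -- Every mixed crossing is changed together with the fixed one `x₀`; by evenness the total
    -- change at `x₀` from these additions is zero.
    have : D.extend v = ∑ x : D.crossings,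
        v x • (single x + if D.Mixed x then single x₀ else 0) := by
      simp only [smul_add, Finset.sum_add_distrib, smul_ite, smul_zero]
      rw [← Finset.sum_filter, ← Finset.sum_smul, hv, zero_smul, add_zero, extend_eq_sum]
    rw [this]
    refine Submodule.sum_mem _ fun x _ => Submodule.smul_mem _ _ ?_
    split_ifs with h
    · exact single_add_single_mem hD h hx₀
    · rw [add_zero]
      exact single_mem_of_not_mixed hD h
  · push Not at hx
    exact extend_mem_of_single fun x _ => single_mem_of_not_mixed hD (hx x)

/-! ### Sequences of region crossing changes -/

theorem mk_eq_mk {P : PolygonPair Plane} {h1 h2 U h3 h4 U' h3' h4'} (h : U = U') :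
    (⟨P, h1, h2, U, h3, h4⟩ : LinkDiagram) = ⟨P, h1, h2, U', h3', h4'⟩ := by
  subst h; rfl

theorem crossingChange_congr {S S' : Set Plane} (h : ∀ x ∈ D.crossings, x ∈ S ↔ x ∈ S') :
    D.crossingChange S = D.crossingChange S' := by
  refine mk_eq_mk ?_
  ext p
  simp only [Set.mem_ofPred_eq]
  constructor
  · rintro ⟨h1, h2⟩
    exact ⟨h1, by rw [← h _ h1]; exact h2⟩
  · rintro ⟨h1, h2⟩
    exact ⟨h1, by rw [h _ h1]; exact h2⟩

theorem crossingChange_empty : D.crossingChange ∅ = D := by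
  obtain ⟨P, h1, h2, U, h3, h4⟩ := D
  refine mk_eq_mk ?_
  ext p
  simp only [Set.mem_ofPred_eq, Set.mem_empty_iff_false, not_false_iff, iff_true]
  exact ⟨fun h => h.2, fun h => ⟨h3 p h, h⟩⟩

theorem crossingChange_crossingChange (S S' : Set Plane) :
    (D.crossingChange S).crossingChange S' = D.crossingChange (symmDiff S S') := by
  refine mk_eq_mk ?_
  ext p
  change (D.point p ∈ D.crossings ∧ ((D.point p ∈ D.crossings ∧ (p ∈ D.upper ↔ D.point p ∉ S)) ↔
    D.point p ∉ S')) ↔ D.point p ∈ D.crossings ∧ (p ∈ D.upper ↔ D.point p ∉ symmDiff S S')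
  rw [Set.mem_symmDiff]
  tauto

/-- The crossings with nonzero entry in a vector. -/
def supp (v : Plane → ZMod 2) : Set Plane := {x | v x ≠ 0}

theorem supp_add (v w : Plane → ZMod 2) : supp (v + w) = symmDiff (supp v) (supp w) := by
  ext x
  simp only [supp, Set.mem_symmDiff, Set.mem_ofPred_eq, Pi.add_apply]
  generalize v x = a
  generalize w x = b
  revert a b
  decide

theorem crossingChange_chi (R : Set Plane) :
    D.crossingChange (supp (D.chi R)) = D.crossingChange (frontier R) :=
  crossingChange_congr fun x hx => by simp [supp, chi, hx]

/-- Crossing changes do not affect the projection, so the regions and their incidence vectors stay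
the same and successive changes add up. Starting from an arbitrary set `S` lets the sequences of the
span induction be concatenated. -/
theorem reflTransGen_of_mem {v : Plane → ZMod 2} (hv : v ∈ D.rccSpan) :
    Relation.ReflTransGen RegionCrossingChange D (D.crossingChange (supp v)) := by
  suffices H : ∀ S : Set Plane, Relation.ReflTransGen RegionCrossingChange (D.crossingChange S)
      (D.crossingChange (symmDiff S (supp v))) by
    have := H ∅
    rwa [crossingChange_empty, ← Set.bot_eq_empty, bot_symmDiff] at this
  have h0 : supp (0 : Plane → ZMod 2) = ⊥ := by simp [supp]
  induction hv using Submodule.span_induction with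
  | mem v hv =>
    obtain ⟨R, hR, rfl⟩ := hv
    intro S
    refine Relation.ReflTransGen.single ⟨R, hR, ?_⟩
    rw [← crossingChange_crossingChange]
    exact crossingChange_chi (D := D.crossingChange S) R
  | zero =>
    intro S
    rw [h0, symmDiff_bot]
  | add v w _ _ hv hw =>
    intro S
    rw [supp_add, ← symmDiff_assoc]
    exact (hv S).trans (hw _)
  | smul a v _ hv =>
    intro S
    rcases zmod_two_eq_zero_or_one a with rfl | rfl
    · rw [zero_smul, h0, symmDiff_bot]
    · rw [one_smul]; exact hv S

theorem exists_mem_of_reflTransGen {D' : LinkDiagram}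
    (h : Relation.ReflTransGen RegionCrossingChange D D') :
    ∃ v ∈ D.rccSpan, D' = D.crossingChange (supp v) := by
  induction h with
  | refl => exact ⟨0, Submodule.zero_mem _, by simp [supp, crossingChange_empty]⟩
  | tail _ h ih =>
    obtain ⟨v, hv, rfl⟩ := ih
    obtain ⟨R, hR, rfl⟩ := h
    refine ⟨v + D.chi R, Submodule.add_mem _ hv (Submodule.subset_span ⟨R, hR, rfl⟩), ?_⟩
    rw [supp_add, ← crossingChange_crossingChange]
    exact (crossingChange_chi (D := D.crossingChange (supp v)) R).symm

end LinkDiagram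

end RegionCrossing

/-! ### The jump of a colouring along an edge -/

namespace RegionCrossing

/-- The total change of a piecewise constant function on the unit interval is the sum of its jumps. -/
theorem total_change {h m : ℝ → ZMod 2} {T : Finset ℝ} (hT : ∀ τ ∈ T, 0 < τ ∧ τ < 1)
    (hm : ∀ t ∈ Set.Ioo (0 : ℝ) 1, ∃ a b, (∀ᶠ s in 𝓝[<] t, h s = a) ∧ (∀ᶠ s in 𝓝[>] t, h s = b) ∧
      a + b = if t ∈ T then m t else 0)
    {h₀ h₁ : ZMod 2} (e₀ : ∀ᶠ s in 𝓝[>] 0, h s = h₀) (e₁ : ∀ᶠ s in 𝓝[<] 1, h s = h₁) :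
    h₀ + h₁ = ∑ τ ∈ T, m τ := by
  classical
  -- A step function with the same jumps as `h`, continuous from the left because of the strict
  -- inequality. The sum `h + S` then has no jumps.
  let S : ℝ → ZMod 2 := fun t => ∑ τ ∈ T with τ < t, m τ
  have hleft : ∀ t, ∀ᶠ s in 𝓝[<] t, S s = S t := by
    intro t
    have : ∀ᶠ s in 𝓝[<] t, ∀ τ ∈ T, τ < t → τ < s := by
      refine (eventually_all_finset T).2 fun τ _ => ?_
      by_cases hτ : τ < t
      · filter_upwards [nhdsWithin_le_nhds (eventually_gt_nhds hτ)] with s hs _ using hs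
      · exact .of_forall fun s h' => absurd h' hτ
    filter_upwards [this, self_mem_nhdsWithin] with s hs hst
    refine Finset.sum_congr (Finset.filter_congr fun τ hτ => ⟨fun h => h.trans hst, hs τ hτ⟩)
      fun _ _ => rfl
  have hright : ∀ t, ∀ᶠ s in 𝓝[>] t, S s = S t + if t ∈ T then m t else 0 := by
    intro t
    have : ∀ᶠ s in 𝓝[>] t, ∀ τ ∈ T, t < τ → s < τ := by
      refine (eventually_all_finset T).2 fun τ _ => ?_
      by_cases hτ : t < τ
      · filter_upwards [nhdsWithin_le_nhds (eventually_lt_nhds hτ)] with s hs _ using hs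
      · exact .of_forall fun s h' => absurd h' hτ
    filter_upwards [this, self_mem_nhdsWithin] with s hs hst
    replace hst : t < s := hst
    have e : T.filter (fun τ => τ < s) = T.filter (fun τ => τ < t) ∪ T.filter (fun τ => τ = t) := by
      ext τ
      simp only [Finset.mem_filter, Finset.mem_union]
      constructor
      · rintro ⟨h1, h2⟩
        rcases lt_trichotomy τ t with h3 | h3 | h3
        · exact Or.inl ⟨h1, h3⟩
        · exact Or.inr ⟨h1, h3⟩
        · exact absurd (hs τ h1 h3) h2.not_gt
      · rintro (⟨h1, h2⟩ | ⟨h1, h2⟩)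
        · exact ⟨h1, h2.trans hst⟩
        · exact ⟨h1, h2 ▸ hst⟩
    have hd : Disjoint (T.filter fun τ => τ < t) (T.filter fun τ => τ = t) := by
      refine Finset.disjoint_filter.2 fun τ _ h1 h2 => ?_
      exact h1.ne h2
    simp only [S]
    rw [e, Finset.sum_union hd, Finset.sum_filter (fun τ => τ = t), Finset.sum_ite_eq']
  have hc : ∀ t ∈ Set.Ioo (0 : ℝ) 1, ∃ c, ∀ᶠ s in 𝓝[≠] t, h s + S s = c := by
    intro t ht
    obtain ⟨a, b, ha, hb, hab⟩ := hm t ht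
    refine ⟨a + S t, ?_⟩
    rw [← Set.Iio_union_Ioi, nhdsWithin_union, eventually_sup]
    constructor
    · filter_upwards [ha, hleft t] with s h1 h2
      rw [h1, h2]
    · filter_upwards [hb, hright t] with s h1 h2
      rw [h1, h2, ← hab]
      linear_combination CharTwo.add_self_eq_zero b
  -- `c t` is the value of `h + S` on both sides of `t`. The value at `t` itself is disregarded,
  -- since nothing is known about `h` at a jump.
  choose! c hc using hc
  have hconst : ∀ t ∈ Set.Ioo (0 : ℝ) 1, ∀ t' ∈ Set.Ioo (0 : ℝ) 1, c t = c t' := by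
    let _ : TopologicalSpace (ZMod 2) := ⊥
    have : DiscreteTopology (ZMod 2) := ⟨rfl⟩
    have hcont : ContinuousOn c (Set.Ioo 0 1) := by
      intro t ht
      refine tendsto_nhds_of_eventually_eq ?_
      have h1 := eventually_eventually_nhds.2 (eventually_nhdsWithin_iff.1 (hc t ht))
      filter_upwards [nhdsWithin_le_nhds h1, self_mem_nhdsWithin] with t' h2 ht'
      by_cases htt : t' = t
      · rw [htt]
      have h3 : ∀ᶠ s in 𝓝[≠] t', h s + S s = c t := by
        have h4 : ∀ᶠ s in 𝓝 t', s ≠ t := isOpen_ne.mem_nhds htt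
        exact nhdsWithin_le_nhds (h2.and h4 |>.mono fun s hs => hs.1 hs.2)
      obtain ⟨s, h4, h5⟩ := (h3.and (hc t' ht')).exists
      exact h5.symm.trans h4
    intro t ht t' ht'
    exact isPreconnected_Ioo.constant hcont ht ht'
  have pick : ∀ {P : ℝ → Prop} {t : ℝ}, t ∈ Set.Ioo (0 : ℝ) 1 → (∀ᶠ s in 𝓝 t, P s) →
      ∃ s, P s ∧ h s + S s = c (1 / 2) := by
    intro P t ht hP
    obtain ⟨s, h1, h2⟩ := ((hc t ht).and (nhdsWithin_le_nhds hP)).exists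
    exact ⟨s, h2, h1.trans (hconst t ht _ (by constructor <;> norm_num))⟩
  have S0 : S 0 = 0 := by
    simp only [S]
    rw [Finset.filter_false_of_mem fun τ hτ => (hT τ hτ).1.not_gt, Finset.sum_empty]
  have S1 : S 1 = ∑ τ ∈ T, m τ := by
    simp only [S]
    rw [Finset.filter_true_of_mem fun τ hτ => (hT τ hτ).2]
  have k0 : h₀ = c (1 / 2) := by
    have h1 : ∀ᶠ s in 𝓝[>] (0 : ℝ), h s = h₀ ∧ S s = 0 := by
      filter_upwards [e₀, hright 0] with s h1 h2
      rw [if_neg fun h => lt_irrefl _ (hT 0 h).1, add_zero, S0] at h2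
      exact ⟨h1, h2⟩
    have h1' := eventually_eventually_nhdsWithin.2 h1
    have h2 : ∀ᶠ s in 𝓝[>] (0 : ℝ), s < 1 := nhdsWithin_le_nhds (eventually_lt_nhds one_pos)
    obtain ⟨t, ⟨h3, h4⟩, h5⟩ := ((h1'.and h2).and self_mem_nhdsWithin).exists
    rw [IsOpen.nhdsWithin_eq isOpen_Ioi h5] at h3
    obtain ⟨s, ⟨h6, h7⟩, h8⟩ := pick ⟨h5, h4⟩ h3
    rw [← h8, h6, h7, add_zero]
  have k1 : h₁ + ∑ τ ∈ T, m τ = c (1 / 2) := by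
    have h1 : ∀ᶠ s in 𝓝[<] (1 : ℝ), h s = h₁ ∧ S s = ∑ τ ∈ T, m τ := by
      filter_upwards [e₁, hleft 1] with s h1 h2
      exact ⟨h1, h2.trans S1⟩
    have h1' := eventually_eventually_nhdsWithin.2 h1
    have h2 : ∀ᶠ s in 𝓝[<] (1 : ℝ), 0 < s := nhdsWithin_le_nhds (eventually_gt_nhds one_pos)
    obtain ⟨t, ⟨h3, h4⟩, h5⟩ := ((h1'.and h2).and self_mem_nhdsWithin).exists
    rw [IsOpen.nhdsWithin_eq isOpen_Iio h5] at h3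
    obtain ⟨s, ⟨h6, h7⟩, h8⟩ := pick ⟨h4, h5⟩ h3
    rw [← h8, h6, h7]
  rw [k0, ← k1]
  linear_combination CharTwo.add_self_eq_zero h₁

/-- The vector rotated by a right angle. -/
def rot (v : Plane) : Plane := (-v.2, v.1)

theorem det_rot_ne {v : Plane} (hv : v ≠ 0) : det v (rot v) ≠ 0 := by
  have : det v (rot v) = v.1 * v.1 + v.2 * v.2 := by simp [det, rot]
  rw [this]
  intro h
  apply hv
  have h1 : v.1 * v.1 = 0 := by nlinarith [mul_self_nonneg v.1, mul_self_nonneg v.2]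
  have h2 : v.2 * v.2 = 0 := by nlinarith [mul_self_nonneg v.1, mul_self_nonneg v.2]
  exact Prod.ext (mul_self_eq_zero.1 h1) (mul_self_eq_zero.1 h2)

namespace LinkDiagram

variable {D : LinkDiagram}

theorem LocConst.eq_of_convex {f : Plane → ZMod 2} (hf : D.LocConst f) (x u w : Plane)
    {S : Set (ℝ × ℝ)} (hS : Convex ℝ S) (h : ∀ s t, (s, t) ∈ S → x + (s • u + t • w) ∈ D.supportᶜ)
    {s t s' t' : ℝ} (h1 : (s, t) ∈ S) (h2 : (s', t') ∈ S) :
    f (x + (s • u + t • w)) = f (x + (s' • u + t' • w)) := by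
  have hc : Continuous fun st : ℝ × ℝ => x + (st.1 • u + st.2 • w) := by fun_prop
  have hp := hS.isPreconnected.image _ hc.continuousOn
  refine hf.eq_of_region_eq (h _ _ h1) (h _ _ h2) (region_eq_of_mem ?_).symm
  refine hp.subset_connectedComponentIn ⟨_, h1, rfl⟩ ?_ ⟨_, h2, rfl⟩
  rintro _ ⟨⟨a, b⟩, hab, rfl⟩
  exact h a b hab

open Classical in
/-- The jump of a locally constant function across an edge. -/
noncomputable def edgeJump (f : Plane → ZMod 2) (e : D.Edge) (t : ℝ) : ZMod 2 :=
  if ∀ᶠ δ : ℝ in 𝓝[>] 0, f (D.along e t + δ • rot (D.vec e)) + f (D.along e t - δ • rot (D.vec e)) = 1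
  then 1 else 0

/-- The definition returns `0` unless the jump is eventually `1`; with only two values in `ZMod 2`
this recovers every eventual value. -/
theorem edgeJump_eq {f : Plane → ZMod 2} {e : D.Edge} {t : ℝ} {c : ZMod 2}
    (h : ∀ᶠ δ : ℝ in 𝓝[>] 0,
      f (D.along e t + δ • rot (D.vec e)) + f (D.along e t - δ • rot (D.vec e)) = c) :
    edgeJump f e t = c := by
  unfold edgeJump
  split_ifs with h'
  · obtain ⟨δ, h1, h2⟩ := (h.and h').exists
    exact h2.symm.trans h1
  · rcases zmod_two_eq_zero_or_one c with rfl | rfl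
    · rfl
    · exact absurd h h'

/-- Near a point of an edge which is neither a vertex nor a crossing, only that edge is visible. -/
theorem exists_half_chart {e : D.Edge} {t : ℝ} (h0 : 0 < t) (h1 : t < 1)
    (hx : D.along e t ∉ D.crossings) {η : Plane} (hη : det (D.vec e) η ≠ 0) :
    ∃ ε > 0, ∀ a b : ℝ, |a| < ε → |b| < ε →
      D.along e t + (a • D.vec e + b • η) ∈ D.support → b = 0 := by
  obtain ⟨ε, hε, H⟩ := eventually_coord _ (D.vec e) η
    (eventually_mem_edgeSet D.toPolygonPair (D.along e t))
  refine ⟨ε, hε, fun a b ha hb hmem => ?_⟩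
  rw [support_eq_iUnion] at hmem
  obtain ⟨e', he'⟩ := Set.mem_iUnion.1 hmem
  have h2 := H a b ha hb e' he'
  have he : e' = e := by
    by_contra hne
    exact notMem_edgeSet_of_notMem_crossings (p := D.param e t ⟨h0.le, h1⟩) h0 hx hne h2
  rw [he, D.edgeSet_eq] at he'
  obtain ⟨r, -, hr⟩ := he'
  rw [D.along_eq, D.along_eq, add_assoc, add_right_inj, ← add_assoc, ← add_smul] at hr
  exact (coord_unique hη (s := r) (t := 0) (s' := t + a) (t' := b)
    (by rw [zero_smul, add_zero]; exact hr)).2.symm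

theorem half_chart_eq {f : Plane → ZMod 2} (hf : D.LocConst f) {x u w : Plane} {ε : ℝ}
    (h : ∀ a b : ℝ, |a| < ε → |b| < ε → x + (a • u + b • w) ∈ D.support → b = 0) {a b a' b' : ℝ}
    (ha : |a| < ε) (hb : |b| < ε) (ha' : |a'| < ε) (hb' : |b'| < ε) (hbb : 0 < b * b') :
    f (x + (a • u + b • w)) = f (x + (a' • u + b' • w)) := by
  rw [abs_lt] at ha hb ha' hb'
  rcases lt_or_gt_of_ne (left_ne_zero_of_mul hbb.ne') with h0 | h0
  · have h0' : b' < 0 := by by_contra! hc; nlinarith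
    refine hf.eq_of_convex x u w ((convex_Ioo (-ε) ε).prod (convex_Ioo (-ε) 0)) ?_ ⟨ha, hb.1, h0⟩
      ⟨ha', hb'.1, h0'⟩
    rintro s t ⟨h1, h2⟩ hmem
    simp only [Set.mem_Ioo] at h1 h2
    exact h2.2.ne (h s t (abs_lt.2 h1) (abs_lt.2 ⟨h2.1, by linarith⟩) hmem)
  · have h0' : 0 < b' := by by_contra! hc; nlinarith
    refine hf.eq_of_convex x u w ((convex_Ioo (-ε) ε).prod (convex_Ioo 0 ε)) ?_ ⟨ha, h0, hb.2⟩
      ⟨ha', h0', hb'.2⟩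
    rintro s t ⟨h1, h2⟩ hmem
    simp only [Set.mem_Ioo] at h1 h2
    exact h2.1.ne' (h s t (abs_lt.2 h1) (abs_lt.2 ⟨by linarith, h2.2⟩) hmem)

theorem eventually_abs_mul_lt (a : ℝ) {ε : ℝ} (hε : 0 < ε) : ∀ᶠ δ : ℝ in 𝓝[>] 0, |δ * a| < ε := by
  have : Continuous fun δ : ℝ => |δ * a| := by fun_prop
  have := (this.tendsto 0).eventually_lt_const (u := ε) (by simpa)
  exact nhdsWithin_le_nhds this

/-- On each side of the edge the colouring is constant in the chart, so the normal direction in the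
definition of the jump may be replaced by any transverse direction and any distance inside the
chart. -/
theorem edgeJump_eq_corner {f : Plane → ZMod 2} (hf : D.LocConst f) {e : D.Edge} {t : ℝ}
    {η : Plane} (hη : det (D.vec e) η ≠ 0) {ε : ℝ} (hε : 0 < ε)
    (h : ∀ a b : ℝ, |a| < ε → |b| < ε → D.along e t + (a • D.vec e + b • η) ∈ D.support → b = 0)
    {a : ℝ} (ha : |a| < ε) {b : ℝ} (hb : |b| < ε) (hb0 : b ≠ 0) :
    edgeJump f e (t + a) = f (D.along e t + (a • D.vec e + b • η)) +
      f (D.along e t + (a • D.vec e + (-b) • η)) := by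
  wlog hb1 : 0 < b generalizing b
  · rw [this (b := -b) (by rwa [abs_neg]) (neg_ne_zero.2 hb0)
      (by rcases lt_or_gt_of_ne hb0 with h | h <;> [linarith; exact absurd h hb1]), neg_neg, add_comm]
  refine edgeJump_eq ?_
  have hb' : |-b| < ε := by rwa [abs_neg]
  set c := det (rot (D.vec e)) η / det (D.vec e) η with hc
  set d := det (D.vec e) (rot (D.vec e)) / det (D.vec e) η with hd
  have hrot : rot (D.vec e) = c • D.vec e + d • η := eq_coord hη _
  have hd0 : d ≠ 0 := div_ne_zero (det_rot_ne (D.vec_ne_zero e)) hη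
  have ha' : 0 < ε - |a| := sub_pos.2 ha
  filter_upwards [eventually_abs_mul_lt c ha', eventually_abs_mul_lt d hε, self_mem_nhdsWithin]
    with δ h1 h2 hδ
  replace hδ : 0 < δ := hδ
  have e1 : D.along e (t + a) + δ • rot (D.vec e) =
      D.along e t + ((a + δ * c) • D.vec e + (δ * d) • η) := by
    rw [D.along_eq, D.along_eq, hrot]; module
  have e2 : D.along e (t + a) - δ • rot (D.vec e) =
      D.along e t + ((a + -(δ * c)) • D.vec e + (-(δ * d)) • η) := by
    rw [D.along_eq, D.along_eq, hrot]; module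
  have b1 : |a + δ * c| < ε := (abs_add_le _ _).trans_lt (by linarith)
  have b2 : |a + -(δ * c)| < ε := (abs_add_le _ _).trans_lt (by rw [abs_neg]; linarith)
  have b3 : |-(δ * d)| < ε := by rwa [abs_neg]
  rw [e1, e2]
  rcases lt_or_gt_of_ne hd0 with h3 | h3
  · have h4 : δ * d < 0 := mul_neg_of_pos_of_neg hδ h3
    rw [half_chart_eq hf h b1 h2 ha hb' (by nlinarith), half_chart_eq hf h b2 b3 ha hb (by nlinarith),
      add_comm]
  · have h4 : 0 < δ * d := mul_pos hδ h3
    rw [half_chart_eq hf h b1 h2 ha hb (by nlinarith), half_chart_eq hf h b2 b3 ha hb' (by nlinarith)]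

theorem edgeJump_eventually {f : Plane → ZMod 2} (hf : D.LocConst f) {e : D.Edge} {t : ℝ}
    (h0 : 0 < t) (h1 : t < 1) (hx : D.along e t ∉ D.crossings) :
    ∀ᶠ s in 𝓝 t, edgeJump f e s = edgeJump f e t := by
  have hη := det_rot_ne (D.vec_ne_zero e)
  obtain ⟨ε, hε, h⟩ := exists_half_chart h0 h1 hx hη
  have key : ∀ a, |a| < ε → edgeJump f e (t + a) = edgeJump f e t := by
    intro a ha
    have hb : |ε / 2| < ε := by rw [abs_of_pos (by linarith)]; linarith
    have h00 : |(0 : ℝ)| < ε := by simpa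
    have k1 := edgeJump_eq_corner hf hη hε h ha hb (by positivity)
    have k2 := edgeJump_eq_corner hf hη hε h h00 hb (by positivity)
    rw [add_zero] at k2
    rw [k1, k2, half_chart_eq hf h ha hb h00 hb (by positivity),
      half_chart_eq hf h (b := -(ε / 2)) (b' := -(ε / 2)) ha (by rwa [abs_neg]) h00 (by rwa [abs_neg])
        (by rw [neg_mul_neg]; positivity)]
  filter_upwards [Metric.ball_mem_nhds t hε] with s hs
  have := key (s - t) (by simpa [Real.dist_eq] using hs)
  rwa [add_sub_cancel] at this

theorem edgeJump_chart {f : Plane → ZMod 2} (hf : D.LocConst f) {p q : D.Param} (hx : D.Cross p q)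
    {ε : ℝ} (hc : D.Chart p q ε) {s : ℝ} (hs : |s| < ε) (hs0 : s ≠ 0) {b : ℝ} (hb0 : 0 < b)
    (hb : b < ε) : edgeJump f (D.edgeOf p) (p.2.2 + s) =
      f (D.corner p q s b) + f (D.corner p q s (-b)) := by
  have hb' : |b| < ε := by rwa [abs_of_pos hb0]
  have hmem := hc.param_mem hs
  obtain ⟨ε', hε', h⟩ := exists_half_chart hmem.1 hmem.2 (hc.shift_notMem hs hs0) hx.det_ne
  obtain ⟨δ, h1, h2, h3⟩ := ((hf.eventually_corner hc hs hs0 hb' hb0).and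
    ((eventually_mem_nhdsWithin (a := (0 : ℝ)) (s := Set.Ioi 0)).and
      (nhdsWithin_le_nhds (Metric.ball_mem_nhds (0 : ℝ) hε')))).exists
  replace h2 : 0 < δ := h2
  have h00 : |(0 : ℝ)| < ε' := by simpa
  have k := edgeJump_eq_corner hf hx.det_ne hε' h h00 (by simpa using h3) h2.ne'
  rw [add_zero] at k
  rw [k, ← h1.1, ← h1.2]
  congr 2
  · rw [zero_smul, zero_add]; rfl
  · rw [zero_smul, zero_add, neg_smul, ← sub_eq_add_neg]; rfl

/-- Before the crossing the jump across the strand `p` is the sum over the two corners on that side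
of the strand `q`, after it the sum over the other two. -/
theorem edgeJump_cross {f : Plane → ZMod 2} (hf : D.LocConst f) {p q : D.Param} (hx : D.Cross p q)
    {ε : ℝ} (hc : D.Chart p q ε) {l : ℝ} (h0 : 0 < l) (h1 : l < ε) :
    ∃ a b, (∀ᶠ s in 𝓝[<] (p.2.2 : ℝ), edgeJump f (D.edgeOf p) s = a) ∧
      (∀ᶠ s in 𝓝[>] (p.2.2 : ℝ), edgeJump f (D.edgeOf p) s = b) ∧ a + b = D.cornerSum f p q l := by
  have la : |l| < ε := by rwa [abs_of_pos h0]
  have lb : |-l| < ε := by rwa [abs_neg]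
  have key : ∀ a, |a| < ε → ∀ s : ℝ, |s - (p.2.2 : ℝ)| < ε → 0 < (s - (p.2.2 : ℝ)) * a →
      edgeJump f (D.edgeOf p) s = f (D.corner p q a l) + f (D.corner p q a (-l)) := by
    intro a ha s hs hsa
    have := edgeJump_chart hf hx hc hs (left_ne_zero_of_mul hsa.ne') h0 h1
    rw [add_sub_cancel] at this
    rw [this, hf.corner_eq hc hs la ha la hsa (mul_pos h0 h0),
      hf.corner_eq hc hs lb ha lb hsa (by rw [neg_mul_neg]; exact mul_pos h0 h0)]
  have hball : ∀ᶠ s in 𝓝 (p.2.2 : ℝ), |s - (p.2.2 : ℝ)| < ε := by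
    filter_upwards [Metric.ball_mem_nhds (p.2.2 : ℝ) hc.1] with s hs
    simpa [Real.dist_eq] using hs
  refine ⟨_, _, ?_, ?_, add_comm _ _⟩
  · filter_upwards [nhdsWithin_le_nhds hball, self_mem_nhdsWithin] with s h2 h3
    exact key _ lb s h2 (by nlinarith [show s < (p.2.2 : ℝ) from h3])
  · filter_upwards [nhdsWithin_le_nhds hball, self_mem_nhdsWithin] with s h2 h3
    exact key _ la s h2 (mul_pos (sub_pos.2 h3) h0)

end LinkDiagram

end RegionCrossing

/-! ### Going around a component: invariance under region crossing changes -/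

namespace RegionCrossing

namespace PolygonPair

variable {V : Type} (P : PolygonPair V)

/-- The previous edge of the polygon. -/
def prev (e : P.Edge) : P.Edge := ⟨e.1, e.2 - 1⟩

@[simp] theorem next_prev (e : P.Edge) : P.next (P.prev e) = e :=
  Sigma.ext rfl (heq_of_eq (sub_add_cancel _ _))

@[simp] theorem prev_next (e : P.Edge) : P.prev (P.next e) = e :=
  Sigma.ext rfl (heq_of_eq (add_sub_cancel_right _ _))

end PolygonPair

namespace LinkDiagram

variable {D : LinkDiagram}

/-- A vertex is not a crossing and so has a single parameter, at the start of its outgoing edge. A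
closed edge contains it only as this initial point or as its final point. -/
theorem eq_or_eq_of_src_mem {e e' : D.Edge} (h : D.src (D.next e) ∈ D.edgeSet e') :
    e' = e ∨ e' = D.next e := by
  obtain ⟨r, hr, hr'⟩ := D.exists_param_of_mem_edgeSet h
  have : r = D.param (D.next e) 0 (by simp) := by
    by_contra hne
    refine src_notMem_crossings (D.next e) ?_
    rw [← hr]
    exact Cross.mem ⟨hne, by rw [hr, D.point_param, D.along_zero]⟩
  rcases hr' with h' | ⟨h', -⟩
  · right; rw [← h', this, D.edgeOf_param]
  · left
    rw [this, D.edgeOf_param] at h'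
    rw [← D.prev_next e', ← h', D.prev_next]

theorem edgeJump_transverse {f : Plane → ZMod 2} (hf : D.LocConst f) {e : D.Edge} {t : ℝ}
    (h0 : 0 < t) (h1 : t < 1) (hx : D.along e t ∉ D.crossings) {η : Plane}
    (hη : det (D.vec e) η ≠ 0) : ∀ᶠ b in 𝓝[>] (0 : ℝ),
      edgeJump f e t = f (D.along e t + b • η) + f (D.along e t + (-b) • η) := by
  obtain ⟨ε, hε, h⟩ := exists_half_chart h0 h1 hx hη
  filter_upwards [nhdsWithin_le_nhds (Metric.ball_mem_nhds (0 : ℝ) hε), self_mem_nhdsWithin]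
    with b hb hb0
  have h00 : |(0 : ℝ)| < ε := by simpa
  have := edgeJump_eq_corner hf hη hε h h00 (by simpa using hb) (ne_of_gt hb0)
  simpa using this

theorem eventually_notMem_crossings {z : Plane} (h : z ∉ D.crossings) :
    ∀ᶠ z' in 𝓝 z, z' ∉ D.crossings :=
  finite_crossings.isClosed.isOpen_compl.mem_nhds h

/-- The jumps across the two edges at a vertex agree. -/
theorem exists_edgeJump_vertex {f : Plane → ZMod 2} (hf : D.LocConst f) (e : D.Edge) :
    ∃ c, (∀ᶠ s in 𝓝[>] (0 : ℝ), edgeJump f e (1 - s) = c) ∧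
      ∀ᶠ s in 𝓝[>] (0 : ℝ), edgeJump f (D.next e) s = c := by
  set e' := D.next e with he'
  set v := D.src e' with hv
  set u := D.vec e with hu
  set w := D.vec e' with hw
  have al : ∀ s, D.along e (1 - s) = v + (-s) • u := fun s => by
    rw [hv, he', ← D.along_one, D.along_eq, D.along_eq]; module
  have al' : ∀ s, D.along e' s = v + s • w := fun s => D.along_eq e' s
  have hsupp : ∀ η : Plane, ∃ ε > 0, ∀ s t : ℝ, |s| < ε → |t| < ε →
      v + (s • u + t • η) ∈ D.support →
      (∃ r : ℝ, r ≤ 0 ∧ s • u + t • η = r • u) ∨ ∃ r : ℝ, 0 ≤ r ∧ s • u + t • η = r • w := by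
    intro η
    obtain ⟨ε, hε, H⟩ := eventually_coord _ u η (eventually_mem_edgeSet D.toPolygonPair v)
    refine ⟨ε, hε, fun s t hs ht hmem => ?_⟩
    rw [support_eq_iUnion] at hmem
    obtain ⟨a, ha⟩ := Set.mem_iUnion.1 hmem
    have h2 := eq_or_eq_of_src_mem (H s t hs ht a ha)
    rw [D.edgeSet_eq] at ha
    obtain ⟨r, hr, hr'⟩ := ha
    rcases h2 with rfl | rfl
    · left
      refine ⟨r - 1, by linarith [hr.2], ?_⟩
      have := al (1 - r)
      rw [sub_sub_cancel, neg_sub] at this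
      rw [this, add_right_inj] at hr'
      exact hr'.symm
    · right
      refine ⟨r, hr.1, ?_⟩
      rw [al', add_right_inj] at hr'
      exact hr'.symm
  by_cases hd : det u w = 0
  -- If the edges are parallel, the diagram near the vertex lies on one line, and the same two
  -- half-planes determine the jump on both edges.
  · set η := rot u with hη
    have hdu : det u η ≠ 0 := det_rot_ne (D.vec_ne_zero e)
    obtain ⟨lam, hlam⟩ : ∃ lam : ℝ, w = lam • u := by
      have hc := eq_coord hdu w
      rw [hd, zero_div, zero_smul, add_zero] at hc
      exact ⟨_, hc⟩
    have hlam0 : lam ≠ 0 := by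
      rintro rfl
      exact D.vec_ne_zero e' (by rw [← hw, hlam, zero_smul])
    have hdw : det w η ≠ 0 := by rw [hlam, det_smul_left]; exact mul_ne_zero hlam0 hdu
    obtain ⟨ε, hε, H⟩ := hsupp η
    have H' : ∀ a b : ℝ, |a| < ε → |b| < ε → v + (a • u + b • η) ∈ D.support → b = 0 := by
      intro a b ha hb hmem
      rcases H a b ha hb hmem with ⟨r, -, hr⟩ | ⟨r, -, hr⟩
      · exact (coord_unique hdu (s := a) (t := b) (s' := r) (t' := 0)
          (by rw [zero_smul, add_zero]; exact hr)).2
      · rw [hlam, smul_smul] at hr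
        exact (coord_unique hdu (s := a) (t := b) (s' := r * lam) (t' := 0)
          (by rw [zero_smul, add_zero]; exact hr)).2
    set ε' := min ε (ε / |lam|)
    have hε' : 0 < ε' := lt_min hε (div_pos hε (abs_pos.2 hlam0))
    have H'' : ∀ a b : ℝ, |a| < ε' → |b| < ε' → D.along e' 0 + (a • w + b • η) ∈ D.support → b = 0 := by
      intro a b ha hb hmem
      rw [al', zero_smul, add_zero, hlam, smul_smul] at hmem
      refine H' (a * lam) b ?_ (hb.trans_le (min_le_left _ _)) hmem
      rw [abs_mul]
      exact (lt_div_iff₀ (abs_pos.2 hlam0)).1 (ha.trans_le (min_le_right _ _))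
    have H1 : ∀ a b : ℝ, |a| < ε → |b| < ε → D.along e 1 + (a • u + b • η) ∈ D.support → b = 0 := by
      intro a b ha hb hmem
      refine H' a b ha hb ?_
      have := al 0
      rw [sub_zero, neg_zero, zero_smul, add_zero] at this
      rwa [this] at hmem
    have h00 : |(0 : ℝ)| < ε := by simpa
    set b := ε' / 2
    have hb0 : 0 < b := by positivity
    have hb1 : |b| < ε' := by rw [abs_of_pos hb0]; exact half_lt_self hε'
    have hb2 : |b| < ε := hb1.trans_le (min_le_left _ _)
    have hb3 : |-b| < ε := by rwa [abs_neg]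
    have hbb : 0 < b * b := mul_pos hb0 hb0
    have hbb' : 0 < -b * -b := by rwa [neg_mul_neg]
    refine ⟨f (v + ((0 : ℝ) • u + b • η)) + f (v + ((0 : ℝ) • u + (-b) • η)), ?_, ?_⟩
    · filter_upwards [nhdsWithin_le_nhds (Metric.ball_mem_nhds (0 : ℝ) hε)] with s hs
      have hs' : |-s| < ε := by simpa using hs
      have k := edgeJump_eq_corner hf hdu hε H1 hs' hb2 hb0.ne'
      have hv1 := al 0
      rw [sub_zero, neg_zero, zero_smul, add_zero] at hv1
      rw [← sub_eq_add_neg, hv1] at k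
      rw [k, half_chart_eq hf H' hs' hb2 h00 hb2 hbb, half_chart_eq hf H' hs' hb3 h00 hb3 hbb']
    · filter_upwards [nhdsWithin_le_nhds (Metric.ball_mem_nhds (0 : ℝ) hε')] with s hs
      have hs' : |s| < ε' := by simpa using hs
      have hs2 : |s * lam| < ε := by
        rw [abs_mul]
        exact (lt_div_iff₀ (abs_pos.2 hlam0)).1 (hs'.trans_le (min_le_right _ _))
      have k := edgeJump_eq_corner hf hdw hε' H'' hs' hb1 hb0.ne'
      rw [zero_add, al', zero_smul, add_zero, ← hw, hlam, smul_smul] at k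
      rw [k, half_chart_eq hf H' hs2 hb2 h00 hb2 hbb, half_chart_eq hf H' hs2 hb3 h00 hb3 hbb']
  · obtain ⟨ε, hε, H⟩ := hsupp w
    have H' : ∀ s t : ℝ, |s| < ε → |t| < ε → v + (s • u + t • w) ∈ D.support →
        (t = 0 ∧ s ≤ 0) ∨ (s = 0 ∧ 0 ≤ t) := by
      intro s t hs ht hmem
      rcases H s t hs ht hmem with ⟨r, hr0, hr⟩ | ⟨r, hr0, hr⟩
      · have := coord_unique hd (s' := r) (t' := 0) (by rw [hr, zero_smul, add_zero])
        exact Or.inl ⟨this.2, this.1 ▸ hr0⟩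
      · have := coord_unique hd (s' := 0) (t' := r) (by rw [hr, zero_smul, zero_add])
        exact Or.inr ⟨this.1, this.2 ▸ hr0⟩
    have absI : ∀ {x : ℝ}, x ∈ Set.Ioo (-ε) ε → |x| < ε := fun hx => abs_lt.2 hx
    have absN : ∀ {x : ℝ}, x ∈ Set.Ioo (-ε) 0 → |x| < ε := fun hx => abs_lt.2 ⟨hx.1, hx.2.trans hε⟩
    have absP : ∀ {x : ℝ}, x ∈ Set.Ioo 0 ε → |x| < ε := fun hx =>
      abs_lt.2 ⟨(neg_lt_zero.2 hε).trans hx.1, hx.2⟩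
    -- In coordinates along `u` and `w` the edges occupy `s ≤ 0`, `t = 0` and `s = 0`, `0 ≤ t`. They
    -- bound the quadrant `s < 0 < t` and a reflex sector, which is the union of the overlapping
    -- convex pieces `t < 0` and `0 < s`. Both jumps compare the quadrant with the sector.
    have quad : ∀ {s t s' t' : ℝ}, s ∈ Set.Ioo (-ε) 0 → t ∈ Set.Ioo 0 ε → s' ∈ Set.Ioo (-ε) 0 →
        t' ∈ Set.Ioo 0 ε → f (v + (s • u + t • w)) = f (v + (s' • u + t' • w)) := by
      intro s t s' t' h1 h2 h3 h4
      refine hf.eq_of_convex v u w ((convex_Ioo (-ε) 0).prod (convex_Ioo 0 ε)) ?_ ⟨h1, h2⟩ ⟨h3, h4⟩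
      rintro a b ⟨ha, hb⟩ hmem
      rcases H' a b (absN ha) (absP hb) hmem with h | h
      · exact hb.1.ne' h.1
      · exact ha.2.ne h.1
    have lower : ∀ {s t s' t' : ℝ}, s ∈ Set.Ioo (-ε) ε → t ∈ Set.Ioo (-ε) 0 → s' ∈ Set.Ioo (-ε) ε →
        t' ∈ Set.Ioo (-ε) 0 → f (v + (s • u + t • w)) = f (v + (s' • u + t' • w)) := by
      intro s t s' t' h1 h2 h3 h4
      refine hf.eq_of_convex v u w ((convex_Ioo (-ε) ε).prod (convex_Ioo (-ε) 0)) ?_ ⟨h1, h2⟩ ⟨h3, h4⟩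
      rintro a b ⟨ha, hb⟩ hmem
      rcases H' a b (absI ha) (absN hb) hmem with h | h
      · exact hb.2.ne h.1
      · exact hb.2.not_ge h.2
    have right : ∀ {s t s' t' : ℝ}, s ∈ Set.Ioo 0 ε → t ∈ Set.Ioo (-ε) ε → s' ∈ Set.Ioo 0 ε →
        t' ∈ Set.Ioo (-ε) ε → f (v + (s • u + t • w)) = f (v + (s' • u + t' • w)) := by
      intro s t s' t' h1 h2 h3 h4
      refine hf.eq_of_convex v u w ((convex_Ioo 0 ε).prod (convex_Ioo (-ε) ε)) ?_ ⟨h1, h2⟩ ⟨h3, h4⟩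
      rintro a b ⟨ha, hb⟩ hmem
      rcases H' a b (absP ha) (absI hb) hmem with h | h
      · exact ha.1.not_ge h.2
      · exact ha.1.ne' h.1
    have hv' : v ∉ D.crossings := src_notMem_crossings e'
    have n1 : ∀ᶠ s in 𝓝[>] (0 : ℝ), D.along e (1 - s) ∉ D.crossings := by
      have hc : Continuous fun s : ℝ => D.along e (1 - s) := by simp only [al]; fun_prop
      have h0 : D.along e (1 - 0) ∉ D.crossings := by rw [al]; simpa using hv'
      exact nhdsWithin_le_nhds (hc.continuousAt.eventually (eventually_notMem_crossings h0))
    have n2 : ∀ᶠ s in 𝓝[>] (0 : ℝ), D.along e' s ∉ D.crossings := by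
      have hc : Continuous fun s : ℝ => D.along e' s := by simp only [al']; fun_prop
      have h0 : D.along e' 0 ∉ D.crossings := by rw [al']; simpa using hv'
      exact nhdsWithin_le_nhds (hc.continuousAt.eventually (eventually_notMem_crossings h0))
    set l := ε / 2
    have hl : l ∈ Set.Ioo 0 ε := ⟨half_pos hε, half_lt_self hε⟩
    have hl' : -l ∈ Set.Ioo (-ε) 0 := ⟨neg_lt_neg hl.2, neg_lt_zero.2 hl.1⟩
    have hlI : l ∈ Set.Ioo (-ε) ε := ⟨(neg_lt_zero.2 hε).trans hl.1, hl.2⟩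
    have hlI' : -l ∈ Set.Ioo (-ε) ε := ⟨hl'.1, hl'.2.trans hε⟩
    have small : ∀ᶠ s in 𝓝[>] (0 : ℝ), s < ε ∧ s < 1 :=
      nhdsWithin_le_nhds ((eventually_lt_nhds hε).and (eventually_lt_nhds one_pos))
    have dwu : det w u ≠ 0 := by rw [det_comm]; exact neg_ne_zero.2 hd
    refine ⟨f (v + ((-l) • u + l • w)) + f (v + (l • u + l • w)), ?_, ?_⟩
    · filter_upwards [n1, small, self_mem_nhdsWithin] with s h1 h2 h3
      replace h3 : 0 < s := h3
      have ht := edgeJump_transverse hf (by linarith : 0 < 1 - s) (by linarith) h1 (η := w) hd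
      obtain ⟨b, k, ⟨hb1, -⟩, hb0⟩ := (ht.and (small.and self_mem_nhdsWithin)).exists
      replace hb0 : 0 < b := hb0
      rw [al, add_assoc, add_assoc] at k
      have hs : -s ∈ Set.Ioo (-ε) 0 := ⟨neg_lt_neg h2.1, neg_lt_zero.2 h3⟩
      have hb : -b ∈ Set.Ioo (-ε) 0 := ⟨neg_lt_neg hb1, neg_lt_zero.2 hb0⟩
      rw [k, quad hs ⟨hb0, hb1⟩ hl' hl, lower ⟨hs.1, hs.2.trans hε⟩ hb hlI hl', right hl hlI' hl hlI]
    · filter_upwards [n2, small, self_mem_nhdsWithin] with s h1 h2 h3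
      replace h3 : 0 < s := h3
      have ht := edgeJump_transverse hf h3 h2.2 h1 (η := u) dwu
      obtain ⟨b, k, ⟨hb1, -⟩, hb0⟩ := (ht.and (small.and self_mem_nhdsWithin)).exists
      replace hb0 : 0 < b := hb0
      rw [al', add_assoc, add_assoc, add_comm (s • w), add_comm (s • w)] at k
      have hb : -b ∈ Set.Ioo (-ε) 0 := ⟨neg_lt_neg hb1, neg_lt_zero.2 hb0⟩
      rw [k, quad hb ⟨h3, h2.1⟩ hl' hl,
        right ⟨hb0, hb1⟩ ⟨(neg_lt_zero.2 hε).trans h3, h2.1⟩ hl hlI, add_comm]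

theorem tendsto_one_sub : Tendsto (fun s : ℝ => 1 - s) (𝓝[<] 1) (𝓝[>] 0) := by
  refine tendsto_nhdsWithin_iff.2 ⟨?_, ?_⟩
  · have : Continuous fun s : ℝ => 1 - s := by fun_prop
    simpa using (this.tendsto 1).mono_left nhdsWithin_le_nhds
  · filter_upwards [self_mem_nhdsWithin] with s hs
    exact sub_pos.2 (Set.mem_Iio.1 hs)

theorem edgeJump_strand {f : Plane → ZMod 2} (hf : D.LocConst f) (x : D.crossings) {p : D.Param}
    (hp : D.point p = x) : ∃ a b, (∀ᶠ s in 𝓝[<] (p.2.2 : ℝ), edgeJump f (D.edgeOf p) s = a) ∧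
      (∀ᶠ s in 𝓝[>] (p.2.2 : ℝ), edgeJump f (D.edgeOf p) s = b) ∧ a + b = cornerSums f x := by
  have hc := cross_strand x
  rcases hc.eq_or_eq (hp.trans (point_strand x).symm) with rfl | rfl
  · exact edgeJump_cross hf hc (chart_strand x) (gap_pos x) (gap_lt x)
  · have := edgeJump_cross hf hc.symm ((chart_strand x).symm hc.2) (gap_pos x) (gap_lt x)
    have e : cornerSums f x = D.cornerSum f (strand' x) (strand x) (gap x) := by
      simp only [cornerSums, cornerSum, corner_comm hc.2]
      ring
    rwa [e]

open Classical in
/-- The corner sums of a locally constant function over all crossings of both components add up to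
zero, as one sees by following the jump across the first component. -/
theorem sum_mixed_cornerSums [Fintype D.crossings] {f : Plane → ZMod 2} (hf : D.LocConst f) :
    ∑ x : D.crossings with D.Mixed x.1, cornerSums f x = 0 := by
  have hTf : ∀ e : D.Edge, {t | t ∈ Set.Ico (0 : ℝ) 1 ∧ D.along e t ∈ D.crossings}.Finite := fun e =>
    (finite_crossings.preimage (D.along_injective e).injOn).subset fun t ht => ht.2
  let T : D.Edge → Finset ℝ := fun e => (hTf e).toFinset
  have memT : ∀ e t, t ∈ T e ↔ t ∈ Set.Ico (0 : ℝ) 1 ∧ D.along e t ∈ D.crossings := fun e t => by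
    simp [T]
  let M : Plane → ZMod 2 := D.extend (cornerSums f)
  choose c hc hc' using fun e => exists_edgeJump_vertex hf e
  -- The jump at the start of `e` is that at the end of the previous edge; along `e` it changes by
  -- the corner sums at the crossings met.
  have total : ∀ e, c (D.prev e) + c e = ∑ t ∈ T e, M (D.along e t) := by
    intro e
    refine total_change (h := edgeJump f e) (m := fun t => M (D.along e t)) ?_ ?_ ?_ ?_
    · intro t ht
      obtain ⟨h1, h2⟩ := (memT e t).1 ht
      refine ⟨lt_of_le_of_ne h1.1 ?_, h1.2⟩
      rintro rfl
      rw [D.along_zero] at h2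
      exact src_notMem_crossings e h2
    · intro t ht
      by_cases htT : t ∈ T e
      · have hx := ((memT e t).1 htT).2
        obtain ⟨a, b, h1, h2, h3⟩ := edgeJump_strand hf ⟨_, hx⟩ (p := D.param e t ⟨ht.1.le, ht.2⟩) rfl
        refine ⟨a, b, h1, h2, ?_⟩
        rw [if_pos htT, h3]
        exact (extend_apply (cornerSums f) ⟨_, hx⟩).symm
      · have hx : D.along e t ∉ D.crossings := fun h => htT ((memT e t).2 ⟨⟨ht.1.le, ht.2⟩, h⟩)
        have := edgeJump_eventually hf ht.1 ht.2 hx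
        refine ⟨_, _, nhdsWithin_le_nhds this, nhdsWithin_le_nhds this, ?_⟩
        rw [if_neg htT, CharTwo.add_self_eq_zero]
    · have := hc' (D.prev e)
      rwa [D.next_prev] at this
    · filter_upwards [tendsto_one_sub.eventually (hc e)] with s hs
      rwa [sub_sub_cancel] at hs
  have hP : {p : D.Param | p.1 = 0 ∧ D.point p ∈ D.crossings}.Finite := by
    refine (Set.Finite.preimage (f := fun p : D.Param => (D.edgeOf p, (p.2.2 : ℝ))) ?_
      ((Finset.univ.sigma T).finite_toSet.image fun a => (a.1, a.2))).subset ?_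
    · intro p _ q _ h
      simp only [Prod.mk.injEq] at h
      exact D.param_ext h.1 h.2
    · intro p hp
      exact ⟨⟨D.edgeOf p, p.2.2⟩, Finset.mem_coe.2 (Finset.mem_sigma.2 ⟨Finset.mem_univ _,
        (memT _ _).2 ⟨p.2.2.2, hp.2⟩⟩), rfl⟩
  have sum1 : ∑ e : D.Edge with e.1 = 0, ∑ t ∈ T e, M (D.along e t) =
      ∑ p ∈ hP.toFinset, M (D.point p) := by
    rw [Finset.sum_sigma']
    refine Finset.sum_bij' (fun a ha => D.param a.1 a.2 ((memT _ _).1 (Finset.mem_sigma.1 ha).2).1)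
      (fun p _ => ⟨D.edgeOf p, p.2.2⟩) ?_ ?_ ?_ ?_ ?_
    · intro a ha
      have h1 := Finset.mem_sigma.1 ha
      exact (Set.Finite.mem_toFinset hP).2 ⟨(Finset.mem_filter.1 h1.1).2, ((memT _ _).1 h1.2).2⟩
    · intro p hp
      have := (Set.Finite.mem_toFinset hP).1 hp
      exact Finset.mem_sigma.2 ⟨Finset.mem_filter.2 ⟨Finset.mem_univ _, this.1⟩,
        (memT _ _).2 ⟨p.2.2.2, this.2⟩⟩
    · intro a _; rfl
    · intro p _; rfl
    · intro a _; rfl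
  -- Each vertex value occurs once as a start and once as an end, as component `0` is closed.
  have sum2 : ∑ e : D.Edge with e.1 = 0, ∑ t ∈ T e, M (D.along e t) = 0 := by
    simp only [← total, Finset.sum_add_distrib]
    have : ∑ e : D.Edge with e.1 = 0, c (D.prev e) = ∑ e : D.Edge with e.1 = 0, c e := by
      refine Finset.sum_bij' (fun e _ => D.prev e) (fun e _ => D.next e) ?_ ?_ ?_ ?_ ?_
      · intro e he; simpa [PolygonPair.prev] using he
      · intro e he; simpa [PolygonPair.next] using he
      · intro e _; simp
      · intro e _; simp
      · intro e _; rfl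
    rw [this, CharTwo.add_self_eq_zero]
  rw [sum1] at sum2
  -- The passages of component `0` through a crossing: one if it is mixed, two or none otherwise.
  -- Only the mixed crossings survive modulo two.
  let F : D.crossings → Finset D.Param := fun x =>
    ({strand x, strand' x} : Finset D.Param).filter fun p => p.1 = 0
  have hF : ∀ x p, p ∈ F x → D.point p = x := by
    intro x p hp
    simp only [F, Finset.mem_filter, Finset.mem_insert, Finset.mem_singleton] at hp
    rcases hp.1 with rfl | rfl
    · exact point_strand x
    · rw [← (cross_strand x).2]; exact point_strand x
  have hPF : hP.toFinset = Finset.univ.biUnion F := by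
    ext p
    simp only [Set.Finite.mem_toFinset, Set.mem_ofPred_eq, Finset.mem_biUnion, Finset.mem_univ,
      true_and]
    constructor
    · rintro ⟨h0, h1⟩
      refine ⟨⟨_, h1⟩, Finset.mem_filter.2 ⟨?_, h0⟩⟩
      have := (cross_strand (⟨_, h1⟩ : D.crossings)).eq_or_eq (r := p)
        (point_strand (⟨_, h1⟩ : D.crossings)).symm
      simpa using this
    · rintro ⟨x, hx⟩
      exact ⟨(Finset.mem_filter.1 hx).2, by rw [hF x p hx]; exact x.2⟩
  rw [← sum2, hPF, Finset.sum_biUnion, Finset.sum_filter]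
  · refine Finset.sum_congr rfl fun x _ => ?_
    have h1 : ∑ p ∈ F x, M (D.point p) = ∑ p ∈ F x, cornerSums f x :=
      Finset.sum_congr rfl fun p hp => by rw [hF x p hp]; exact extend_apply _ _
    rw [h1, Finset.sum_filter, Finset.sum_pair (cross_strand x).1, mixed_iff_strand]
    generalize (strand x).1 = a
    generalize (strand' x).1 = b
    have h2 : (a = 0 ∨ a = 1) ∧ (b = 0 ∨ b = 1) := by omega
    rcases h2 with ⟨rfl | rfl, rfl | rfl⟩ <;> simp [CharTwo.add_self_eq_zero]
  · intro x _ y _ hxy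
    refine Finset.disjoint_left.2 fun p hp hq => hxy (Subtype.ext ?_)
    rw [← hF x p hp, hF y p hq]

open Classical in
/-- The number of crossings of both components on the boundary of a region is even. -/
theorem sum_mixed_chi [Fintype D.crossings] {R : Set Plane} (hR : R ∈ D.regions) :
    ∑ x : D.crossings with D.Mixed x.1, D.chi R x = 0 := by
  let f : Plane → ZMod 2 := fun z => if z ∈ R then 1 else 0
  have hfR : ∀ z ∈ D.supportᶜ, f z = if R = D.region z then 1 else 0 := by
    intro z hz
    have : z ∈ R ↔ R = D.region z :=
      ⟨fun h => eq_region_of_mem hR h, fun h => h ▸ mem_region hz⟩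
    simp only [f, this]
  have hf : D.LocConst f := by
    intro z hz
    filter_upwards [(isOpen_region z).mem_nhds (mem_region hz)] with z' hz'
    rw [hfR z hz, hfR z' (region_subset z hz'), region_eq_of_mem hz']
  rw [← sum_mixed_cornerSums hf]
  refine Finset.sum_congr rfl fun x hx => ?_
  have hm : (strand x).1 ≠ (strand' x).1 := (mixed_iff_strand x).1 (Finset.mem_filter.1 hx).2
  have hc := cross_strand x
  have hch := chart_strand x
  have g0 := (gap_pos x).ne'
  have gn := neg_ne_zero.2 g0
  have ga := abs_gap_lt x
  have gb := abs_neg_gap_lt x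
  have n1 := region_corner_ne hc hch ga g0 ga g0
  have n2 := region_corner_ne hc hch gb gn ga g0
  have n3 := region_corner_ne hc.symm (hch.symm hc.2) ga g0 ga g0
  have n4 := region_corner_ne hc.symm (hch.symm hc.2) gb gn ga g0
  simp only [← corner_comm hc.2] at n3 n4
  -- All four corners of a mixed crossing lie in different regions, so the corner sum of the
  -- indicator of `R` is one exactly if `R` is at the crossing.
  have n5 := region_corner_ne_opposite hc hm hch ga g0 ga g0
  have n6 := region_corner_ne_opposite hc hm hch ga g0 gb gn
  rw [neg_neg] at n6
  have hfr := mem_frontier_iff hc hch (gap_pos x) (gap_lt x) hR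
  rw [point_strand] at hfr
  simp only [chi, x.2, true_and, hfr, cornerSums, cornerSum]
  change _ = f (nearby x _ _) + f (nearby x _ _) + (f (nearby x _ _) + f (nearby x _ _))
  rw [hfR _ (nearby_notMem x ga ga g0 g0), hfR _ (nearby_notMem x ga gb g0 gn),
    hfR _ (nearby_notMem x gb ga gn g0), hfR _ (nearby_notMem x gb gb gn gn)]
  simp only [nearby]
  by_cases h1 : R = D.region (D.corner (strand x) (strand' x) (gap x) (gap x))
  · simp [h1, n1, n3, n5]
  by_cases h2 : R = D.region (D.corner (strand x) (strand' x) (gap x) (-gap x))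
  · simp [h2, n1.symm, n4, n6]
  by_cases h3 : R = D.region (D.corner (strand x) (strand' x) (-gap x) (gap x))
  · simp [h3, n3.symm, n6.symm, n2]
  by_cases h4 : R = D.region (D.corner (strand x) (strand' x) (-gap x) (-gap x))
  · simp [h4, n2.symm, n4.symm, n5.symm]
  · simp [h1, h2, h3, h4]

open Classical in
/-- Region crossing changes affect an even number of crossings of both components. -/
theorem sum_mixed_of_mem [Fintype D.crossings] {v : Plane → ZMod 2} (hv : v ∈ D.rccSpan) :
    ∑ x : D.crossings with D.Mixed x.1, v x = 0 := by
  induction hv using Submodule.span_induction with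
  | mem v hv =>
    obtain ⟨R, hR, rfl⟩ := hv
    exact sum_mixed_chi hR
  | zero => simp
  | add v w _ _ hv hw => simp only [Pi.add_apply, Finset.sum_add_distrib, hv, hw, add_zero]
  | smul a v _ hv => simp only [Pi.smul_apply, smul_eq_mul, ← Finset.mul_sum, hv, mul_zero]

end LinkDiagram

end RegionCrossing

/-! ### The linking number modulo two -/

namespace RegionCrossing

namespace LinkDiagram

variable {D : LinkDiagram}

/-- At the crossing `x` component `0` passes over component `1`. -/
def Over (D : LinkDiagram) (x : Plane) : Prop :=
  ∃ a b, D.point ⟨0, a⟩ = x ∧ D.point ⟨1, b⟩ = x ∧ (⟨0, a⟩ : D.Param) ∈ D.upper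

theorem cross_of_point_eq {a b} (h : D.point ⟨0, a⟩ = D.point ⟨1, b⟩) : D.Cross ⟨0, a⟩ ⟨1, b⟩ :=
  ⟨fun h' => absurd (congrArg Sigma.fst h') (by simp), h⟩

theorem Over.mem {x : Plane} (h : D.Over x) : x ∈ D.crossings := by
  obtain ⟨a, b, h1, h2, -⟩ := h
  exact h1 ▸ (cross_of_point_eq (h1.trans h2.symm)).mem

theorem Over.mixed {x : Plane} (h : D.Over x) : D.Mixed x := by
  obtain ⟨a, b, h1, h2, -⟩ := h
  exact h1 ▸ (cross_of_point_eq (h1.trans h2.symm)).mixed_iff.2 (by simp)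

theorem exists_of_mixed {x : Plane} (hx : x ∈ D.crossings) (h : D.Mixed x) :
    ∃ a b, D.point ⟨0, a⟩ = x ∧ D.point ⟨1, b⟩ = x := by
  obtain ⟨⟨k, a⟩, ⟨l, b⟩, hc, rfl⟩ := mem_crossings.1 hx
  have h1 : k ≠ l := hc.mixed_iff.1 h
  have h2 : (k = 0 ∧ l = 1) ∨ (k = 1 ∧ l = 0) := by omega
  rcases h2 with ⟨rfl, rfl⟩ | ⟨rfl, rfl⟩
  · exact ⟨a, b, rfl, hc.2.symm⟩
  · exact ⟨b, a, hc.2.symm, rfl⟩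

theorem unique_of_point_eq {a a' b b'} {x : Plane} (h : D.point ⟨0, a⟩ = x) (h' : D.point ⟨1, b⟩ = x)
    (k : D.point ⟨0, a'⟩ = x) (k' : D.point ⟨1, b'⟩ = x) : a = a' ∧ b = b' := by
  have hc := cross_of_point_eq (h.trans h'.symm)
  constructor
  · rcases hc.eq_or_eq (k.trans h.symm) with h1 | h1
    · exact (eq_of_heq (Sigma.mk.inj_iff.1 h1).2).symm
    · exact absurd (congrArg Sigma.fst h1) (by simp)
  · rcases hc.eq_or_eq (k'.trans h.symm) with h1 | h1
    · exact absurd (congrArg Sigma.fst h1) (by simp)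
    · exact (eq_of_heq (Sigma.mk.inj_iff.1 h1).2).symm

theorem over_iff {a b} {x : Plane} (h : D.point ⟨0, a⟩ = x) (h' : D.point ⟨1, b⟩ = x) :
    D.Over x ↔ (⟨0, a⟩ : D.Param) ∈ D.upper := by
  constructor
  · rintro ⟨a', b', k, k', hu⟩
    rwa [(unique_of_point_eq h h' k k').1]
  · exact fun hu => ⟨a, b, h, h', hu⟩

/-- Two edges of different components cross at most once. -/
theorem params_unique {i : ZMod (D.comp 0).n} {j : ZMod (D.comp 1).n} {s t s' t' : Set.Ico (0 : ℝ) 1}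
    (h : D.point ⟨0, i, s⟩ = D.point ⟨1, j, t⟩) (h' : D.point ⟨0, i, s'⟩ = D.point ⟨1, j, t'⟩) :
    s = s' ∧ t = t' := by
  have hd := (cross_of_point_eq h).det_ne
  rw [PolygonPair.point_eq_along, PolygonPair.point_eq_along, PolygonPair.along_eq,
    PolygonPair.along_eq] at h h'
  dsimp only [PolygonPair.edgeOf] at h h' hd
  have := coord_unique hd (s := s) (t := -t) (s' := s') (t' := -t')
    (by linear_combination (norm := module) h - h')
  exact ⟨Subtype.ext this.1, Subtype.ext (neg_injective this.2)⟩

open Classical in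
/-- The parity of the number of crossings at which component `0` is above component `1`. -/
noncomputable def overParity (D : LinkDiagram) : ZMod 2 := ({x | D.Over x}.ncard : ZMod 2)

theorem finite_over : {x | D.Over x}.Finite := finite_crossings.subset fun _ h => Over.mem h

open Classical in
theorem overParity_eq_sum [Fintype D.crossings] :
    D.overParity = ∑ x : D.crossings with D.Mixed x.1, if D.Over x then 1 else 0 := by
  rw [Finset.sum_ite, Finset.sum_const_zero, add_zero, Finset.sum_const, nsmul_one, overParity,
    Set.ncard_eq_toFinset_card _ finite_over]
  congr 1
  refine (Finset.card_bij (fun x _ => x.1) ?_ ?_ ?_).symm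
  · intro x hx
    simpa using (Finset.mem_filter.1 hx).2
  · exact fun x _ y _ h => Subtype.ext h
  · intro x hx
    have hx' : D.Over x := by simpa using hx
    exact ⟨⟨x, hx'.mem⟩, by simp [hx', hx'.mixed], rfl⟩

theorem sign_det_cast {r : ℝ} (h : r ≠ 0) : (((SignType.sign r : SignType) : ℤ) : ZMod 2) = 1 := by
  rcases h.lt_or_gt with h | h
  · rw [sign_neg h]; rfl
  · rw [sign_pos h]; rfl

open Classical in
-- Both signs are `1` modulo two. What remains is a count of pairs of edges, which corresponds to a
-- count of crossings because two edges cross at most once and a mixed crossing determines its two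
-- edges.
theorem linkingNumber_cast : ((D.linkingNumber : ℤ) : ZMod 2) = D.overParity := by
  have h1 : ((D.linkingNumber : ℤ) : ZMod 2) =
      ∑ e : ZMod (D.comp 0).n × ZMod (D.comp 1).n,
        if ∃ s t : Set.Ico (0 : ℝ) 1, D.point ⟨0, e.1, s⟩ = D.point ⟨1, e.2, t⟩ ∧
          (⟨0, e.1, s⟩ : D.Param) ∈ D.upper then (1 : ZMod 2) else 0 := by
    rw [Fintype.sum_prod_type, linkingNumber, Int.cast_sum]
    refine Finset.sum_congr rfl fun i _ => ?_
    rw [Int.cast_sum]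
    refine Finset.sum_congr rfl fun j _ => ?_
    split_ifs with h
    · obtain ⟨s, t, h, -⟩ := h
      exact sign_det_cast (cross_of_point_eq h).det_ne
    · rfl
  rw [h1, Finset.sum_boole, overParity, Set.ncard_eq_toFinset_card _ finite_over]
  congr 1
  have key : ∀ e : ZMod (D.comp 0).n × ZMod (D.comp 1).n,
      (∃ s t : Set.Ico (0 : ℝ) 1, D.point ⟨0, e.1, s⟩ = D.point ⟨1, e.2, t⟩ ∧
        (⟨0, e.1, s⟩ : D.Param) ∈ D.upper) →
      ∃ x, D.Over x ∧ ∃ s t, D.point ⟨0, e.1, s⟩ = x ∧ D.point ⟨1, e.2, t⟩ = x := by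
    rintro e ⟨s, t, h, hu⟩
    exact ⟨_, ⟨_, _, rfl, h.symm, hu⟩, s, t, rfl, h.symm⟩
  choose! f hf using key
  refine Finset.card_bij (fun e _ => f e) ?_ ?_ ?_
  · intro e he
    simpa using (hf e (Finset.mem_filter.1 he).2).1
  · intro e he e' he' hee
    obtain ⟨-, s, t, h1, h2⟩ := hf e (Finset.mem_filter.1 he).2
    obtain ⟨-, s', t', h1', h2'⟩ := hf e' (Finset.mem_filter.1 he').2
    have := unique_of_point_eq h1 h2 (h1'.trans hee.symm) (h2'.trans hee.symm)
    exact Prod.ext (Prod.ext_iff.1 this.1).1 (Prod.ext_iff.1 this.2).1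
  · intro x hx
    have hx' : D.Over x := by simpa using hx
    obtain ⟨⟨i, s⟩, ⟨j, t⟩, h1, h2, hu⟩ := hx'
    have he : ∃ s t : Set.Ico (0 : ℝ) 1, D.point ⟨0, i, s⟩ = D.point ⟨1, j, t⟩ ∧
        (⟨0, i, s⟩ : D.Param) ∈ D.upper := ⟨s, t, h1.trans h2.symm, hu⟩
    obtain ⟨-, s', t', h1', h2'⟩ := hf (i, j) he
    refine ⟨(i, j), Finset.mem_filter.2 ⟨Finset.mem_univ _, he⟩, ?_⟩
    rw [← h1', ← h1, (params_unique (h1.trans h2.symm) (h1'.trans h2'.symm)).1]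

theorem even_linkingNumber_iff : Even D.linkingNumber ↔ D.overParity = 0 := by
  rw [← linkingNumber_cast, ZMod.intCast_eq_zero_iff_even]

theorem over_crossingChange (S : Set Plane) {x : Plane} (hx : x ∈ D.crossings) (hm : D.Mixed x) :
    (D.crossingChange S).Over x ↔ (D.Over x ↔ x ∉ S) := by
  obtain ⟨a, b, h1, h2⟩ := exists_of_mixed hx hm
  rw [over_iff h1 h2, over_iff (D := D.crossingChange S) h1 h2]
  have : (⟨0, a⟩ : D.Param) ∈ (D.crossingChange S).upper ↔
    (D.point ⟨0, a⟩ ∈ D.crossings ∧ ((⟨0, a⟩ : D.Param) ∈ D.upper ↔ D.point ⟨0, a⟩ ∉ S)) := Iff.rfl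
  rw [h1] at this
  exact this.trans (by simp [hx])

open Classical in
theorem overParity_crossingChange [inst : Fintype D.crossings] (v : Plane → ZMod 2) :
    (D.crossingChange (supp v)).overParity =
      D.overParity + ∑ x : D.crossings with D.Mixed x.1, v x := by
  have h : (D.crossingChange (supp v)).overParity =
      ∑ x : D.crossings with D.Mixed x.1, if (D.crossingChange (supp v)).Over x then 1 else 0 :=
    @overParity_eq_sum (D.crossingChange (supp v)) inst
  rw [h, overParity_eq_sum, ← Finset.sum_add_distrib]
  refine Finset.sum_congr rfl fun x hx => ?_
  rw [over_crossingChange _ x.2 (Finset.mem_filter.1 hx).2]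
  rcases zmod_two_eq_zero_or_one (v x) with h | h <;> by_cases h' : D.Over x <;>
    simp [supp, h, h', CharTwo.add_self_eq_zero]

theorem overParity_eq_of_reflTransGen {D' : LinkDiagram}
    (h : Relation.ReflTransGen RegionCrossingChange D D') : D'.overParity = D.overParity := by
  classical
  obtain ⟨v, hv, rfl⟩ := exists_mem_of_reflTransGen h
  have : Fintype D.crossings := finite_crossings.fintype
  rw [overParity_crossingChange, sum_mixed_of_mem hv, add_zero]

end LinkDiagram

end RegionCrossing

/-! ### Towers: trivial links with increasing heights -/

namespace RegionCrossing

/-- Two closed polygons with at least three vertices each, the second one above the first one, each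
with increasing heights except for its last edge, which is seen from the initial vertex in a
direction not in the cones over the other edges. -/
structure Towers where
  n : Fin 2 → ℕ
  Q : Fin 2 → ℕ → Space
  three_le : ∀ k, 3 ≤ n k
  height_lt : ∀ k i, i + 1 < n k → (Q k i).2 < (Q k (i + 1)).2
  closing : ∀ k i, i + 2 < n k → ∀ s α β : ℝ, 0 < s → 0 ≤ α → 0 ≤ β →
    s • (Q k (n k - 1) - Q k 0) ≠ α • (Q k i - Q k 0) + β • (Q k (i + 1) - Q k 0)
  separated : (Q 0 (n 0 - 1)).2 < (Q 1 0).2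

/-- The closed polygon whose vertices are the first `n` terms of a sequence. -/
def sequencePolygon (n : ℕ) (h : 3 ≤ n) (Q : ℕ → Space) : ClosedPolygon Space :=
  ⟨n, ⟨by omega⟩, fun i => Q i.val⟩

theorem sequencePolygon_congr {n n' : ℕ} {h : 3 ≤ n} {h' : 3 ≤ n'} {Q Q' : ℕ → Space} (hn : n = n')
    (hQ : ∀ i, Q i = Q' i) : sequencePolygon n h Q = sequencePolygon n' h' Q' := by
  subst hn
  rw [funext hQ]

theorem zmod_val_succ {n : ℕ} [NeZero n] (i : ZMod n) :
    (i.val + 1 < n ∧ (i + 1).val = i.val + 1) ∨ (i.val + 1 = n ∧ (i + 1).val = 0) := by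
  have h1 : (i + 1).val = (i.val + 1) % n := by
    rw [ZMod.val_add, ZMod.val_one_eq_one_mod, Nat.add_mod_mod]
  have h2 := ZMod.val_lt i
  rcases Nat.lt_or_ge (i.val + 1) n with h | h
  · exact Or.inl ⟨h, by rw [h1, Nat.mod_eq_of_lt h]⟩
  · have : i.val + 1 = n := by omega
    exact Or.inr ⟨this, by rw [h1, this, Nat.mod_self]⟩

theorem exists_of_mem_triangle {V : Type*} [AddCommGroup V] [Module ℝ V] {a b c x : V}
    (h : x ∈ convexHull ℝ {a, c, b}) :
    ∃ β γ : ℝ, 0 ≤ β ∧ 0 ≤ γ ∧ β + γ ≤ 1 ∧ x = a + β • (c - a) + γ • (b - a) := by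
  rw [convexHull_insert (by simp), convexHull_pair] at h
  obtain ⟨_, rfl, y, ⟨r, s, hr, hs, hrs, rfl⟩, ⟨u, v, hu, hv, huv, rfl⟩⟩ := mem_convexJoin.1 h
  refine ⟨v * r, v * s, mul_nonneg hv hr, mul_nonneg hv hs, by rw [← mul_add, hrs]; linarith, ?_⟩
  obtain rfl : u = 1 - v := by linarith
  obtain rfl : r = 1 - s := by linarith
  module

namespace Towers

variable (T : Towers)

theorem height_mono (k : Fin 2) {i j : ℕ} (hij : i ≤ j) (hj : j < T.n k) :
    (T.Q k i).2 ≤ (T.Q k j).2 := by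
  induction j, hij using Nat.le_induction with
  | base => exact le_rfl
  | succ j _ ih => exact (ih (by omega)).trans (T.height_lt k j hj).le

theorem height_strict (k : Fin 2) {i j : ℕ} (hij : i < j) (hj : j < T.n k) :
    (T.Q k i).2 < (T.Q k j).2 :=
  (T.height_lt k i (by omega)).trans_le (T.height_mono k hij hj)

/-- The pair of polygons. -/
def pair : PolygonPair Space := ⟨fun k => sequencePolygon (T.n k) (T.three_le k) (T.Q k)⟩

theorem point_cases (p : T.pair.Param) :
    (p.2.1.val + 1 < T.n p.1 ∧ T.pair.point p =
      T.Q p.1 p.2.1.val + (p.2.2 : ℝ) • (T.Q p.1 (p.2.1.val + 1) - T.Q p.1 p.2.1.val)) ∨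
    (p.2.1.val + 1 = T.n p.1 ∧ T.pair.point p =
      T.Q p.1 0 + (1 - (p.2.2 : ℝ)) • (T.Q p.1 (T.n p.1 - 1) - T.Q p.1 0)) := by
  have h : T.pair.point p = T.Q p.1 p.2.1.val +
      (p.2.2 : ℝ) • (T.Q p.1 (p.2.1 + 1).val - T.Q p.1 p.2.1.val) := by
    rw [PolygonPair.point, AffineMap.lineMap_apply_module']
    exact add_comm _ _
  rw [h]
  rcases zmod_val_succ p.2.1 with ⟨h1, h2⟩ | ⟨h1, h2⟩
  · exact Or.inl ⟨h1, by rw [h2]⟩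
  · refine Or.inr ⟨h1, ?_⟩
    have h1' : p.2.1.val + 1 = T.n p.1 := h1
    rw [h2, show T.n p.1 - 1 = p.2.1.val by omega]
    module

theorem height_bounds (p : T.pair.Param) :
    (T.Q p.1 0).2 ≤ (T.pair.point p).2 ∧ (T.pair.point p).2 ≤ (T.Q p.1 (T.n p.1 - 1)).2 := by
  have h0 := p.2.2.2.1
  have h1 := p.2.2.2.2
  have h3 := T.three_le p.1
  rcases T.point_cases p with ⟨hi, h⟩ | ⟨hi, h⟩
  · have k1 := T.height_mono p.1 (Nat.zero_le p.2.1.val) (by omega)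
    have k2 := T.height_mono p.1 (show p.2.1.val + 1 ≤ T.n p.1 - 1 by omega) (by omega)
    have k3 := T.height_lt p.1 _ hi
    rw [h]
    simp only [Prod.snd_add, Prod.smul_snd, Prod.snd_sub, smul_eq_mul]
    constructor <;> nlinarith
  · have k1 := T.height_mono p.1 (Nat.zero_le (T.n p.1 - 1)) (by omega)
    rw [h]
    simp only [Prod.snd_add, Prod.smul_snd, Prod.snd_sub, smul_eq_mul]
    constructor <;> nlinarith

theorem comp_eq_of_height_bounds {x : Space} {k l : Fin 2} (h : (T.Q k 0).2 ≤ x.2)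
    (h' : x.2 ≤ (T.Q k (T.n k - 1)).2) (g : (T.Q l 0).2 ≤ x.2)
    (g' : x.2 ≤ (T.Q l (T.n l - 1)).2) : k = l := by
  have := T.separated
  by_contra hkl
  have h2 : (k = 0 ∧ l = 1) ∨ (k = 1 ∧ l = 0) := by omega
  rcases h2 with ⟨rfl, rfl⟩ | ⟨rfl, rfl⟩ <;> linarith

/-- The last edge has no points in common with the other ones, apart from the end points. -/
theorem closing_ne (k : Fin 2) {i : ℕ} (hi : i + 1 < T.n k) {s t : ℝ} (hs0 : 0 ≤ s) (hs1 : s < 1)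
    (ht : t < 1) :
    T.Q k 0 + (1 - t) • (T.Q k (T.n k - 1) - T.Q k 0) ≠
      T.Q k i + s • (T.Q k (i + 1) - T.Q k i) := by
  intro h
  have h' : (1 - t) • (T.Q k (T.n k - 1) - T.Q k 0) =
      (1 - s) • (T.Q k i - T.Q k 0) + s • (T.Q k (i + 1) - T.Q k 0) := by
    linear_combination (norm := module) h
  rcases Nat.lt_or_ge (i + 2) (T.n k) with h2 | h2
  · exact T.closing k i h2 _ _ _ (by linarith) (by linarith) hs0 h'
  · have h3 := T.three_le k
    -- The other edge now ends at the top vertex too. A common point makes a multiple of the closing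
    -- ray equal to a multiple of the ray to vertex `j + 1`, against `closing` for the edge `j` with
    -- `α = 0`. Comparing heights shows that the factor is positive.
    obtain ⟨j, rfl⟩ : ∃ j, i = j + 1 := ⟨i - 1, by omega⟩
    have h4 : j + 1 + 1 = T.n k - 1 := by omega
    rw [h4] at h'
    have h5 : (1 - t - s) • (T.Q k (T.n k - 1) - T.Q k 0) =
        (0 : ℝ) • (T.Q k j - T.Q k 0) + (1 - s) • (T.Q k (j + 1) - T.Q k 0) := by
      linear_combination (norm := module) h'
    refine T.closing k j (by omega) _ _ _ ?_ le_rfl (by linarith) h5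
    have k1 := T.height_strict k (Nat.succ_pos j) (by omega)
    have k2 := T.height_strict k (show 0 < T.n k - 1 by omega) (by omega)
    have k3 := congrArg Prod.snd h5
    simp only [Prod.snd_add, Prod.smul_snd, Prod.snd_sub, smul_eq_mul] at k3
    by_contra hneg
    have := mul_nonneg (sub_nonneg.2 (not_lt.1 hneg)) (sub_nonneg.2 k2.le)
    have := mul_pos (sub_pos.2 hs1) (sub_pos.2 k1)
    nlinarith

theorem val_le_of_height {k : Fin 2} {i j : ℕ} {s t : ℝ} (hi : i + 1 < T.n k) (hj : j + 1 < T.n k)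
    (hs0 : 0 ≤ s) (ht1 : t < 1)
    (h : (T.Q k i + s • (T.Q k (i + 1) - T.Q k i)).2 = (T.Q k j + t • (T.Q k (j + 1) - T.Q k j)).2) :
    i ≤ j := by
  by_contra hji
  have k1 := T.height_mono k (show j + 1 ≤ i by omega) (by omega)
  have k2 := T.height_lt k i hi
  have k3 := T.height_lt k j hj
  simp only [Prod.snd_add, Prod.smul_snd, Prod.snd_sub, smul_eq_mul] at h
  nlinarith

/-- Heights separate the components and determine the points on the rising edges; the closing edge
is handled by `closing_ne`. -/
theorem pair_injective : Function.Injective T.pair.point := by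
  rintro ⟨k, i, s⟩ ⟨l, j, t⟩ h
  obtain rfl : k = l := by
    have h1 := T.height_bounds ⟨k, i, s⟩
    have h2 := T.height_bounds ⟨l, j, t⟩
    rw [← h] at h2
    exact T.comp_eq_of_height_bounds h1.1 h1.2 h2.1 h2.2
  have s0 := s.2.1
  have s1 := s.2.2
  have t0 := t.2.1
  have t1 := t.2.2
  have h3 := T.three_le k
  suffices hh : i.val = j.val ∧ (s : ℝ) = t by
    have e1 : i = j := ZMod.val_injective _ hh.1
    have e2 : s = t := Subtype.ext hh.2
    rw [e1, e2]
  rcases T.point_cases ⟨k, i, s⟩ with ⟨hi, e⟩ | ⟨hi, e⟩ <;>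
    rcases T.point_cases ⟨k, j, t⟩ with ⟨hj, e'⟩ | ⟨hj, e'⟩ <;> dsimp only at hi hj e e' <;>
    rw [e, e'] at h
  · have e1 : i.val = j.val := le_antisymm
      (T.val_le_of_height hi hj s0 t1 (congrArg Prod.snd h))
      (T.val_le_of_height hj hi t0 s1 (congrArg Prod.snd h.symm))
    refine ⟨e1, ?_⟩
    rw [e1] at h
    have k1 := T.height_lt k _ hj
    have k3 := congrArg Prod.snd h
    simp only [Prod.snd_add, Prod.smul_snd, Prod.snd_sub, smul_eq_mul] at k3
    exact mul_right_cancel₀ (sub_pos.2 k1).ne' (add_left_cancel k3)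
  · exact absurd h.symm (T.closing_ne k hi s0 s1 t1)
  · exact absurd h (T.closing_ne k hj t0 t1 s1)
  · refine ⟨by omega, ?_⟩
    have k1 := T.height_strict k (show 0 < T.n k - 1 by omega) (by omega)
    have k3 := congrArg Prod.snd h
    simp only [Prod.snd_add, Prod.smul_snd, Prod.snd_sub, smul_eq_mul] at k3
    have := mul_right_cancel₀ (sub_pos.2 k1).ne' (add_left_cancel k3)
    linarith

/-- The link formed by two towers. -/
def link : PolygonalLink := ⟨T.pair, T.pair_injective⟩

/-- Omission of the first vertex after the initial one. -/
def remove (k : Fin 2) (hk : 4 ≤ T.n k) : Towers where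
  n l := if l = k then T.n l - 1 else T.n l
  Q l i := if l = k ∧ i ≠ 0 then T.Q l (i + 1) else T.Q l i
  three_le l := by
    have := T.three_le l
    split_ifs with h
    · subst h; omega
    · exact this
  height_lt l i hi := by
    by_cases h : l = k
    · subst h
      rw [if_pos rfl] at hi
      by_cases h0 : i = 0
      · subst h0
        simpa using T.height_strict l (show 0 < 2 by omega) (by omega)
      · simpa [h0] using T.height_lt l (i + 1) (by omega)
    · rw [if_neg h] at hi
      simpa [h] using T.height_lt l i hi
  closing l i hi s α β hs hα hβ := by
    by_cases h : l = k
    · subst h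
      rw [if_pos rfl] at hi
      have e1 : T.n l - 1 - 1 ≠ 0 := by omega
      have e2 : T.n l - 1 - 1 + 1 = T.n l - 1 := by omega
      by_cases h0 : i = 0
      · subst h0
        -- The new first edge starts at the apex of the cone, so its cone is the ray through the old
        -- vertex `2`, a face of the cone over the old edge `1`.
        simpa [e1, e2] using T.closing l 1 (by omega) s 0 β hs le_rfl hβ
      · simpa [h0, e1, e2] using T.closing l (i + 1) (by omega) s α β hs hα hβ
    · rw [if_neg h] at hi
      simpa [h] using T.closing l i hi s α β hs hα hβ
  separated := by
    have := T.separated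
    have e2 : T.n k - 1 - 1 + 1 = T.n k - 1 := by omega
    by_cases h : 0 = k
    · subst h
      have e1 : T.n 0 - 1 - 1 ≠ 0 := by omega
      simpa [e1, e2] using this
    · simpa [h] using this

theorem link_vertex (k : Fin 2) (i : ℕ) :
    (T.link.comp k).vertex (i : ZMod (T.link.comp k).n) = T.Q k (i % T.n k) := by
  change T.Q k (ZMod.val (i : ZMod (T.n k))) = _
  rw [ZMod.val_natCast]

theorem remove_n (k : Fin 2) (hk : 4 ≤ T.n k) : (T.remove k hk).n k = T.n k - 1 := if_pos rfl

theorem remove_zero (k : Fin 2) (hk : 4 ≤ T.n k) (l : Fin 2) : (T.remove k hk).Q l 0 = T.Q l 0 :=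
  if_neg (by simp)

theorem remove_succ (k : Fin 2) (hk : 4 ≤ T.n k) {i : ℕ} (hi : i ≠ 0) :
    (T.remove k hk).Q k i = T.Q k (i + 1) := if_pos ⟨rfl, hi⟩

/-- The triangle reaches the height of `T.Q k 2` only at that vertex. The later rising edges are not
below that height, the other component has disjoint heights, and a common point with the closing
edge would put a positive multiple of the closing ray into the cone over edge `1`. -/
theorem triangle_inter_remove (k : Fin 2) (hk : 4 ≤ T.n k) (p : (T.remove k hk).pair.Param)
    (hx : (T.remove k hk).pair.point p ∈ convexHull ℝ {T.Q k 0, T.Q k 1, T.Q k 2}) :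
    (T.remove k hk).pair.point p ∈ segment ℝ (T.Q k 0) (T.Q k 2) := by
  have h := (T.remove k hk).point_cases p
  have h1 := (T.remove k hk).height_bounds p
  generalize (T.remove k hk).pair.point p = x at *
  generalize p.2.1.val = i at *
  have t0 := p.2.2.2.1
  have t1 := p.2.2.2.2
  generalize (p.2.2 : ℝ) = t at *
  generalize p.1 = l at *
  obtain ⟨β, γ, hβ, hγ, hβγ, e⟩ := exists_of_mem_triangle hx
  have k1 := T.height_lt k 0 (by omega)
  have k2 := T.height_lt k 1 (by omega)
  rw [zero_add] at k1
  have eh := congrArg Prod.snd e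
  simp only [Prod.snd_add, Prod.smul_snd, Prod.snd_sub, smul_eq_mul] at eh
  norm_num at k2
  have k3 : ((T.remove k hk).Q k ((T.remove k hk).n k - 1)).2 = (T.Q k (T.n k - 1)).2 := by
    rw [remove_n, remove_succ _ _ _ (by omega), show T.n k - 1 - 1 + 1 = T.n k - 1 by omega]
  have k4 := T.height_mono k (show 2 ≤ T.n k - 1 by omega) (by omega)
  have b1 := mul_nonneg hβ (sub_nonneg.2 k1.le)
  have b2 := mul_nonneg hβ (sub_nonneg.2 k2.le)
  have b3 := mul_nonneg hγ (sub_nonneg.2 (k1.trans k2).le)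
  have b4 := mul_nonneg (sub_nonneg.2 hβγ) (sub_nonneg.2 (k1.trans k2).le)
  obtain rfl : l = k := by
    refine (T.remove k hk).comp_eq_of_height_bounds h1.1 h1.2 ?_ ?_
    · rw [remove_zero]; linarith
    · rw [k3]; linarith
  rcases h with ⟨hi, h⟩ | ⟨hi, h⟩
  · rw [remove_n] at hi
    by_cases h0 : i = 0
    · rw [h0, remove_zero, zero_add, remove_succ _ _ _ one_ne_zero] at h
      rw [h, segment_eq_image']
      exact ⟨t, ⟨t0, t1.le⟩, rfl⟩
    · rw [remove_succ _ _ _ h0, remove_succ _ _ _ (by omega)] at h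
      have eh' := congrArg Prod.snd h
      simp only [Prod.snd_add, Prod.smul_snd, Prod.snd_sub, smul_eq_mul] at eh'
      have k5 := T.height_mono l (show 2 ≤ i + 1 by omega) (by omega)
      have k6 := T.height_lt l (i + 1) (by omega)
      have k7 : (T.Q l 2).2 ≤ x.2 := by
        have := mul_nonneg t0 (sub_nonneg.2 k6.le)
        linarith
      have k8 : γ = 1 := by
        by_contra hne
        have h2 : γ < 1 := lt_of_le_of_ne (by linarith) hne
        rcases hβ.eq_or_lt with rfl | hβ
        · have := mul_pos (sub_pos.2 h2) (sub_pos.2 (k1.trans k2))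
          linarith
        · have := mul_pos hβ (sub_pos.2 k2)
          linarith
      have k9 : β = 0 := by linarith
      rw [e, k8, k9, zero_smul, add_zero, one_smul, add_sub_cancel]
      exact right_mem_segment _ _ _
  · rw [remove_n] at h
    rw [remove_zero, remove_succ _ _ _ (by omega), show T.n l - 1 - 1 + 1 = T.n l - 1 by omega] at h
    refine absurd ?_ (T.closing l 1 (by omega) (1 - t) β γ (by linarith) hβ hγ)
    rw [e] at h
    linear_combination (norm := module) -h

theorem triangleMove_remove (k : Fin 2) (hk : 4 ≤ T.n k) :
    PolygonalLink.TriangleMove (T.remove k hk).link T.link := by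
  have hn := T.remove_n k hk
  have hQ0 := T.remove_zero k hk
  have hQ := fun i hi => T.remove_succ k hk (i := i) hi
  set T' := T.remove k hk
  -- The inserted vertex has index `1` in the longer polygon, so `r = 2` there; the vertex following
  -- it has index `s = 1` in the shorter one. Both enumerations end at the initial vertex.
  refine ⟨k, ?_, ?_, ((1 : ℕ) : ZMod (T'.link.comp k).n), ((2 : ℕ) : ZMod (T.link.comp k).n),
    ?_, ?_⟩
  · intro l hl
    exact sequencePolygon_congr (h := T.three_le l) (h' := T'.three_le l) (if_neg hl).symm
      fun i => (if_neg (by simp [hl])).symm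
  · change T.n k = T'.n k + 1
    omega
  · intro i hi
    change i < T'.n k at hi
    rw [← Nat.cast_add, ← Nat.cast_add, link_vertex, link_vertex, hn]
    rcases Nat.lt_or_ge (2 + i) (T.n k) with h | h
    · rw [Nat.mod_eq_of_lt h, Nat.mod_eq_of_lt (by omega), hQ _ (by omega)]
      congr 1; omega
    · have e3 : 2 + i = T.n k := by omega
      have e4 : 1 + i = T.n k - 1 := by omega
      rw [e3, e4, Nat.mod_self, Nat.mod_self, hQ0]
  · have va : (T'.link.comp k).vertex (((1 : ℕ) : ZMod (T'.link.comp k).n) - 1) = T.Q k 0 := by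
      have := T'.link_vertex k 0
      rw [Nat.zero_mod, hQ0] at this
      rw [← this, Nat.cast_one, sub_self, Nat.cast_zero]
    have vc : (T.link.comp k).vertex (((2 : ℕ) : ZMod (T.link.comp k).n) - 1) = T.Q k 1 := by
      have := T.link_vertex k 1
      rw [Nat.mod_eq_of_lt (by omega)] at this
      rw [← this, Nat.cast_one, Nat.cast_ofNat, sub_eq_of_eq_add one_add_one_eq_two.symm]
    have vb : (T'.link.comp k).vertex ((1 : ℕ) : ZMod (T'.link.comp k).n) = T.Q k 2 := by
      rw [link_vertex, Nat.mod_eq_of_lt (by omega), hQ _ one_ne_zero]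
    rw [va, vb, vc]
    rintro _ ⟨hx, p, rfl⟩
    exact T.triangle_inter_remove k hk p hx

/-- Inverse triangle moves remove vertices until both components are triangles, whose disks lie in
disjoint horizontal slabs. -/
theorem isTrivial : T.link.IsTrivial := by
  induction hm : T.n 0 + T.n 1 using Nat.strong_induction_on generalizing T with
  | _ m ih =>
    subst hm
    by_cases h : ∃ k, 4 ≤ T.n k
    · obtain ⟨k, hk⟩ := h
      have hlt : (T.remove k hk).n 0 + (T.remove k hk).n 1 < T.n 0 + T.n 1 := by
        have h0 := T.three_le 0
        have h1 := T.three_le 1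
        have h2 : k = 0 ∨ k = 1 := by omega
        rcases h2 with rfl | rfl <;> simp [remove] <;> omega
      obtain ⟨L₀, h1, h2, h3⟩ := ih _ hlt (T.remove k hk) rfl
      exact ⟨L₀, ((Relation.EqvGen.rel _ _ (T.triangleMove_remove k hk)).symm).trans _ _ _ h1, h2, h3⟩
    · push Not at h
      have h3 : ∀ k, T.n k = 3 := fun k => le_antisymm (by have := h k; omega) (T.three_le k)
      refine ⟨T.link, Relation.EqvGen.refl _, h3, ?_⟩
      have hb : ∀ k, convexHull ℝ (Set.range (T.link.comp k).vertex) ⊆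
          {x | (T.Q k 0).2 ≤ x.2 ∧ x.2 ≤ (T.Q k (T.n k - 1)).2} := by
        intro k
        refine convexHull_min ?_ ?_
        · rintro _ ⟨i, rfl⟩
          have hi : ZMod.val i < T.n k := ZMod.val_lt i
          exact ⟨T.height_mono k (Nat.zero_le _) hi, T.height_mono k (show ZMod.val i ≤ T.n k - 1 by omega) (by omega)⟩
        · exact (convex_halfSpace_ge (LinearMap.snd ℝ Plane ℝ).isLinear _).inter
            (convex_halfSpace_le (LinearMap.snd ℝ Plane ℝ).isLinear _)
      refine Set.disjoint_left.2 fun x h0 h1 => ?_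
      have h0' := (hb 0 h0)
      have h1' := (hb 1 h1)
      exact absurd (T.comp_eq_of_height_bounds h0'.1 h0'.2 h1'.1 h1'.2) (by simp)

end Towers

end RegionCrossing

/-! ### A trivial link over every diagram, and sufficiency -/

namespace RegionCrossing

/-- The norm on a cone that does not contain a line or a degenerate generator. -/
theorem exists_mul_le_norm {V : Type*} [NormedAddCommGroup V] [NormedSpace ℝ V] {u w : V}
    (h : (0 : V) ∉ segment ℝ u w) :
    ∃ d : ℝ, 0 < d ∧ ∀ α β : ℝ, 0 ≤ α → 0 ≤ β → (α + β) * d ≤ ‖α • u + β • w‖ := by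
  have hc : IsClosed (segment ℝ u w) := by
    rw [segment_eq_image_lineMap]
    exact (isCompact_Icc.image AffineMap.lineMap_continuous).isClosed
  have hne : (segment ℝ u w).Nonempty := ⟨u, left_mem_segment _ _ _⟩
  refine ⟨Metric.infDist 0 (segment ℝ u w), (hc.notMem_iff_infDist_pos hne).1 h, ?_⟩
  intro α β hα hβ
  rcases (add_nonneg hα hβ).eq_or_lt with h0 | h0
  · rw [← h0, zero_mul]
    exact norm_nonneg _
  · have hm : (α / (α + β)) • u + (β / (α + β)) • w ∈ segment ℝ u w :=
      ⟨_, _, by positivity, by positivity, by field_simp, rfl⟩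
    have h1 := Metric.infDist_le_dist_of_mem (x := (0 : V)) hm
    rw [dist_zero_left] at h1
    have h2 : α • u + β • w = (α + β) • ((α / (α + β)) • u + (β / (α + β)) • w) := by
      rw [smul_add, smul_smul, smul_smul, mul_div_cancel₀ _ h0.ne', mul_div_cancel₀ _ h0.ne']
    rw [h2, norm_smul, Real.norm_of_nonneg h0.le]
    exact mul_le_mul_of_nonneg_left h1 h0.le

namespace LinkDiagram

open PolygonPair

variable (D : LinkDiagram)

/-- A polygon with one vertex has an edge of length zero. With two vertices its edges are one
segment traversed both ways, and the common midpoint would be a crossing of parallel strands. -/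
theorem three_le_n (k : Fin 2) : 3 ≤ (D.comp k).n := by
  by_contra hn
  have hpos := NeZero.pos (D.comp k).n
  set e : D.Edge := ⟨k, 0⟩ with he
  have v0 : (0 : ZMod (D.comp k).n).val = 0 := ZMod.val_zero
  have h1 := zmod_val_succ (0 : ZMod (D.comp k).n)
  rw [v0] at h1
  rcases h1 with ⟨h1, h1'⟩ | ⟨h1, h1'⟩
  · have h2 := zmod_val_succ (0 + 1 : ZMod (D.comp k).n)
    rw [h1'] at h2
    have h3 : (0 + 1 + 1 : ZMod (D.comp k).n) = 0 := by
      refine ZMod.val_injective _ ?_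
      rw [v0]
      omega
    have hne : (0 : ZMod (D.comp k).n) ≠ 0 + 1 := by
      intro h
      have := congrArg ZMod.val h
      rw [h1', v0] at this
      omega
    have hn2 : D.next (D.next e) = e := by
      change (⟨k, 0 + 1 + 1⟩ : D.Edge) = ⟨k, 0⟩
      rw [h3]
    have hv : D.vec (D.next e) = (-1 : ℝ) • D.vec e := by
      change D.src (D.next (D.next e)) - D.src (D.next e) =
        (-1 : ℝ) • (D.src (D.next e) - D.src e)
      rw [hn2]
      module
    have hh : (1 / 2 : ℝ) ∈ Set.Ico (0 : ℝ) 1 := by norm_num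
    have hc : D.Cross (D.param e (1 / 2) hh) (D.param (D.next e) (1 / 2) hh) := by
      constructor
      · intro h
        have h4 : e = D.next e := congrArg D.edgeOf h
        exact hne (eq_of_heq (Sigma.mk.inj_iff.1 h4).2)
      · rw [point_param, point_param, along_eq, along_eq, hv]
        have : D.src (D.next e) = D.src e + D.vec e := by
          change _ = D.src e + (D.src (D.next e) - D.src e)
          abel
        rw [this]
        module
    refine hc.det_ne ?_
    rw [edgeOf_param, edgeOf_param, hv, det_smul_right, det_self, mul_zero]
  · refine D.vec_ne_zero e ?_
    have h2 : (0 + 1 : ZMod (D.comp k).n) = 0 := ZMod.val_injective _ (by rw [h1', v0])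
    change (D.comp k).vertex (0 + 1) - (D.comp k).vertex 0 = 0
    rw [h2, sub_self]

/-- The `i`-th vertex, seen from the initial one. -/
def ray (k : Fin 2) (i : ℕ) : Plane :=
  (D.comp k).vertex (i : ZMod (D.comp k).n) - (D.comp k).vertex 0

/-- With vertex `i` at height `i`, the left side is the height on the lifted cone over an edge, and
it is at most linear in the horizontal distance from the initial vertex, as this vertex does not lie
on the edge. For `i = 0` it does, but the degenerate generator then has height zero as well. -/
theorem exists_ray_bound (k : Fin 2) {i : ℕ} (hi : i + 1 < (D.comp k).n) :
    ∃ C : ℝ, 0 ≤ C ∧ ∀ α β : ℝ, 0 ≤ α → 0 ≤ β →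
      α * i + β * (i + 1) ≤ C * ‖α • D.ray k i + β • D.ray k (i + 1)‖ := by
  rcases Nat.eq_zero_or_pos i with rfl | hi0
  · have h0 : D.ray k 0 = 0 := by simp [ray]
    have h1 : D.ray k (0 + 1) ≠ 0 := by
      have := D.vec_ne_zero ⟨k, 0⟩
      simpa [ray, vec, dir] using this
    have h2 := norm_pos_iff.2 h1
    refine ⟨‖D.ray k (0 + 1)‖⁻¹, by positivity, fun α β _ hβ => ?_⟩
    rw [h0, smul_zero, zero_add (β • _), norm_smul, Real.norm_of_nonneg hβ,
      mul_left_comm, inv_mul_cancel₀ h2.ne']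
    simp
  · have hseg : (0 : Plane) ∉ segment ℝ (D.ray k i) (D.ray k (i + 1)) := by
      intro h
      set e : D.Edge := ⟨k, (i : ZMod (D.comp k).n)⟩ with he
      have hs : D.src ⟨k, 0⟩ ∈ D.edgeSet e := by
        obtain ⟨a, b, ha, hb, hab, h⟩ := h
        refine ⟨a, b, ha, hb, hab, ?_⟩
        have h' : a • (D.src e - D.src ⟨k, 0⟩) + b • (D.src (D.next e) - D.src ⟨k, 0⟩) = 0 := by
          simpa [ray, src, next, he] using h
        obtain rfl : a = 1 - b := by linarith
        linear_combination (norm := module) h'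
      obtain ⟨p, hp, hpe⟩ := exists_param_of_mem_edgeSet D.toPolygonPair hs
      have h00 : (0 : ℝ) ∈ Set.Ico (0 : ℝ) 1 := by norm_num
      have hp0 : p = D.param ⟨k, 0⟩ 0 h00 := by
        by_contra hne
        refine src_notMem_crossings (D := D) ⟨k, 0⟩ (mem_crossings.2 ⟨p, _, ⟨hne, ?_⟩, hp⟩)
        rw [point_param, along_zero, hp]
      have hv := ZMod.val_natCast (D.comp k).n i
      rw [Nat.mod_eq_of_lt (by omega)] at hv
      have hv0 : (0 : ZMod (D.comp k).n).val = 0 := ZMod.val_zero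
      rw [hp0, edgeOf_param] at hpe
      rcases hpe with hpe | ⟨hpe, -⟩
      · have := congrArg ZMod.val (eq_of_heq (Sigma.mk.inj_iff.1 hpe).2)
        omega
      · have : (0 : ZMod (D.comp k).n).val = ((i : ZMod (D.comp k).n) + 1).val :=
          congrArg ZMod.val (eq_of_heq (Sigma.mk.inj_iff.1 hpe).2)
        have h2 := zmod_val_succ (i : ZMod (D.comp k).n)
        omega
    obtain ⟨d, hd, H⟩ := exists_mul_le_norm hseg
    refine ⟨(i + 1) / d, by positivity, fun α β hα hβ => ?_⟩
    have h1 := mul_le_mul_of_nonneg_left (H α β hα hβ) (show (0 : ℝ) ≤ (i + 1) / d by positivity)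
    refine le_trans ?_ h1
    have : ((i : ℝ) + 1) / d * ((α + β) * d) = (i + 1) * (α + β) := by field_simp
    rw [this]
    nlinarith

/-- If the last vertex is high enough, the closing edge is steeper than every direction in the
finitely many cones, so no positive multiple of it lies in one of them. The bound by the number of
vertices keeps the heights increasing. -/
theorem exists_summit (k : Fin 2) : ∃ H : ℝ, ((D.comp k).n : ℝ) ≤ H ∧
    ∀ i : ℕ, i + 2 < (D.comp k).n → ∀ s α β : ℝ, 0 < s → 0 ≤ α → 0 ≤ β →
      s • D.ray k ((D.comp k).n - 1) = α • D.ray k i + β • D.ray k (i + 1) →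
        s * H ≠ α * i + β * (i + 1) := by
  have h : ∀ i ∈ Finset.range ((D.comp k).n - 2), ∀ᶠ H : ℝ in atTop,
      ∀ s α β : ℝ, 0 < s → 0 ≤ α → 0 ≤ β →
      s • D.ray k ((D.comp k).n - 1) = α • D.ray k i + β • D.ray k (i + 1) →
        s * H ≠ α * i + β * (i + 1) := by
    intro i hi
    rw [Finset.mem_range] at hi
    obtain ⟨C, -, hC⟩ := D.exists_ray_bound k (show i + 1 < (D.comp k).n by omega)
    filter_upwards [eventually_gt_atTop (C * ‖D.ray k ((D.comp k).n - 1)‖)] with H hH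
    intro s α β hs hα hβ e e'
    have h1 := hC α β hα hβ
    rw [← e, ← e', norm_smul, Real.norm_of_nonneg hs.le] at h1
    have h2 := mul_lt_mul_of_pos_left hH hs
    linarith
  obtain ⟨H, h1, h2⟩ :=
    (((Filter.eventually_all_finset _).2 h).and (eventually_ge_atTop ((D.comp k).n : ℝ))).exists
  exact ⟨H, h2, fun i hi => h1 i (Finset.mem_range.2 (by omega))⟩

/-- A summit for each component. -/
noncomputable def summit (k : Fin 2) : ℝ := (D.exists_summit k).choose

/-- The height of the first vertex. -/
noncomputable def base (k : Fin 2) : ℝ := if k = 0 then 0 else D.summit 0 + 1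

/-- Heights of the vertices over the initial one. -/
noncomputable def elevation (k : Fin 2) (i : ℕ) : ℝ :=
  if i + 1 = (D.comp k).n then D.summit k else i

/-- A pair of towers over a diagram. -/
noncomputable def towers : Towers where
  n k := (D.comp k).n
  Q k i := ((D.comp k).vertex (i : ZMod (D.comp k).n), D.base k + D.elevation k i)
  three_le := D.three_le_n
  height_lt k i hi := by
    have h := (D.exists_summit k).choose_spec.1
    change _ ≤ D.summit k at h
    have hi' : (i : ℝ) + 1 < (D.comp k).n := by exact_mod_cast hi
    simp only [add_lt_add_iff_left, elevation, if_neg hi.ne]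
    split_ifs
    · linarith
    · push_cast; linarith
  closing k i hi s α β hs hα hβ h := by
    have h3 := D.three_le_n k
    have h1 := congrArg Prod.fst h
    have h2 := congrArg Prod.snd h
    have e0 : D.elevation k 0 = 0 := by
      rw [elevation, if_neg (by omega), Nat.cast_zero]
    have e1 : D.elevation k i = i := if_neg (by omega)
    have e2 : D.elevation k (i + 1) = i + 1 := by
      rw [elevation, if_neg (by omega), Nat.cast_succ]
    have e3 : D.elevation k ((D.comp k).n - 1) = D.summit k := if_pos (by omega)
    refine (D.exists_summit k).choose_spec.2 i hi s α β hs hα hβ ?_ ?_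
    · simpa [ray] using h1
    · change s * D.summit k = _
      simpa [e0, e1, e2, e3] using h2
  separated := by
    have h3 := D.three_le_n 0
    have h4 := D.three_le_n 1
    have e0 : D.elevation 1 0 = 0 := by
      rw [elevation, if_neg (by omega), Nat.cast_zero]
    have e3 : D.elevation 0 ((D.comp 0).n - 1) = D.summit 0 := if_pos (by omega)
    simp [base, e0, e3]

theorem towers_vertex (k : Fin 2) (i : ZMod (D.comp k).n) :
    ((D.towers.link.comp k).vertex i).1 = (D.comp k).vertex i := by
  change (D.comp k).vertex ((i.val : ℕ) : ZMod (D.comp k).n) = _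
  rw [ZMod.natCast_zmod_val]

/-- The projection of the towers to the diagram. -/
noncomputable def towersProjection : Projection D D.towers.link where
  edge _ i := i
  start _ _ := 0
  finish _ _ := 1
  start_nonneg _ _ := le_rfl
  start_lt _ _ := one_pos
  finish_le _ _ := le_rfl
  start_eq k i := by rw [AffineMap.lineMap_apply_zero]; exact D.towers_vertex k i
  finish_eq k := fun (i : ZMod (D.comp k).n) => by
    rw [AffineMap.lineMap_apply_one]; exact D.towers_vertex k (i + 1)
  succ _ _ := Or.inr ⟨rfl, rfl, rfl⟩

theorem towersProjection_toParam (p : D.towers.link.Param) : D.towersProjection.toParam p = p := by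
  obtain ⟨k, i, t⟩ := p
  refine param_ext (P := D.toPolygonPair) rfl ?_
  change (0 : ℝ) + (t : ℝ) * (1 - 0) = t
  ring

variable {D}

theorem Projection.point_toParam {L : PolygonalLink} (π : Projection D L) (p : L.Param) :
    D.point (π.toParam p) = (L.point p).1 := by
  have h1 := π.start_eq p.1 p.2.1
  have h2 := π.finish_eq p.1 p.2.1
  have h3 : (L.point p).1 = AffineMap.lineMap ((L.comp p.1).vertex p.2.1).1
      ((L.comp p.1).vertex (p.2.1 + 1)).1 (p.2.2 : ℝ) := by
    rw [PolygonPair.point, AffineMap.lineMap_apply_module', AffineMap.lineMap_apply_module']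
    rfl
  have h4 : D.point (π.toParam p) = AffineMap.lineMap ((D.comp p.1).vertex (π.edge p.1 p.2.1))
      ((D.comp p.1).vertex (π.edge p.1 p.2.1 + 1))
      (π.start p.1 p.2.1 + (p.2.2 : ℝ) * (π.finish p.1 p.2.1 - π.start p.1 p.2.1)) := rfl
  rw [h3, h4, h1, h2]
  simp only [AffineMap.lineMap_apply_module']
  module

/-- Any link which projects to the underlying curves of a diagram has a diagram that arises from it
by crossing changes. -/
theorem Projection.exists_isDiagramOf {L : PolygonalLink} (π : Projection D L)
    (hb : Function.Bijective π.toParam) (hv : ∀ k j, ((L.comp k).vertex j).1 ∉ D.crossings) :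
    ∃ S, (D.crossingChange S).IsDiagramOf L := by
  let S : Set Plane := {x | ∃ p q : L.Param, p ≠ q ∧ (L.point p).1 = x ∧ (L.point q).1 = x ∧
    ¬ (π.toParam p ∈ D.upper ↔ (L.point q).2 < (L.point p).2)}
  let π' : Projection (D.crossingChange S) L := ⟨π.edge, π.start, π.finish, π.start_nonneg,
    π.start_lt, π.finish_le, π.start_eq, π.finish_eq, π.succ⟩
  refine ⟨S, π', hb, hv, fun p q hpq h => ?_⟩
  have hc : D.Cross (π.toParam p) (π.toParam q) :=
    ⟨fun h' => hpq (hb.1 h'), by rw [π.point_toParam, π.point_toParam, h]⟩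
  have hne : (L.point p).2 ≠ (L.point q).2 := fun h' => hpq (L.injective (Prod.ext h h'))
  have hS : D.point (π.toParam p) ∈ S ↔
      ¬ (π.toParam p ∈ D.upper ↔ (L.point q).2 < (L.point p).2) := by
    constructor
    · rintro ⟨p', q', hpq', h1, h2, h3⟩
      have hc' : D.Cross (π.toParam p') (π.toParam q') :=
        ⟨fun h' => hpq' (hb.1 h'), by rw [π.point_toParam, π.point_toParam, h1, h2]⟩
      have hp' := hc.eq_or_eq (r := π.toParam p') (by rw [π.point_toParam, h1])
      have hq' := hc.eq_or_eq (r := π.toParam q') (by rw [π.point_toParam, h2])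
      rcases hp' with hp' | hp'
      · have hq'' : π.toParam q' = π.toParam q :=
          hq'.resolve_left fun h' => hc'.1 (hp'.trans h'.symm)
        rw [hb.1 hp', hb.1 hq''] at h3
        exact h3
      -- With the two strands interchanged, the upper strand and the comparison of heights are both
      -- reversed, so the disagreement is the same.
      · have hq'' : π.toParam q' = π.toParam p :=
          hq'.resolve_right fun h' => hc'.1 (hp'.trans h'.symm)
        rw [hb.1 hp', hb.1 hq''] at h3
        have h4 := D.upper_iff _ _ hc.1 hc.2
        intro h5
        apply h3
        have h6 : (L.point p).2 < (L.point q).2 ↔ ¬ (L.point q).2 < (L.point p).2 := by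
          rw [not_lt]
          exact ⟨le_of_lt, fun h => lt_of_le_of_ne h hne⟩
        rw [h6, ← h5, h4, not_not]
    · intro h3
      exact ⟨p, q, hpq, (π.point_toParam p).symm, by rw [π.point_toParam, h], h3⟩
  have hu : π'.toParam p ∈ (D.crossingChange S).upper ↔ (D.point (π.toParam p) ∈ D.crossings ∧
      (π.toParam p ∈ D.upper ↔ D.point (π.toParam p) ∉ S)) := Iff.rfl
  rw [hu, hS]
  have := hc.mem
  tauto

/-- Some crossing changes lead to a diagram of a trivial link, in which component `1` is above. -/
theorem exists_trivial (D : LinkDiagram) : ∃ S, (∀ x, ¬ (D.crossingChange S).Over x) ∧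
    ∃ L : PolygonalLink, (D.crossingChange S).IsDiagramOf L ∧ L.IsTrivial := by
  have hb : Function.Bijective D.towersProjection.toParam := by
    have : D.towersProjection.toParam = id := funext D.towersProjection_toParam
    rw [this]
    exact Function.bijective_id
  obtain ⟨S, hS⟩ := D.towersProjection.exists_isDiagramOf hb (fun k j hj =>
    src_notMem_crossings (D := D) ⟨k, j⟩ ((congrArg (· ∈ D.crossings) (D.towers_vertex k j)).mp hj))
  refine ⟨S, ?_, _, hS, D.towers.isTrivial⟩
  obtain ⟨π, hπ, -, h⟩ := hS
  rintro x ⟨a, b, h1, h2, hu⟩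
  obtain ⟨p, hp⟩ := hπ.2 ⟨0, a⟩
  obtain ⟨q, hq⟩ := hπ.2 ⟨1, b⟩
  have hp0 : p.1 = 0 := congrArg Sigma.fst hp
  have hq0 : q.1 = 1 := congrArg Sigma.fst hq
  have hlt : (D.towers.link.point q).2 < (D.towers.link.point p).2 := by
    rw [← h p q, hp]
    · exact hu
    · rintro rfl
      exact absurd (hp0.symm.trans hq0) (by simp)
    · rw [← π.point_toParam, ← π.point_toParam, hp, hq]
      exact h1.trans h2.symm
  have h3 := (D.towers.height_bounds p).2
  have h4 := (D.towers.height_bounds q).1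
  rw [hp0] at h3
  rw [hq0] at h4
  have h5 := D.towers.separated
  exact absurd hlt (not_lt.2 (by change (D.towers.pair.point p).2 ≤ (D.towers.pair.point q).2; linarith))

/-- In the tower diagram component `0` is never above, so both diagrams have over-parity zero. They
differ in an even number of mixed crossings, and such a difference is realizable. -/
theorem unknottable_of_even (hD : IsConnected D.support) (h : D.overParity = 0) : D.Unknottable := by
  classical
  have : Fintype D.crossings := finite_crossings.fintype
  obtain ⟨S, hS, L, hL, hT⟩ := D.exists_trivial
  let v : D.crossings → ZMod 2 := fun x => if (x : Plane) ∈ S then 1 else 0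
  have e : D.crossingChange (supp (D.extend v)) = D.crossingChange S := by
    refine crossingChange_congr fun x hx => ?_
    have := extend_apply v ⟨x, hx⟩
    simp [supp, this, v]
  refine ⟨D.crossingChange S, ?_, L, hL, hT⟩
  rw [← e]
  refine reflTransGen_of_mem (extend_mem_of_even hD ?_)
  have h1 := overParity_crossingChange (D := D) (D.extend v)
  rw [h, zero_add, e] at h1
  simp only [extend_apply] at h1
  rw [← h1, overParity]
  simp [hS]

end LinkDiagram

end RegionCrossing

/-! ### A segment and a triangle in the plane -/

namespace RegionCrossing

open Classical in
/-- The truth value of a proposition modulo two. -/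
noncomputable def ind (P : Prop) : ZMod 2 := if P then 1 else 0

theorem ind_false {P : Prop} (h : ¬ P) : ind P = 0 := if_neg h

theorem ind_congr {P Q : Prop} (h : P ↔ Q) : ind P = ind Q := by rw [propext h]

theorem ind_xor (P Q : Prop) : ind (P ∧ ¬ Q ∨ Q ∧ ¬ P) = ind P + ind Q := by
  by_cases hP : P <;> by_cases hQ : Q <;> simp [ind, hP, hQ, CharTwo.add_self_eq_zero]

theorem exists_smul_of_det_eq_zero {u w : Plane} (hu : u ≠ 0) (h : det u w = 0) :
    ∃ r : ℝ, w = r • u := by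
  have hc := eq_coord (det_rot_ne hu) w
  rw [h, zero_div, zero_smul, add_zero] at hc
  exact ⟨_, hc⟩

theorem line_mem_segment_iff {V : Type*} [AddCommGroup V] [Module ℝ V] {p u : V} (hu : u ≠ 0)
    (r x y : ℝ) : p + r • u ∈ segment ℝ (p + x • u) (p + y • u) ↔ r ∈ Set.uIcc x y := by
  rw [← segment_eq_uIcc]
  constructor
  · rintro ⟨a, b, ha, hb, hab, h⟩
    refine ⟨a, b, ha, hb, hab, smul_left_injective ℝ hu ?_⟩
    obtain rfl : a = 1 - b := by linarith
    simp only [smul_eq_mul]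
    linear_combination (norm := module) h
  · rintro ⟨a, b, ha, hb, hab, rfl⟩
    refine ⟨a, b, ha, hb, hab, ?_⟩
    obtain rfl : a = 1 - b := by linarith
    simp only [smul_eq_mul]
    module

/-- No end point of one of two segments lies on the other one. -/
structure General {V : Type*} [AddCommGroup V] [Module ℝ V] (a b p q : V) : Prop where
  left : a ∉ segment ℝ p q
  right : b ∉ segment ℝ p q
  left' : p ∉ segment ℝ a b
  right' : q ∉ segment ℝ a b

/-- Two segments have a point in common. -/
def Meets {V : Type*} [AddCommGroup V] [Module ℝ V] (a b p q : V) : Prop :=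
  ∃ z, z ∈ segment ℝ a b ∧ z ∈ segment ℝ p q

/-- The side of a point with respect to an oriented line. -/
def side (p q z : Plane) : ℝ := det (q - p) (z - p)

theorem side_combo {p q a b : Plane} {s t : ℝ} (h : s + t = 1) :
    side p q (s • a + t • b) = s * side p q a + t * side p q b := by
  obtain rfl : s = 1 - t := by linarith
  have : (1 - t) • a + t • b - p = (1 - t) • (a - p) + t • (b - p) := by module
  rw [side, this, det_add_right, det_smul_right, det_smul_right]
  rfl

theorem side_line (p q : Plane) (r : ℝ) : side p q (p + r • (q - p)) = 0 := by
  rw [side, add_sub_cancel_left, det_smul_right, det_self, mul_zero]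

theorem exists_of_side_eq_zero {p q z : Plane} (hpq : p ≠ q) (h : side p q z = 0) :
    ∃ r : ℝ, z = p + r • (q - p) := by
  obtain ⟨r, hr⟩ := exists_smul_of_det_eq_zero (sub_ne_zero.2 hpq.symm) h
  exact ⟨r, by rw [← hr, add_sub_cancel]⟩

theorem mem_segment_line_iff {p q : Plane} (hpq : p ≠ q) (r : ℝ) :
    p + r • (q - p) ∈ segment ℝ p q ↔ 0 ≤ r ∧ r ≤ 1 := by
  have := line_mem_segment_iff (p := p) (sub_ne_zero.2 hpq.symm) r 0 1
  rwa [zero_smul, add_zero, one_smul, add_sub_cancel, Set.uIcc_of_le zero_le_one] at this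

theorem side_eq_zero_of_mem {p q z : Plane} (h : z ∈ segment ℝ p q) : side p q z = 0 := by
  rw [segment_eq_image'] at h
  obtain ⟨r, -, rfl⟩ := h
  exact side_line p q r

/-- Points on the line are assigned to the nonnegative side. A common point of the segments has side
zero, which forces both `a` and `b` onto the line, all other cases violating general position at
once; and of two collinear segments that meet, one has an end point on the other. -/
theorem not_meets_of_same_side {a b p q : Plane} (hpq : p ≠ q) (hg : General a b p q)
    (h : (0 ≤ side p q a ∧ 0 ≤ side p q b) ∨ (side p q a < 0 ∧ side p q b < 0)) :
    ¬ Meets a b p q := by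
  rintro ⟨z, ⟨s, t, hs, ht, hst, rfl⟩, hz⟩
  have h0 := side_eq_zero_of_mem hz
  rw [side_combo hst] at h0
  rcases h with ⟨ha, hb⟩ | ⟨ha, hb⟩
  · have h1 := mul_nonneg hs ha
    have h2 := mul_nonneg ht hb
    have h3 : s * side p q a = 0 := by linarith
    have h4 : t * side p q b = 0 := by linarith
    rcases mul_eq_zero.1 h3 with rfl | h3
    · obtain rfl : t = 1 := by linarith
      rw [zero_smul, zero_add, one_smul] at hz
      exact hg.right hz
    rcases mul_eq_zero.1 h4 with rfl | h4
    · obtain rfl : s = 1 := by linarith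
      rw [zero_smul, add_zero, one_smul] at hz
      exact hg.left hz
    obtain ⟨x, rfl⟩ := exists_of_side_eq_zero hpq h3
    obtain ⟨y, rfl⟩ := exists_of_side_eq_zero hpq h4
    have k1 := hg.left
    have k2 := hg.right
    have k3 := hg.left'
    have k4 : s • (p + x • (q - p)) + t • (p + y • (q - p)) = p + (s * x + t * y) • (q - p) := by
      obtain rfl : s = 1 - t := by linarith
      module
    have k5 := line_mem_segment_iff (p := p) (sub_ne_zero.2 hpq.symm) 0 x y
    rw [zero_smul, add_zero] at k5
    rw [k4] at hz
    rw [mem_segment_line_iff hpq] at k1 k2 hz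
    rw [k5, Set.mem_uIcc] at k3
    push Not at k1 k2 k3
    by_cases hx : 0 ≤ x <;> by_cases hy : 0 ≤ y
    · have h1 := Convex.min_le_combo x y hs ht hst
      have h2 := lt_min (k1 hx) (k2 hy)
      exact absurd hz.2 (not_le.2 (h2.trans_le h1))
    · exact absurd (k3.2 (not_le.1 hy).le) (not_lt.2 hx)
    · exact absurd (k3.1 (not_le.1 hx).le) (not_lt.2 hy)
    · have h1 := Convex.combo_le_max x y hs ht hst
      have h2 := max_lt (not_le.1 hx) (not_le.1 hy)
      exact absurd hz.1 (not_le.2 (h1.trans_lt h2))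
  · have h1 := mul_nonpos_of_nonneg_of_nonpos hs ha.le
    have h2 := mul_nonpos_of_nonneg_of_nonpos ht hb.le
    have h3 : s * side p q a = 0 := by linarith
    have h4 : t * side p q b = 0 := by linarith
    have h5 := (mul_eq_zero.1 h3).resolve_right ha.ne
    have h6 := (mul_eq_zero.1 h4).resolve_right hb.ne
    linarith

/-- An edge between different sides of a line meets this line in one point. -/
theorem exists_intersection {a b p q : Plane} (hpq : p ≠ q)
    (h : (0 ≤ side p q a ∧ side p q b < 0) ∨ (side p q a < 0 ∧ 0 ≤ side p q b)) :
    ∃ m : ℝ, p + m • (q - p) ∈ segment ℝ a b ∧ ∀ s t : ℝ, 0 ≤ s → 0 ≤ t →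
      s * side p q a + t * side p q b = 0 → s • a + t • b = (s + t) • (p + m • (q - p)) := by
  set x := side p q a with hx
  set y := side p q b with hy
  have hne : x - y ≠ 0 := by rcases h with h | h <;> [exact ne_of_gt (by linarith); exact ne_of_lt (by linarith)]
  have hsum : -y / (x - y) + x / (x - y) = 1 := by field_simp; ring
  have hz : side p q ((-y / (x - y)) • a + (x / (x - y)) • b) = 0 := by
    rw [side_combo hsum, ← hx, ← hy]; field_simp; ring
  obtain ⟨m, hm⟩ := exists_of_side_eq_zero hpq hz
  refine ⟨m, hm ▸ ⟨_, _, ?_, ?_, hsum, rfl⟩, ?_⟩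
  · rcases h with h | h
    · exact div_nonneg (by linarith) (by linarith)
    · exact div_nonneg_of_nonpos (by linarith) (by linarith)
  · rcases h with h | h
    · exact div_nonneg (by linarith) (by linarith)
    · exact div_nonneg_of_nonpos (by linarith) (by linarith)
  · intro s t _ _ hst
    have e1 : (s + t) * (-y / (x - y)) = s := by
      field_simp; linarith
    have e2 : (s + t) * (x / (x - y)) = t := by
      field_simp; linarith
    rw [← hm, smul_add, smul_smul, smul_smul, e1, e2]

theorem meets_iff_of_intersection {a b p q : Plane} (hpq : p ≠ q) {m : ℝ}
    (hm : p + m • (q - p) ∈ segment ℝ a b) (hu : ∀ s t : ℝ, 0 ≤ s → 0 ≤ t →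
      s * side p q a + t * side p q b = 0 → s • a + t • b = (s + t) • (p + m • (q - p))) :
    Meets a b p q ↔ 0 ≤ m ∧ m ≤ 1 := by
  constructor
  · rintro ⟨z, ⟨s, t, hs, ht, hst, rfl⟩, hz⟩
    have h0 := side_eq_zero_of_mem hz
    rw [side_combo hst] at h0
    rw [hu s t hs ht h0, hst, one_smul] at hz
    exact (mem_segment_line_iff hpq m).1 hz
  · exact fun h => ⟨_, hm, (mem_segment_line_iff hpq m).2 h⟩

theorem ind_unit_interval {m : ℝ} (h0 : m ≠ 0) : ind (0 ≤ m ∧ m ≤ 1) = ind (0 < m) + ind (1 < m) := by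
  rw [← ind_xor]
  refine ind_congr ⟨fun h => Or.inl ⟨lt_of_le_of_ne h.1 h0.symm, not_lt.2 h.2⟩, ?_⟩
  rintro (⟨h, h'⟩ | ⟨h, h'⟩)
  · exact ⟨h.le, not_lt.1 h'⟩
  · exact absurd (zero_lt_one.trans h) h'

theorem ind_mem_uIcc {m n r : ℝ} (hm : m ≠ r) (hn : n ≠ r) :
    ind (r ∈ Set.uIcc m n) = ind (r < m) + ind (r < n) := by
  rw [← ind_xor]
  refine ind_congr ?_
  rw [Set.mem_uIcc]
  constructor
  · rintro (⟨h, h'⟩ | ⟨h, h'⟩)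
    · exact Or.inr ⟨lt_of_le_of_ne h' hn.symm, not_lt.2 h⟩
    · exact Or.inl ⟨lt_of_le_of_ne h' hm.symm, not_lt.2 h⟩
  · rintro (⟨h, h'⟩ | ⟨h, h'⟩)
    · exact Or.inr ⟨not_lt.1 h', h.le⟩
    · exact Or.inl ⟨not_lt.1 h', h.le⟩

/-- The line through `p` and `q` cuts the triangle in the interval between its points `m` on `a b`
and `n` on `b c`, where `p` and `q` are at `0` and `1`. Both sides of the equation become the sum of
the truth values of `0 < m`, `1 < m`, `0 < n` and `1 < n`. -/
theorem meets_parity_of_odd {a b c p q : Plane} (hpq : p ≠ q) (gab : General a b p q)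
    (gbc : General b c p q) (gca : General c a p q)
    (h : (side p q b < 0 ∧ 0 ≤ side p q a ∧ 0 ≤ side p q c) ∨
      (0 ≤ side p q b ∧ side p q a < 0 ∧ side p q c < 0)) :
    ind (Meets a b p q) + ind (Meets b c p q) + ind (Meets c a p q) =
      ind (p ∈ convexHull ℝ {a, b, c}) + ind (q ∈ convexHull ℝ {a, b, c}) := by
  obtain ⟨m, hm, um⟩ := exists_intersection (a := a) (b := b) hpq (by tauto)
  obtain ⟨n, hn, un⟩ := exists_intersection (a := b) (b := c) hpq (by tauto)
  have h3 : ¬ Meets c a p q := not_meets_of_same_side hpq gca (by tauto)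
  have key : ∀ r : ℝ, p + r • (q - p) ∈ convexHull ℝ {a, b, c} ↔ r ∈ Set.uIcc m n := by
    intro r
    rw [← line_mem_segment_iff (p := p) (sub_ne_zero.2 hpq.symm)]
    constructor
    · intro hr
      obtain ⟨β, γ, hβ, hγ, hβγ, e⟩ := exists_of_mem_triangle hr
      set α := 1 - β - γ with hα
      have hα0 : 0 ≤ α := by rw [hα]; linarith
      have e' : p + r • (q - p) = α • a + β • b + γ • c := by rw [e, hα]; module
      have hs : α * side p q a + β * side p q b + γ * side p q c = 0 := by
        have h0 := side_line p q r
        rw [e] at h0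
        simp only [side, det, Prod.fst_add, Prod.snd_add, Prod.fst_sub, Prod.snd_sub, Prod.smul_fst,
          Prod.smul_snd, smul_eq_mul] at h0 ⊢
        rw [hα]
        linarith
      -- The weight of `b` is divided so that the part with `a` and the part with `c` balance
      -- separately on the line; these parts are multiples of the two intersection points.
      obtain ⟨β₁, β₂, hβ₁, hβ₂, hββ, s₁, s₂⟩ : ∃ β₁ β₂ : ℝ, 0 ≤ β₁ ∧ 0 ≤ β₂ ∧ β₁ + β₂ = β ∧
          α * side p q a + β₁ * side p q b = 0 ∧ β₂ * side p q b + γ * side p q c = 0 := by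
        by_cases hb : side p q b = 0
        · refine ⟨β, 0, hβ, le_rfl, add_zero _, ?_⟩
          rw [hb] at hs ⊢
          have hac : side p q a < 0 ∧ side p q c < 0 := by
            rcases h with h | h
            · exact absurd hb h.1.ne
            · exact h.2
          have h1 := mul_nonpos_of_nonneg_of_nonpos hα0 hac.1.le
          have h2 := mul_nonpos_of_nonneg_of_nonpos hγ hac.2.le
          constructor <;> linarith
        · refine ⟨-(α * side p q a) / side p q b, -(γ * side p q c) / side p q b, ?_, ?_, ?_, ?_, ?_⟩
          · rcases h with ⟨h, h', -⟩ | ⟨h, h', -⟩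
            · exact div_nonneg_of_nonpos (neg_nonpos.2 (mul_nonneg hα0 h')) h.le
            · exact div_nonneg (neg_nonneg.2 (mul_nonpos_of_nonneg_of_nonpos hα0 h'.le)) h
          · rcases h with ⟨h, -, h'⟩ | ⟨h, -, h'⟩
            · exact div_nonneg_of_nonpos (neg_nonpos.2 (mul_nonneg hγ h')) h.le
            · exact div_nonneg (neg_nonneg.2 (mul_nonpos_of_nonneg_of_nonpos hγ h'.le)) h
          · rw [← add_div, div_eq_iff hb]; linarith
          · rw [div_mul_cancel₀ _ hb]; ring
          · rw [div_mul_cancel₀ _ hb]; ring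
      refine ⟨α + β₁, β₂ + γ, by linarith, by linarith, by rw [hα]; linarith, ?_⟩
      rw [← um _ _ hα0 hβ₁ s₁, ← un _ _ hβ₂ hγ s₂, e', ← hββ]
      module
    · intro hr
      have hc := convex_convexHull ℝ ({a, b, c} : Set Plane)
      have ha : a ∈ convexHull ℝ ({a, b, c} : Set Plane) := subset_convexHull _ _ (by simp)
      have hb : b ∈ convexHull ℝ ({a, b, c} : Set Plane) := subset_convexHull _ _ (by simp)
      have hcc : c ∈ convexHull ℝ ({a, b, c} : Set Plane) := subset_convexHull _ _ (by simp)
      exact hc.segment_subset (hc.segment_subset ha hb hm) (hc.segment_subset hb hcc hn) hr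
  have k0 := key 0
  have k1 := key 1
  rw [zero_smul, add_zero] at k0
  rw [one_smul, add_sub_cancel] at k1
  have m0 : m ≠ 0 := by
    rintro rfl
    rw [zero_smul, add_zero] at hm
    exact gab.left' hm
  have m1 : m ≠ 1 := by
    rintro rfl
    rw [one_smul, add_sub_cancel] at hm
    exact gab.right' hm
  have n0 : n ≠ 0 := by
    rintro rfl
    rw [zero_smul, add_zero] at hn
    exact gbc.left' hn
  have n1 : n ≠ 1 := by
    rintro rfl
    rw [one_smul, add_sub_cancel] at hn
    exact gbc.right' hn
  rw [ind_false h3, ind_congr (meets_iff_of_intersection hpq hm um),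
    ind_congr (meets_iff_of_intersection hpq hn un), ind_congr k0, ind_congr k1,
    ind_unit_interval m0, ind_unit_interval n0, ind_mem_uIcc m0 n0, ind_mem_uIcc m1 n1]
  ring

/-- The weighted sides of the vertices add up to zero without cancellation, so each term vanishes. A
vanishing weight puts `r` on a side of the triangle; otherwise the triangle is degenerate and in the
line, and again `r` lies between two vertices. -/
theorem notMem_triangle_of_same_side {a b c p q r : Plane} (hpq : p ≠ q) (hr : side p q r = 0)
    (hab : r ∉ segment ℝ a b) (hbc : r ∉ segment ℝ b c) (hca : r ∉ segment ℝ c a)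
    (h : (0 ≤ side p q a ∧ 0 ≤ side p q b ∧ 0 ≤ side p q c) ∨
      (side p q a < 0 ∧ side p q b < 0 ∧ side p q c < 0)) : r ∉ convexHull ℝ {a, b, c} := by
  intro hm
  obtain ⟨β, γ, hβ, hγ, hβγ, e⟩ := exists_of_mem_triangle hm
  obtain ⟨α, hα⟩ : ∃ α, α = 1 - β - γ := ⟨_, rfl⟩
  have hα0 : 0 ≤ α := by rw [hα]; linarith
  have e' : r = α • a + β • b + γ • c := by rw [e, hα]; module
  have hs : α * side p q a + β * side p q b + γ * side p q c = 0 := by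
    rw [e] at hr
    simp only [side, det, Prod.fst_add, Prod.snd_add, Prod.fst_sub, Prod.snd_sub, Prod.smul_fst,
      Prod.smul_snd, smul_eq_mul] at hr ⊢
    rw [hα]
    linarith
  rcases h with ⟨ha, hb, hc⟩ | ⟨ha, hb, hc⟩
  · have h1 := mul_nonneg hα0 ha
    have h2 := mul_nonneg hβ hb
    have h3 := mul_nonneg hγ hc
    have h1' : α * side p q a = 0 := by linarith
    have h2' : β * side p q b = 0 := by linarith
    have h3' : γ * side p q c = 0 := by linarith
    rcases mul_eq_zero.1 h1' with rfl | h1'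
    · exact hbc ⟨β, γ, hβ, hγ, by linarith, by rw [e']; module⟩
    rcases mul_eq_zero.1 h2' with rfl | h2'
    · exact hca ⟨γ, α, hγ, hα0, by linarith, by rw [e']; module⟩
    rcases mul_eq_zero.1 h3' with rfl | h3'
    · exact hab ⟨α, β, hα0, hβ, by linarith, by rw [e']; module⟩
    obtain ⟨x, rfl⟩ := exists_of_side_eq_zero hpq h1'
    obtain ⟨y, rfl⟩ := exists_of_side_eq_zero hpq h2'
    obtain ⟨z, rfl⟩ := exists_of_side_eq_zero hpq h3'
    have e'' : r = p + (α * x + β * y + γ * z) • (q - p) := by rw [e', hα]; module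
    rw [e'', line_mem_segment_iff (sub_ne_zero.2 hpq.symm), Set.mem_uIcc] at hab hbc hca
    generalize hw : α * x + β * y + γ * z = w at *
    have hw' : α * (x - w) + β * (y - w) + γ * (z - w) = 0 := by rw [← hw, hα]; ring
    have zero : ∀ {u v : ℝ}, 0 ≤ u → v ≠ 0 → u * v = 0 → u = 0 := fun _ hv h =>
      (mul_eq_zero.1 h).resolve_right hv
    rcases lt_trichotomy x w with hx | hx | hx
    · have hy : y < w := by
        by_contra hy
        exact hab (Or.inl ⟨hx.le, not_lt.1 hy⟩)
      have hz : z < w := by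
        by_contra hz
        exact hca (Or.inr ⟨hx.le, not_lt.1 hz⟩)
      have i1 := mul_nonneg hα0 (sub_pos.2 hx).le
      have i2 := mul_nonneg hβ (sub_pos.2 hy).le
      have i3 := mul_nonneg hγ (sub_pos.2 hz).le
      have j1 := zero hα0 (sub_pos.2 hx).ne' (by linarith)
      have j2 := zero hβ (sub_pos.2 hy).ne' (by linarith)
      have j3 := zero hγ (sub_pos.2 hz).ne' (by linarith)
      linarith
    · exact hab (by rcases le_total w y with h | h <;> [exact Or.inl ⟨hx.le, h⟩; exact Or.inr ⟨h, hx.ge⟩])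
    · have hy : w < y := by
        by_contra hy
        exact hab (Or.inr ⟨not_lt.1 hy, hx.le⟩)
      have hz : w < z := by
        by_contra hz
        exact hca (Or.inl ⟨not_lt.1 hz, hx.le⟩)
      have i1 := mul_nonneg hα0 (sub_pos.2 hx).le
      have i2 := mul_nonneg hβ (sub_pos.2 hy).le
      have i3 := mul_nonneg hγ (sub_pos.2 hz).le
      have j1 := zero hα0 (sub_pos.2 hx).ne' (by linarith)
      have j2 := zero hβ (sub_pos.2 hy).ne' (by linarith)
      have j3 := zero hγ (sub_pos.2 hz).ne' (by linarith)
      linarith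
  · have h1 := mul_nonpos_of_nonneg_of_nonpos hα0 ha.le
    have h2 := mul_nonpos_of_nonneg_of_nonpos hβ hb.le
    have h3 := mul_nonpos_of_nonneg_of_nonpos hγ hc.le
    have h1' : α = 0 := (mul_eq_zero.1 (show α * side p q a = 0 by linarith)).resolve_right ha.ne
    have h2' : β = 0 := (mul_eq_zero.1 (show β * side p q b = 0 by linarith)).resolve_right hb.ne
    have h3' : γ = 0 := (mul_eq_zero.1 (show γ * side p q c = 0 by linarith)).resolve_right hc.ne
    linarith

/-- A segment in general position to the sides of a triangle meets an odd number of them if and only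
if exactly one of its end points lies in the triangle. -/
theorem meets_parity {a b c p q : Plane} (gab : General a b p q)
    (gbc : General b c p q) (gca : General c a p q) :
    ind (Meets a b p q) + ind (Meets b c p q) + ind (Meets c a p q) =
      ind (p ∈ convexHull ℝ {a, b, c}) + ind (q ∈ convexHull ℝ {a, b, c}) := by
  by_cases hpq : p = q
  · subst hpq
    have hM : ∀ {x y : Plane}, General x y p p → ¬ Meets x y p p := by
      rintro x y g ⟨z, hz, hz'⟩
      rw [segment_same, Set.mem_singleton_iff] at hz'
      exact g.left' (hz' ▸ hz)
    rw [ind_false (hM gab), ind_false (hM gbc), ind_false (hM gca), CharTwo.add_self_eq_zero,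
      add_zero, CharTwo.add_self_eq_zero]
  have same : ((0 ≤ side p q a ∧ 0 ≤ side p q b ∧ 0 ≤ side p q c) ∨
      (side p q a < 0 ∧ side p q b < 0 ∧ side p q c < 0)) →
      ind (Meets a b p q) + ind (Meets b c p q) + ind (Meets c a p q) =
      ind (p ∈ convexHull ℝ {a, b, c}) + ind (q ∈ convexHull ℝ {a, b, c}) := by
    intro h
    have hp := notMem_triangle_of_same_side (r := p) hpq
      (side_eq_zero_of_mem (left_mem_segment _ _ _)) gab.left' gbc.left' gca.left' h
    have hq := notMem_triangle_of_same_side (r := q) hpq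
      (side_eq_zero_of_mem (right_mem_segment _ _ _)) gab.right' gbc.right' gca.right' h
    rw [ind_false (not_meets_of_same_side hpq gab (by tauto)),
      ind_false (not_meets_of_same_side hpq gbc (by tauto)),
      ind_false (not_meets_of_same_side hpq gca (by tauto)), ind_false hp, ind_false hq]
    rfl
  -- If the vertices are not all on one side, exactly one of them is alone, and a cyclic permutation
  -- moves it to the middle.
  have e1 : ({b, c, a} : Set Plane) = {a, b, c} := by ext; simp; tauto
  have e2 : ({c, a, b} : Set Plane) = {a, b, c} := by ext; simp; tauto
  have ha := lt_or_ge (side p q a) 0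
  have hb := lt_or_ge (side p q b) 0
  have hc := lt_or_ge (side p q c) 0
  have odd_b := meets_parity_of_odd hpq gab gbc gca
  have odd_c := meets_parity_of_odd hpq gbc gca gab
  have odd_a := meets_parity_of_odd hpq gca gab gbc
  rw [e1] at odd_c
  rw [e2] at odd_a
  rcases ha with ha | ha <;> rcases hb with hb | hb <;> rcases hc with hc | hc
  · exact same (Or.inr ⟨ha, hb, hc⟩)
  · rw [← odd_c (Or.inr ⟨hc, hb, ha⟩)]; ring
  · exact odd_b (Or.inr ⟨hb, ha, hc⟩)
  · rw [← odd_a (Or.inl ⟨ha, hc, hb⟩)]; ring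
  · rw [← odd_a (Or.inr ⟨ha, hc, hb⟩)]; ring
  · exact odd_b (Or.inl ⟨hb, ha, hc⟩)
  · rw [← odd_c (Or.inl ⟨hc, hb, ha⟩)]; ring
  · exact same (Or.inl ⟨ha, hb, hc⟩)

end RegionCrossing

/-! ### Crossing parity in space under triangle moves -/

namespace RegionCrossing

/-- The projections of two segments meet, and there the heights are related by `R`. -/
def Crosses (R : ℝ → ℝ → Prop) (a b p q : Space) : Prop :=
  ∃ x ∈ segment ℝ a b, ∃ y ∈ segment ℝ p q, x.1 = y.1 ∧ R x.2 y.2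

theorem crosses_comm (R : ℝ → ℝ → Prop) (a b p q : Space) :
    Crosses R a b p q ↔ Crosses R b a p q := by
  rw [Crosses, segment_symm]; rfl

theorem crosses_swap (a b p q : Space) : Crosses (· > ·) a b p q ↔ Crosses (· < ·) p q a b := by
  constructor <;> rintro ⟨x, hx, y, hy, h, h'⟩ <;> exact ⟨y, hy, x, hx, h.symm, h'⟩

theorem fst_mem_segment {a b x : Space} (h : x ∈ segment ℝ a b) : x.1 ∈ segment ℝ a.1 b.1 := by
  obtain ⟨s, t, hs, ht, hst, rfl⟩ := h
  exact ⟨s, t, hs, ht, hst, rfl⟩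

theorem exists_of_mem_segment_fst {a b : Space} {z : Plane} (h : z ∈ segment ℝ a.1 b.1) :
    ∃ x ∈ segment ℝ a b, x.1 = z := by
  obtain ⟨s, t, hs, ht, hst, rfl⟩ := h
  exact ⟨_, ⟨s, t, hs, ht, hst, rfl⟩, rfl⟩

theorem exists_mem_convexHull_fst_iff {a b c : Space} {z : Plane} :
    (∃ x ∈ convexHull ℝ {a, b, c}, x.1 = z) ↔ z ∈ convexHull ℝ {a.1, b.1, c.1} := by
  have h := (LinearMap.fst ℝ Plane ℝ).image_convexHull {a, b, c}
  rw [Set.image_insert_eq, Set.image_insert_eq, Set.image_singleton] at h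
  change _ = convexHull ℝ {a.1, b.1, c.1} at h
  rw [← h]
  rfl

/-- Disjoint compact convex sets lie on top of each other in only one way. -/
theorem above_or_below {S T : Set Space} (hS : Convex ℝ S) (hS' : IsCompact S) (hT : Convex ℝ T)
    (hT' : IsCompact T) (hd : Disjoint S T) :
    (∀ x ∈ S, ∀ y ∈ T, x.1 = y.1 → x.2 < y.2) ∨ (∀ x ∈ S, ∀ y ∈ T, x.1 = y.1 → y.2 < x.2) := by
  obtain ⟨f, u, v, hu, huv, hv⟩ := geometric_hahn_banach_compact_closed hS hS' hT hT'.isClosed hd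
  -- For points over each other `f y - f x` is the height difference times `f (0, 1)`; as `f`
  -- separates strictly, the sign of the difference is always that of `f (0, 1)`.
  have key : ∀ x ∈ S, ∀ y ∈ T, x.1 = y.1 → 0 < (y.2 - x.2) * f (0, 1) := by
    intro x hx y hy h
    have h1 : y - x = (y.2 - x.2) • ((0, 1) : Space) := by
      ext <;> simp [h]
    have h2 : f y - f x = (y.2 - x.2) * f (0, 1) := by
      rw [← map_sub, h1, map_smul, smul_eq_mul]
    rw [← h2]
    linarith [hu x hx, hv y hy]
  rcases le_total 0 (f (0, 1)) with h0 | h0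
  · left
    intro x hx y hy h
    have := key x hx y hy h
    by_contra hxy
    have := mul_nonpos_of_nonpos_of_nonneg (sub_nonpos.2 (not_lt.1 hxy)) h0
    linarith
  · right
    intro x hx y hy h
    have := key x hx y hy h
    by_contra hxy
    have := mul_nonpos_of_nonneg_of_nonpos (sub_nonneg.2 (not_lt.1 hxy)) h0
    linarith

/-- A segment disjoint from a triangle crosses an odd number of its sides in a given way if and only
if this is so for one of its end points with respect to the triangle. -/
theorem crosses_parity {R : ℝ → ℝ → Prop} (hR : R = (· < ·) ∨ R = (· > ·)) {a b c p q : Space}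
    (gab : General a.1 b.1 p.1 q.1) (gbc : General b.1 c.1 p.1 q.1) (gca : General c.1 a.1 p.1 q.1)
    (hd : Disjoint (convexHull ℝ {a, b, c}) (segment ℝ p q)) :
    ind (Crosses R a b p q) + ind (Crosses R b c p q) + ind (Crosses R c a p q) =
      ind (∃ x ∈ convexHull ℝ {a, b, c}, x.1 = p.1 ∧ R x.2 p.2) +
        ind (∃ x ∈ convexHull ℝ {a, b, c}, x.1 = q.1 ∧ R x.2 q.2) := by
  have ha : a ∈ convexHull ℝ ({a, b, c} : Set Space) := subset_convexHull _ _ (by simp)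
  have hb : b ∈ convexHull ℝ ({a, b, c} : Set Space) := subset_convexHull _ _ (by simp)
  have hc : c ∈ convexHull ℝ ({a, b, c} : Set Space) := subset_convexHull _ _ (by simp)
  have hp := left_mem_segment ℝ p q
  have hq := right_mem_segment ℝ p q
  have hconv := convex_convexHull ℝ ({a, b, c} : Set Space)
  have sab := hconv.segment_subset ha hb
  have sbc := hconv.segment_subset hb hc
  have sca := hconv.segment_subset hc ha
  -- Either `R` holds at all places where the segment lies over or under the triangle, and the
  -- planar parity statement applies, or it holds at none, and all terms vanish.
  have hsep : (∀ x ∈ convexHull ℝ {a, b, c}, ∀ y ∈ segment ℝ p q, x.1 = y.1 → R x.2 y.2) ∨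
      (∀ x ∈ convexHull ℝ {a, b, c}, ∀ y ∈ segment ℝ p q, x.1 = y.1 → ¬ R x.2 y.2) := by
    have h := above_or_below hconv ((Set.toFinite {a, b, c}).isCompact_convexHull ℝ)
      (convex_segment p q) (by
        rw [← convexHull_pair]; exact (Set.toFinite {p, q}).isCompact_convexHull ℝ) hd
    rcases hR with rfl | rfl <;> rcases h with h | h
    · exact Or.inl h
    · exact Or.inr fun x hx y hy hxy => (h x hx y hy hxy).le.not_gt
    · exact Or.inr fun x hx y hy hxy => (h x hx y hy hxy).le.not_gt
    · exact Or.inl h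
  generalize hΔ : convexHull ℝ {a, b, c} = Δ at *
  rcases hsep with h | h
  · have e : ∀ {a b : Space}, segment ℝ a b ⊆ Δ →
        (Crosses R a b p q ↔ Meets a.1 b.1 p.1 q.1) := by
      intro a b hab
      constructor
      · rintro ⟨x, hx, y, hy, hxy, -⟩
        exact ⟨x.1, fst_mem_segment hx, hxy ▸ fst_mem_segment hy⟩
      · rintro ⟨z, hz, hz'⟩
        obtain ⟨x, hx, rfl⟩ := exists_of_mem_segment_fst hz
        obtain ⟨y, hy, hxy⟩ := exists_of_mem_segment_fst hz'
        exact ⟨x, hx, y, hy, hxy.symm, h x (hab hx) y hy hxy.symm⟩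
    have e' : ∀ {p' : Space}, p' ∈ segment ℝ p q → ((∃ x ∈ Δ, x.1 = p'.1 ∧ R x.2 p'.2) ↔
        p'.1 ∈ convexHull ℝ {a.1, b.1, c.1}) := by
      intro p' hp'
      rw [← exists_mem_convexHull_fst_iff, hΔ]
      constructor
      · rintro ⟨x, hx, hxp, -⟩
        exact ⟨x, hx, hxp⟩
      · rintro ⟨x, hx, hxp⟩
        exact ⟨x, hx, hxp, h x hx p' hp' hxp⟩
    rw [ind_congr (e sab), ind_congr (e sbc), ind_congr (e sca), ind_congr (e' hp),
      ind_congr (e' hq)]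
    exact meets_parity gab gbc gca
  · have e : ∀ {a b : Space}, segment ℝ a b ⊆ Δ → ¬ Crosses R a b p q := by
      rintro a b hab ⟨x, hx, y, hy, hxy, hr⟩
      exact h x (hab hx) y hy hxy hr
    have e' : ∀ {p' : Space}, p' ∈ segment ℝ p q → ¬ ∃ x ∈ Δ, x.1 = p'.1 ∧ R x.2 p'.2 := by
      rintro p' hp' ⟨x, hx, hxp, hr⟩
      exact h x hx p' hp' hxp hr
    rw [ind_false (e sab), ind_false (e sbc), ind_false (e sca), ind_false (e' hp),
      ind_false (e' hq)]
    rfl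

/-- The number of crossings of two closed polygons modulo two, counting those in which the heights
are related by `R`. -/
noncomputable def crossParity (R : ℝ → ℝ → Prop) (P P' : ClosedPolygon Space) : ZMod 2 :=
  ∑ i, ∑ j, ind (Crosses R (P.vertex i) (P.vertex (i + 1)) (P'.vertex j) (P'.vertex (j + 1)))

/-- The projections of two polygons are in general position to each other. -/
def GeneralPair (P P' : ClosedPolygon Space) : Prop :=
  ∀ i j, General (P.vertex i).1 (P.vertex (i + 1)).1 (P'.vertex j).1 (P'.vertex (j + 1)).1

theorem General.comm {V : Type*} [AddCommGroup V] [Module ℝ V] {a b p q : V}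
    (h : General a b p q) : General b a p q :=
  ⟨h.right, h.left, by rw [segment_symm]; exact h.left', by rw [segment_symm]; exact h.right'⟩

theorem crossParity_swap (P P' : ClosedPolygon Space) :
    crossParity (· > ·) P P' = crossParity (· < ·) P' P := by
  rw [crossParity, Finset.sum_comm]
  exact Finset.sum_congr rfl fun j _ => Finset.sum_congr rfl fun i _ => ind_congr (crosses_swap _ _ _ _)

/-- The crossings of a closed polygon with the boundary of a disjoint triangle. -/
theorem crossParity_triangle {R : ℝ → ℝ → Prop} (hR : R = (· < ·) ∨ R = (· > ·)) {a b c : Space}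
    (P : ClosedPolygon Space)
    (gab : ∀ j, General a.1 b.1 (P.vertex j).1 (P.vertex (j + 1)).1)
    (gbc : ∀ j, General b.1 c.1 (P.vertex j).1 (P.vertex (j + 1)).1)
    (gca : ∀ j, General c.1 a.1 (P.vertex j).1 (P.vertex (j + 1)).1)
    (hd : ∀ j, Disjoint (convexHull ℝ {a, b, c}) (segment ℝ (P.vertex j) (P.vertex (j + 1)))) :
    ∑ j, ind (Crosses R a b (P.vertex j) (P.vertex (j + 1))) +
      ∑ j, ind (Crosses R b c (P.vertex j) (P.vertex (j + 1))) +
      ∑ j, ind (Crosses R c a (P.vertex j) (P.vertex (j + 1))) = 0 := by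
  rw [← Finset.sum_add_distrib, ← Finset.sum_add_distrib,
    Finset.sum_congr rfl fun j _ => crosses_parity hR (gab j) (gbc j) (gca j) (hd j),
    Finset.sum_add_distrib]
  -- Every vertex of the closed polygon is an end point of two edges, so the end point terms cancel.
  have := Equiv.sum_comp (Equiv.addRight (1 : ZMod P.n)) fun j =>
    ind (∃ x ∈ convexHull ℝ {a, b, c}, x.1 = (P.vertex j).1 ∧ R x.2 (P.vertex j).2)
  simp only [Equiv.coe_addRight] at this
  rw [this, CharTwo.add_self_eq_zero]

/-- Sums over the edges of a polygon and of one with an additional vertex. -/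
theorem sum_edges_insert {V M : Type*} [AddCommMonoid M] {n n' : ℕ} [NeZero n] [NeZero n']
    {v : ZMod n → V} {v' : ZMod n' → V} (hn : n' = n + 1) (s : ZMod n) (r : ZMod n')
    (h : ∀ i : ℕ, i < n → v' (r + i) = v (s + i)) (F : V → V → M) :
    ∑ i, F (v' i) (v' (i + 1)) + F (v (s - 1)) (v s) =
      ∑ i, F (v i) (v (i + 1)) + (F (v (s - 1)) (v' (r - 1)) + F (v' (r - 1)) (v s)) := by
  have hpos := NeZero.pos n
  obtain ⟨m, rfl⟩ : ∃ m, n = m + 1 := ⟨n - 1, by omega⟩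
  subst hn
  have e1 := Equiv.sum_comp (Equiv.addLeft r) fun i => F (v' i) (v' (i + 1))
  have e2 := Equiv.sum_comp (Equiv.addLeft s) fun i => F (v i) (v (i + 1))
  simp only [Equiv.coe_addLeft] at e1 e2
  rw [← e1, ← e2, sum_zmod, sum_zmod, Finset.sum_range_succ, Finset.sum_range_succ,
    Finset.sum_range_succ]
  have c1 : ((m + 1 : ℕ) : ZMod (m + 1 + 1)) = -1 := by
    have := ZMod.natCast_self (m + 1 + 1)
    rw [Nat.cast_succ] at this
    exact eq_neg_of_add_eq_zero_left this
  have c2 : ((m : ℕ) : ZMod (m + 1)) = -1 := by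
    have := ZMod.natCast_self (m + 1)
    rw [Nat.cast_succ] at this
    exact eq_neg_of_add_eq_zero_left this
  have h0 := h 0 (by omega)
  rw [Nat.cast_zero, Nat.cast_zero, add_zero, add_zero] at h0
  have hm := h m (by omega)
  have hm1 : r + (m : ZMod (m + 1 + 1)) + 1 = r - 1 := by
    have c1' := c1
    push_cast at c1'
    linear_combination c1'
  rw [hm, hm1, c1, c2, ← sub_eq_add_neg, ← sub_eq_add_neg, sub_add_cancel, sub_add_cancel, h0]
  have hsum : ∑ i ∈ Finset.range m, F (v' (r + i)) (v' (r + i + 1)) =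
      ∑ i ∈ Finset.range m, F (v (s + i)) (v (s + i + 1)) := by
    refine Finset.sum_congr rfl fun i hi => ?_
    have hi' := Finset.mem_range.1 hi
    have k := h (i + 1) (by omega)
    rw [Nat.cast_succ, Nat.cast_succ, ← add_assoc, ← add_assoc] at k
    rw [h i (by omega), k]
  rw [hsum]
  abel

/-- The two polygons differ by the boundary of the triangle, which crosses the other polygon evenly
by `crossParity_triangle`. -/
theorem crossParity_triangleMove {R : ℝ → ℝ → Prop} (hR : R = (· < ·) ∨ R = (· > ·))
    {P P₁ P' : ClosedPolygon Space} (hn : P₁.n = P.n + 1) (s : ZMod P.n) (r : ZMod P₁.n)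
    (h : ∀ i : ℕ, i < P.n → P₁.vertex (r + i) = P.vertex (s + i)) (g : GeneralPair P P')
    (g₁ : GeneralPair P₁ P')
    (hd : ∀ j, Disjoint (convexHull ℝ {P.vertex (s - 1), P₁.vertex (r - 1), P.vertex s})
      (segment ℝ (P'.vertex j) (P'.vertex (j + 1)))) :
    crossParity R P₁ P' = crossParity R P P' := by
  have h1 := sum_edges_insert hn s r h fun a b =>
    ∑ j, ind (Crosses R a b (P'.vertex j) (P'.vertex (j + 1)))
  have hpos := NeZero.pos P.n
  have hr : P₁.vertex r = P.vertex s := by simpa using h 0 hpos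
  have hrs : P₁.vertex (r - 1 - 1) = P.vertex (s - 1) := by
    have h2 := h (P.n - 1) (by omega)
    have c1 : ((P.n - 1 : ℕ) : ZMod P₁.n) = -1 - 1 := by
      have h3 := ZMod.natCast_self P₁.n
      have h4 : P₁.n = P.n - 1 + 1 + 1 := by omega
      have h5 : ((P.n - 1 + 1 + 1 : ℕ) : ZMod P₁.n) = 0 := by rw [← h4]; exact h3
      push_cast at h5
      linear_combination h5
    have c2 : ((P.n - 1 : ℕ) : ZMod P.n) = -1 := by
      have h3 := ZMod.natCast_self P.n
      have h4 : P.n = P.n - 1 + 1 := by omega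
      have h5 : ((P.n - 1 + 1 : ℕ) : ZMod P.n) = 0 := by rw [← h4]; exact h3
      push_cast at h5
      linear_combination h5
    rw [c1, c2] at h2
    convert h2 using 2 <;> ring
  have gab : ∀ j, General (P.vertex (s - 1)).1 (P₁.vertex (r - 1)).1 (P'.vertex j).1
      (P'.vertex (j + 1)).1 := fun j => by
    have := g₁ (r - 1 - 1) j
    rwa [sub_add_cancel, hrs] at this
  have gbc : ∀ j, General (P₁.vertex (r - 1)).1 (P.vertex s).1 (P'.vertex j).1
      (P'.vertex (j + 1)).1 := fun j => by
    have := g₁ (r - 1) j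
    rwa [sub_add_cancel, hr] at this
  have gca : ∀ j, General (P.vertex s).1 (P.vertex (s - 1)).1 (P'.vertex j).1
      (P'.vertex (j + 1)).1 := fun j => by
    have := g (s - 1) j
    rw [sub_add_cancel] at this
    exact this.comm
  have h2 := crossParity_triangle hR P' gab gbc gca hd
  have h3 : ∑ j, ind (Crosses R (P.vertex s) (P.vertex (s - 1)) (P'.vertex j) (P'.vertex (j + 1))) =
      ∑ j, ind (Crosses R (P.vertex (s - 1)) (P.vertex s) (P'.vertex j) (P'.vertex (j + 1))) :=
    Finset.sum_congr rfl fun j _ => ind_congr (crosses_comm _ _ _ _ _)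
  rw [h3] at h2
  have h4 := eq_neg_of_add_eq_zero_left h2
  rw [CharTwo.neg_eq] at h4
  rw [h4] at h1
  exact add_right_cancel h1

/-- A triangle does not cross a disjoint polygon. -/
theorem crossParity_of_three {R : ℝ → ℝ → Prop} (hR : R = (· < ·) ∨ R = (· > ·))
    {P P' : ClosedPolygon Space} (hn : P.n = 3) (g : GeneralPair P P')
    (hd : ∀ j, Disjoint (convexHull ℝ (Set.range P.vertex))
      (segment ℝ (P'.vertex j) (P'.vertex (j + 1)))) : crossParity R P P' = 0 := by
  obtain ⟨n, _, v⟩ := P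
  dsimp only at hn
  subst hn
  have g0 := fun j => g 0 j
  have g1 := fun j => g 1 j
  have g2 := fun j => g 2 j
  have h3 : (2 : ZMod 3) + 1 = 0 := by decide
  have h2 : (1 : ZMod 3) + 1 = 2 := by decide
  simp only [h3, h2, zero_add] at g0 g1 g2
  have := crossParity_triangle hR P' g0 g1 g2 fun j => (hd j).mono_left (convexHull_mono (by
    rintro x (rfl | rfl | rfl) <;> exact ⟨_, rfl⟩))
  rw [crossParity, sum_zmod, Finset.sum_range_succ, Finset.sum_range_succ, Finset.sum_range_one]
  simpa only [Nat.cast_zero, Nat.cast_one, Nat.cast_ofNat, h3, h2, zero_add] using this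

end RegionCrossing

/-! ### Generic projections and invariance for links in space -/

namespace RegionCrossing

/-- A shear along the projecting direction. -/
def shear (ε : ℝ) : Space →ₗ[ℝ] Space where
  toFun x := (x.1 - x.2 • (ε, ε ^ 2), x.2)
  map_add' x y := by
    ext <;> simp <;> ring
  map_smul' r x := by
    ext <;> simp <;> ring

theorem shear_apply (ε : ℝ) (x : Space) : shear ε x = (x.1 - x.2 • (ε, ε ^ 2), x.2) := rfl

theorem shear_injective (ε : ℝ) : Function.Injective (shear ε) := by
  intro x y h
  rw [shear_apply, shear_apply] at h
  have h2 : x.2 = y.2 := (Prod.ext_iff.1 h).2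
  have h1 := (Prod.ext_iff.1 h).1
  dsimp only at h1
  rw [h2] at h1
  exact Prod.ext (sub_left_injective h1) h2

/-- A nonzero functional does not vanish along the moment curve close to the origin. -/
theorem eventually_functional_ne_zero {f : Space →ₗ[ℝ] ℝ} (hf : f ≠ 0) :
    ∀ᶠ ε : ℝ in 𝓝[≠] 0, f ((ε, ε ^ 2), 1) ≠ 0 := by
  set A := f ((1, 0), 0) with hA
  set B := f ((0, 1), 0) with hB
  set C := f ((0, 0), 1) with hC
  have key : ∀ x y z : ℝ, f ((x, y), z) = x * A + y * B + z * C := by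
    intro x y z
    have : (((x, y), z) : Space) = x • ((1, 0), 0) + y • ((0, 1), 0) + z • ((0, 0), 1) := by
      ext <;> simp
    rw [this, map_add, map_add, map_smul, map_smul, map_smul]
    rfl
  -- On the moment curve the functional is a polynomial whose coefficients are its values on the
  -- basis, hence a nonzero polynomial with finitely many roots.
  let P : Polynomial ℝ := .C C + .C A * .X + .C B * .X ^ 2
  have hP : P ≠ 0 := by
    intro h
    have h0 := congrArg (Polynomial.coeff · 0) h
    have h1 := congrArg (Polynomial.coeff · 1) h
    have h2 := congrArg (Polynomial.coeff · 2) h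
    simp [P, Polynomial.coeff_X] at h0 h1 h2
    refine hf (LinearMap.ext fun ⟨⟨x, y⟩, z⟩ => ?_)
    rw [key, h0, h1, h2]
    simp
  have hfin := (Polynomial.finite_setOfPred_isRoot hP).compl_mem_cofinite
  filter_upwards [nhdsNE_le_cofinite (a := (0 : ℝ)) hfin] with ε hε h
  refine hε ?_
  rw [key] at h
  change Polynomial.eval ε P = 0
  simp [P]
  linarith

/-- The first coordinate after the shear is a projection along `((ε, ε ^ 2), 1)`. If it puts `a` on
the segment, then a combination of `p - a` and `q - a` is a multiple of this direction. A functional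
vanishing on both vectors but not on the direction makes that multiple zero, so `a` was on the
segment already. -/
theorem eventually_shear_notMem {a p q : Space} (h : a ∉ segment ℝ p q) :
    ∀ᶠ ε : ℝ in 𝓝[≠] 0, (shear ε a).1 ∉ segment ℝ (shear ε p).1 (shear ε q).1 := by
  set S := Submodule.span ℝ ({p - a, q - a} : Set Space) with hS
  have hlt : S < ⊤ := by
    refine lt_top_iff_ne_top.2 fun htop => ?_
    have h1 : Module.finrank ℝ S ≤ 2 := by
      have := finrank_span_finset_le_card (R := ℝ) ({p - a, q - a} : Finset Space)
      rw [Finset.coe_pair] at this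
      exact this.trans Finset.card_le_two
    rw [htop, finrank_top] at h1
    simp [Module.finrank_prod] at h1
  obtain ⟨f, hf, hle⟩ := Submodule.exists_le_ker_of_lt_top S hlt
  have fp : f (p - a) = 0 := hle (Submodule.subset_span (by simp))
  have fq : f (q - a) = 0 := hle (Submodule.subset_span (by simp))
  filter_upwards [eventually_functional_ne_zero hf] with ε hε hmem
  obtain ⟨s, t, hs, ht, hst, e⟩ := hmem
  obtain ⟨z, hz⟩ : ∃ z : Space, z = s • (p - a) + t • (q - a) := ⟨_, rfl⟩
  have fz : f z = 0 := by rw [hz, map_add, map_smul, map_smul, fp, fq]; simp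
  have hz1 : z.1 = z.2 • (ε, ε ^ 2) := by
    rw [hz]
    obtain rfl : s = 1 - t := by linarith
    simp only [shear_apply] at e
    simp only [Prod.fst_add, Prod.smul_fst, Prod.fst_sub, Prod.snd_add, Prod.smul_snd,
      Prod.snd_sub, smul_eq_mul]
    linear_combination (norm := module) e
  have hz2 : z = z.2 • ((ε, ε ^ 2), (1 : ℝ)) := by
    refine Prod.ext hz1 ?_
    simp
  rw [hz2, map_smul, smul_eq_mul] at fz
  have hz3 : z.2 = 0 := (mul_eq_zero.1 fz).resolve_right hε
  rw [hz3, zero_smul, hz] at hz2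
  refine h ⟨s, t, hs, ht, hst, ?_⟩
  obtain rfl : s = 1 - t := by linarith
  linear_combination (norm := module) hz2

theorem eventually_general {a b p q : Space} (h : General a b p q) :
    ∀ᶠ ε : ℝ in 𝓝[≠] 0,
      General (shear ε a).1 (shear ε b).1 (shear ε p).1 (shear ε q).1 := by
  filter_upwards [eventually_shear_notMem h.left, eventually_shear_notMem h.right,
    eventually_shear_notMem h.left', eventually_shear_notMem h.right'] with ε h1 h2 h3 h4
  exact ⟨h1, h2, h3, h4⟩

/-- The image of a polygon under a shear. -/
def shearPolygon (ε : ℝ) (P : ClosedPolygon Space) : ClosedPolygon Space :=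
  ⟨P.n, P.neZero, fun i => shear ε (P.vertex i)⟩

namespace PolygonalLink

variable {L L' : PolygonalLink}

theorem edges_disjoint (L : PolygonalLink) {k l : Fin 2} (hkl : k ≠ l) (i : ZMod (L.comp k).n)
    (j : ZMod (L.comp l).n) : Disjoint (segment ℝ ((L.comp k).vertex i) ((L.comp k).vertex (i + 1)))
      (segment ℝ ((L.comp l).vertex j) ((L.comp l).vertex (j + 1))) := by
  refine Set.disjoint_left.2 fun x hx hy => hkl ?_
  obtain ⟨p, hp, hp'⟩ :=
    PolygonPair.exists_param_of_mem_edgeSet L.toPolygonPair (e := ⟨k, i⟩) hx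
  obtain ⟨q, hq, hq'⟩ :=
    PolygonPair.exists_param_of_mem_edgeSet L.toPolygonPair (e := ⟨l, j⟩) hy
  have hpk : p.1 = k := by
    rcases hp' with h | ⟨h, -⟩ <;> exact congrArg Sigma.fst h
  have hql : q.1 = l := by
    rcases hq' with h | ⟨h, -⟩ <;> exact congrArg Sigma.fst h
  rw [← hpk, ← hql, L.injective (hp.trans hq.symm)]

theorem edges_general (L : PolygonalLink) {k l : Fin 2} (hkl : k ≠ l) (i : ZMod (L.comp k).n)
    (j : ZMod (L.comp l).n) : General ((L.comp k).vertex i) ((L.comp k).vertex (i + 1))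
      ((L.comp l).vertex j) ((L.comp l).vertex (j + 1)) := by
  have h := Set.disjoint_left.1 (L.edges_disjoint hkl i j)
  exact ⟨h (left_mem_segment _ _ _), h (right_mem_segment _ _ _),
    fun h' => h h' (left_mem_segment _ _ _), fun h' => h h' (right_mem_segment _ _ _)⟩

theorem eventually_generalPair (L : PolygonalLink) {k l : Fin 2} (hkl : k ≠ l) :
    ∀ᶠ ε : ℝ in 𝓝[≠] 0, GeneralPair (shearPolygon ε (L.comp k)) (shearPolygon ε (L.comp l)) :=
  eventually_all.2 fun (i : ZMod (L.comp k).n) => eventually_all.2 fun (j : ZMod (L.comp l).n) =>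
    eventually_general (L.edges_general hkl i j)

/-- The parity of the number of crossings at which the first component is above, in a slightly
sheared projection. -/
noncomputable def parity (ε : ℝ) (L : PolygonalLink) : ZMod 2 :=
  crossParity (· > ·) (shearPolygon ε (L.comp 0)) (shearPolygon ε (L.comp 1))

theorem shear_disjoint (ε : ℝ) {a b c p q : Space}
    (h : Disjoint (convexHull ℝ {a, b, c}) (segment ℝ p q)) :
    Disjoint (convexHull ℝ {shear ε a, shear ε b, shear ε c})
      (segment ℝ (shear ε p) (shear ε q)) := by
  have h1 := (shear ε).image_convexHull {a, b, c}
  have h2 := (shear ε).image_convexHull {p, q}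
  rw [Set.image_insert_eq, Set.image_insert_eq, Set.image_singleton] at h1
  rw [Set.image_insert_eq, Set.image_singleton, convexHull_pair, convexHull_pair] at h2
  rw [← h1, ← h2]
  exact (Set.disjoint_image_iff (shear_injective ε)).2 h

theorem eventually_crossParity_eq {k l : Fin 2} (hlk : l ≠ k) {R : ℝ → ℝ → Prop}
    (hR : R = (· < ·) ∨ R = (· > ·)) (hl : L'.comp l = L.comp l)
    (hn : (L'.comp k).n = (L.comp k).n + 1) (s : ZMod (L.comp k).n) (r : ZMod (L'.comp k).n)
    (h : ∀ i : ℕ, i < (L.comp k).n → (L'.comp k).vertex (r + i) = (L.comp k).vertex (s + i))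
    (hΔ : convexHull ℝ
        {(L.comp k).vertex (s - 1), (L'.comp k).vertex (r - 1), (L.comp k).vertex s} ∩ L.support
        ⊆ segment ℝ ((L.comp k).vertex (s - 1)) ((L.comp k).vertex s)) :
    ∀ᶠ ε : ℝ in 𝓝[≠] 0,
      crossParity R (shearPolygon ε (L'.comp k)) (shearPolygon ε (L'.comp l)) =
        crossParity R (shearPolygon ε (L.comp k)) (shearPolygon ε (L.comp l)) := by
  filter_upwards [L.eventually_generalPair hlk.symm, L'.eventually_generalPair hlk.symm]
    with ε g g'
  rw [hl] at g' ⊢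
  refine crossParity_triangleMove hR (P := shearPolygon ε (L.comp k))
    (P₁ := shearPolygon ε (L'.comp k)) hn s r (fun i hi => congrArg (shear ε) (h i hi)) g g' ?_
  intro j
  refine shear_disjoint ε (Set.disjoint_left.2 fun x hx hy => ?_)
  have hd := Set.disjoint_left.1 (L.edges_disjoint hlk.symm (s - 1) j)
  rw [sub_add_cancel] at hd
  exact hd (hΔ ⟨hx, PolygonPair.edgeSet_subset L.toPolygonPair ⟨l, j⟩ hy⟩) hy

theorem TriangleMove.eventually_parity_eq (h : TriangleMove L L') :
    ∀ᶠ ε : ℝ in 𝓝[≠] 0, L'.parity ε = L.parity ε := by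
  obtain ⟨k, hk, hn, s, r, hv, hΔ⟩ := h
  have hk' : k = 0 ∨ k = 1 := by omega
  rcases hk' with rfl | rfl
  · exact eventually_crossParity_eq (by simp) (Or.inr rfl) (hk 1 (by simp)) hn s r hv hΔ
  -- When component `1` moves, the roles of the components are exchanged, and the relation of
  -- heights is reversed.
  · filter_upwards [eventually_crossParity_eq (by simp) (Or.inl rfl) (hk 0 (by simp)) hn s r hv hΔ]
      with ε hε
    rw [parity, parity, crossParity_swap, crossParity_swap, hε]

/-- The admissible shears depend on the move, but finitely many moves have some in common. -/
theorem Equivalent.eventually_parity_eq (h : Equivalent L L') :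
    ∀ᶠ ε : ℝ in 𝓝[≠] 0, L'.parity ε = L.parity ε := by
  induction h with
  | rel _ _ h => exact h.eventually_parity_eq
  | refl => exact Eventually.of_forall fun _ => rfl
  | symm _ _ _ ih => exact ih.mono fun _ h => h.symm
  | trans _ _ _ _ _ ih ih' => exact (ih.and ih').mono fun _ h => h.2.trans h.1

/-- In the standard link the flat disk bounded by component `0` is disjoint from component `1`, and
a triangle with disjoint disk crosses evenly. -/
theorem IsTrivial.eventually_parity_eq_zero (h : L.IsTrivial) :
    ∀ᶠ ε : ℝ in 𝓝[≠] 0, L.parity ε = 0 := by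
  obtain ⟨L₀, h, hn, hd⟩ := h
  filter_upwards [h.eventually_parity_eq, L₀.eventually_generalPair (show (0 : Fin 2) ≠ 1 by simp)]
    with ε h1 g
  rw [← h1, parity]
  refine crossParity_of_three (Or.inr rfl) (hn 0) g fun j => ?_
  have h1 := (shear ε).image_convexHull (Set.range (L₀.comp 0).vertex)
  have h2 := (shear ε).image_convexHull (Set.range (L₀.comp 1).vertex)
  rw [← Set.range_comp] at h1 h2
  have h3 := (Set.disjoint_image_iff (shear_injective ε)).2 hd
  rw [h1, h2] at h3
  refine h3.mono_right ((convex_convexHull ℝ _).segment_subset ?_ ?_) <;>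
    exact subset_convexHull ℝ _ ⟨_, rfl⟩

end PolygonalLink

end RegionCrossing

/-! ### The parity of a diagram as that of a small shear, and necessity -/

namespace RegionCrossing

/-- The time on the first of two segments at which their projections cross. -/
noncomputable def crossTime (a b p q : Space) : ℝ :=
  det (p.1 - a.1) (q.1 - p.1) / det (b.1 - a.1) (q.1 - p.1)

/-- The time on the second of two segments at which their projections cross. -/
noncomputable def crossTime' (a b p q : Space) : ℝ :=
  -(det (b.1 - a.1) (p.1 - a.1) / det (b.1 - a.1) (q.1 - p.1))

/-- The height of the first segment above the second one where their projections cross. -/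
noncomputable def crossHeight (a b p q : Space) : ℝ :=
  (a.2 + crossTime a b p q * (b.2 - a.2)) - (p.2 + crossTime' a b p q * (q.2 - p.2))

/-- Cramer's rule for the intersection of two lines; the explicit formulas are used for their
continuity under a shear. -/
theorem eq_iff_crossTime {a b p q : Space} (hd : det (b.1 - a.1) (q.1 - p.1) ≠ 0) (s t : ℝ) :
    a.1 + s • (b.1 - a.1) = p.1 + t • (q.1 - p.1) ↔
      s = crossTime a b p q ∧ t = crossTime' a b p q := by
  have e := eq_coord hd (p.1 - a.1)
  have e' : p.1 - a.1 = crossTime a b p q • (b.1 - a.1) + (-crossTime' a b p q) • (q.1 - p.1) := by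
    rw [crossTime', neg_neg]; exact e
  constructor
  · intro h
    have := coord_unique hd (s := s) (t := -t) (s' := crossTime a b p q)
      (t' := -crossTime' a b p q) (by rw [← e']; linear_combination (norm := module) h)
    exact ⟨this.1, neg_injective this.2⟩
  · rintro ⟨rfl, rfl⟩
    linear_combination (norm := module) -e'

theorem crosses_iff {a b p q : Space} (hd : det (b.1 - a.1) (q.1 - p.1) ≠ 0) :
    Crosses (· > ·) a b p q ↔ crossTime a b p q ∈ Set.Icc (0 : ℝ) 1 ∧
      crossTime' a b p q ∈ Set.Icc (0 : ℝ) 1 ∧ 0 < crossHeight a b p q := by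
  rw [Crosses, segment_eq_image', segment_eq_image']
  constructor
  · rintro ⟨_, ⟨s, hs, rfl⟩, _, ⟨t, ht, rfl⟩, h, h'⟩
    obtain ⟨rfl, rfl⟩ := (eq_iff_crossTime hd s t).1 h
    exact ⟨hs, ht, sub_pos.2 h'⟩
  · rintro ⟨hs, ht, h⟩
    exact ⟨_, ⟨_, hs, rfl⟩, _, ⟨_, ht, rfl⟩, (eq_iff_crossTime hd _ _).2 ⟨rfl, rfl⟩, sub_pos.1 h⟩

theorem continuous_shear (x : Space) : Continuous fun ε => shear ε x := by
  simp only [shear_apply]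
  fun_prop

theorem shear_zero (x : Space) : shear 0 x = x := by
  rw [shear_apply]
  ext <;> simp

/-- For parallel segments both ends of one are on the same side of the other, so they cannot meet in
general position. -/
theorem det_ne_zero_of_meets {a b p q : Plane} (hg : General a b p q) (hm : Meets a b p q) :
    det (b - a) (q - p) ≠ 0 := by
  intro h
  have hpq : p ≠ q := by
    rintro rfl
    obtain ⟨z, hz, hz'⟩ := hm
    rw [segment_same, Set.mem_singleton_iff] at hz'
    exact hg.left' (hz' ▸ hz)
  refine not_meets_of_same_side hpq hg ?_ hm
  have h1 : side p q a = side p q b := by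
    simp only [side, det, Prod.fst_sub, Prod.snd_sub] at h ⊢
    linarith
  rw [h1]
  rcases lt_or_ge (side p q b) 0 with h2 | h2
  · exact Or.inr ⟨h2, h2⟩
  · exact Or.inl ⟨h2, h2⟩

/-- A small shear does not change crossings in general position. -/
theorem eventually_crosses_iff {a b p q : Space} (hg : General a.1 b.1 p.1 q.1)
    (hd : Disjoint (segment ℝ a b) (segment ℝ p q)) :
    ∀ᶠ ε : ℝ in 𝓝 0, (Crosses (· > ·) (shear ε a) (shear ε b) (shear ε p) (shear ε q) ↔
      Crosses (· > ·) a b p q) := by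
  have lim : ∀ x, Tendsto (fun ε => shear ε x) (𝓝 0) (𝓝 x) := fun x => by
    have := (continuous_shear x).tendsto 0
    rwa [shear_zero] at this
  by_cases hm : Meets a.1 b.1 p.1 q.1
  · have hdet := det_ne_zero_of_meets hg hm
    have hc : ∀ x y z w : Space, Tendsto (fun ε => det ((shear ε x).1 - (shear ε y).1)
        ((shear ε z).1 - (shear ε w).1)) (𝓝 0) (𝓝 (det (x.1 - y.1) (z.1 - w.1))) := by
      intro x y z w
      have hc' : Continuous fun ε => det ((shear ε x).1 - (shear ε y).1)
          ((shear ε z).1 - (shear ε w).1) :=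
        continuous_det (((continuous_shear x).fst).sub (continuous_shear y).fst)
          (((continuous_shear z).fst).sub (continuous_shear w).fst)
      have := hc'.tendsto 0
      simpa only [shear_zero] using this
    have hs : Tendsto (fun ε => crossTime (shear ε a) (shear ε b) (shear ε p) (shear ε q)) (𝓝 0)
        (𝓝 (crossTime a b p q)) := (hc p a q p).div (hc b a q p) hdet
    have ht : Tendsto (fun ε => crossTime' (shear ε a) (shear ε b) (shear ε p) (shear ε q)) (𝓝 0)
        (𝓝 (crossTime' a b p q)) := ((hc b a p a).div (hc b a q p) hdet).neg
    have hh : Tendsto (fun ε => crossHeight (shear ε a) (shear ε b) (shear ε p) (shear ε q)) (𝓝 0)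
        (𝓝 (crossHeight a b p q)) :=
      ((hs.mul_const (b.2 - a.2)).const_add a.2).sub ((ht.mul_const (q.2 - p.2)).const_add p.2)
    -- General position puts both times strictly inside the unit interval, and disjointness in space
    -- makes the height difference nonzero. These are open conditions, so they persist under a small
    -- shear.
    have hmem : crossTime a b p q ∈ Set.Ioo (0 : ℝ) 1 ∧ crossTime' a b p q ∈ Set.Ioo (0 : ℝ) 1 ∧
        crossHeight a b p q ≠ 0 := by
      obtain ⟨z, hz, hz'⟩ := hm
      rw [segment_eq_image'] at hz hz'
      obtain ⟨s, hs, rfl⟩ := hz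
      obtain ⟨t, ht, e⟩ := hz'
      obtain ⟨rfl, rfl⟩ := (eq_iff_crossTime hdet s t).1 e.symm
      have hz1 : a.1 + crossTime a b p q • (b.1 - a.1) ∈ segment ℝ a.1 b.1 := by
        rw [segment_eq_image']; exact ⟨_, hs, rfl⟩
      have hz2 : p.1 + crossTime' a b p q • (q.1 - p.1) ∈ segment ℝ p.1 q.1 := by
        rw [segment_eq_image']; exact ⟨_, ht, rfl⟩
      dsimp only at e
      refine ⟨⟨lt_of_le_of_ne hs.1 fun h => ?_, lt_of_le_of_ne hs.2 fun h => ?_⟩,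
        ⟨lt_of_le_of_ne ht.1 fun h => ?_, lt_of_le_of_ne ht.2 fun h => ?_⟩, fun h => ?_⟩
      · rw [e, ← h, zero_smul, add_zero] at hz2
        exact hg.left hz2
      · rw [e, h, one_smul, add_sub_cancel] at hz2
        exact hg.right hz2
      · rw [← e, ← h, zero_smul, add_zero] at hz1
        exact hg.left' hz1
      · rw [← e, h, one_smul, add_sub_cancel] at hz1
        exact hg.right' hz1
      · have hz3 : a + crossTime a b p q • (b - a) ∈ segment ℝ a b := by
          rw [segment_eq_image']; exact ⟨_, hs, rfl⟩
        refine Set.disjoint_left.1 hd hz3 ?_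
        rw [segment_eq_image']
        exact ⟨_, ht, Prod.ext e (sub_eq_zero.1 h).symm⟩
    have hsign : ∀ᶠ ε in 𝓝 0, (0 < crossHeight (shear ε a) (shear ε b) (shear ε p) (shear ε q) ↔
        0 < crossHeight a b p q) := by
      rcases hmem.2.2.lt_or_gt with h | h
      · filter_upwards [hh.eventually (gt_mem_nhds h)] with ε hε
        exact iff_of_false hε.not_gt h.not_gt
      · filter_upwards [hh.eventually (lt_mem_nhds h)] with ε hε
        exact iff_of_true hε h
    filter_upwards [(hc b a q p).eventually_ne hdet, hs.eventually (Ioo_mem_nhds hmem.1.1 hmem.1.2),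
      ht.eventually (Ioo_mem_nhds hmem.2.1.1 hmem.2.1.2), hsign] with ε h1 h2 h3 h4
    rw [crosses_iff hdet, crosses_iff h1, h4]
    exact and_congr (iff_of_true (Set.Ioo_subset_Icc_self h2) (Set.Ioo_subset_Icc_self hmem.1))
      (and_congr_left fun _ => iff_of_true (Set.Ioo_subset_Icc_self h3)
        (Set.Ioo_subset_Icc_self hmem.2.1))
  · have hcomp : ∀ x y : Plane, IsCompact (segment ℝ x y) := fun x y => by
      rw [← convexHull_pair]
      exact (Set.toFinite {x, y}).isCompact_convexHull ℝ
    -- Projections that do not meet are strictly separated by a functional, which still separates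
    -- the end points after a small shear.
    obtain ⟨f, u, v, hu, huv, hv⟩ := geometric_hahn_banach_compact_closed
      (convex_segment a.1 b.1) (hcomp _ _) (convex_segment p.1 q.1) (hcomp _ _).isClosed
      (Set.disjoint_left.2 fun z hz hz' => hm ⟨z, hz, hz'⟩)
    have flim : ∀ x, Tendsto (fun ε => f (shear ε x).1) (𝓝 0) (𝓝 (f x.1)) := fun x =>
      (f.continuous.comp continuous_fst).continuousAt.tendsto.comp (lim x)
    filter_upwards [(flim a).eventually (gt_mem_nhds (hu _ (left_mem_segment _ _ _))),
      (flim b).eventually (gt_mem_nhds (hu _ (right_mem_segment _ _ _))),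
      (flim p).eventually (lt_mem_nhds (hv _ (left_mem_segment _ _ _))),
      (flim q).eventually (lt_mem_nhds (hv _ (right_mem_segment _ _ _)))] with ε ha hb hp hq
    refine iff_of_false ?_ ?_
    · rintro ⟨x, hx, y, hy, hxy, -⟩
      have h1 : f x.1 < u := (convex_halfSpace_lt f.toLinearMap.isLinear u).segment_subset ha hb
        (fst_mem_segment hx)
      have h2 : v < f y.1 := (convex_halfSpace_gt f.toLinearMap.isLinear v).segment_subset hp hq
        (fst_mem_segment hy)
      rw [hxy] at h1
      linarith
    · rintro ⟨x, hx, y, hy, hxy, -⟩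
      exact hm ⟨x.1, fst_mem_segment hx, hxy ▸ fst_mem_segment hy⟩

namespace LinkDiagram

variable {D : LinkDiagram} {L : PolygonalLink}

theorem Projection.cross (π : Projection D L) (hπ : Function.Injective π.toParam) {p q : L.Param}
    (hpq : p ≠ q) (h : (L.point p).1 = (L.point q).1) : D.Cross (π.toParam p) (π.toParam q) :=
  ⟨fun h' => hpq (hπ h'), by rw [π.point_toParam, π.point_toParam, h]⟩

theorem Projection.vertex_notMem (π : Projection D L) (hπ : Function.Injective π.toParam)
    (hv : ∀ k j, ((L.comp k).vertex j).1 ∉ D.crossings) {k l : Fin 2} (hkl : k ≠ l)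
    (i : ZMod (L.comp k).n) (j : ZMod (L.comp l).n) : ((L.comp k).vertex i).1 ∉
      segment ℝ ((L.comp l).vertex j).1 ((L.comp l).vertex (j + 1)).1 := by
  intro h
  obtain ⟨x, hx, hx'⟩ := exists_of_mem_segment_fst h
  obtain ⟨q, hq, hq'⟩ := PolygonPair.exists_param_of_mem_edgeSet L.toPolygonPair (e := ⟨l, j⟩) hx
  have hql : q.1 = l := by
    rcases hq' with h | ⟨h, -⟩ <;> exact congrArg Sigma.fst h
  have h0 : (0 : ℝ) ∈ Set.Ico (0 : ℝ) 1 := by norm_num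
  have hp : L.point (L.param ⟨k, i⟩ 0 h0) = (L.comp k).vertex i := by
    rw [PolygonPair.point_param, PolygonPair.along_zero]
    rfl
  have hc := π.cross hπ (p := L.param ⟨k, i⟩ 0 h0) (q := q) (fun h => hkl (by rw [← hql, ← h]; rfl))
    (by rw [hp, hq, hx'])
  refine hv k i ?_
  rw [← hp, ← π.point_toParam]
  exact hc.mem

theorem Projection.generalPair (π : Projection D L) (hπ : Function.Injective π.toParam)
    (hv : ∀ k j, ((L.comp k).vertex j).1 ∉ D.crossings) : GeneralPair (L.comp 0) (L.comp 1) :=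
  fun i j => ⟨π.vertex_notMem hπ hv (by simp) i j, π.vertex_notMem hπ hv (by simp) (i + 1) j,
    π.vertex_notMem hπ hv (by simp) j i, π.vertex_notMem hπ hv (by simp) (j + 1) i⟩

/-- A point of an edge that does not lie over a vertex is the point with some parameter. -/
theorem exists_param_of_fst_ne {k : Fin 2} {i : ZMod (L.comp k).n} {x : Space}
    (hx : x ∈ segment ℝ ((L.comp k).vertex i) ((L.comp k).vertex (i + 1)))
    (hne : x.1 ≠ ((L.comp k).vertex (i + 1)).1) : ∃ s, L.point ⟨k, i, s⟩ = x := by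
  rw [segment_eq_image_lineMap] at hx
  obtain ⟨s, hs, rfl⟩ := hx
  have hs1 : s < 1 := lt_of_le_of_ne hs.2 (by
    rintro rfl
    rw [AffineMap.lineMap_apply_one] at hne
    exact hne rfl)
  exact ⟨⟨s, hs.1, hs1⟩, rfl⟩

/-- By general position a common point of two projected edges is never an end point, so it has a
parameter on each of them. Bijectivity of the projection on parameters makes each crossing belong to
just one pair of edges, even if edges of the diagram are subdivided. -/
theorem IsDiagramOf.crossParity_eq (h : D.IsDiagramOf L) :
    crossParity (· > ·) (L.comp 0) (L.comp 1) = D.overParity := by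
  classical
  obtain ⟨π, hπ, hv, hup⟩ := h
  have hg := π.generalPair hπ.1 hv
  have iff_over : ∀ s t, (L.point ⟨0, s⟩).1 = (L.point ⟨1, t⟩).1 →
      (D.Over (L.point ⟨0, s⟩).1 ↔ (L.point ⟨1, t⟩).2 < (L.point ⟨0, s⟩).2) := by
    intro s t hst
    rw [← hup ⟨0, s⟩ ⟨1, t⟩ (fun h => absurd (congrArg Sigma.fst h) (by simp)) hst]
    refine over_iff (a := (π.toParam ⟨0, s⟩).2) (b := (π.toParam ⟨1, t⟩).2) ?_ ?_
    · exact π.point_toParam ⟨0, s⟩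
    · exact (π.point_toParam ⟨1, t⟩).trans hst.symm
  have h1 : crossParity (· > ·) (L.comp 0) (L.comp 1) =
      ∑ e : ZMod (L.comp 0).n × ZMod (L.comp 1).n,
        if Crosses (· > ·) ((L.comp 0).vertex e.1) ((L.comp 0).vertex (e.1 + 1))
          ((L.comp 1).vertex e.2) ((L.comp 1).vertex (e.2 + 1)) then (1 : ZMod 2) else 0 := by
    rw [Fintype.sum_prod_type, crossParity]
    rfl
  rw [h1, Finset.sum_boole, overParity, Set.ncard_eq_toFinset_card _ finite_over]
  congr 1
  have key : ∀ e : ZMod (L.comp 0).n × ZMod (L.comp 1).n,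
      Crosses (· > ·) ((L.comp 0).vertex e.1) ((L.comp 0).vertex (e.1 + 1))
          ((L.comp 1).vertex e.2) ((L.comp 1).vertex (e.2 + 1)) →
      ∃ x, D.Over x ∧ ∃ s t, (L.point ⟨0, e.1, s⟩).1 = x ∧ (L.point ⟨1, e.2, t⟩).1 = x := by
    rintro ⟨i, j⟩ ⟨x, hx, y, hy, hxy, hlt⟩
    obtain ⟨s, rfl⟩ := exists_param_of_fst_ne hx (fun h' =>
      (hg i j).right (by rw [← h', hxy]; exact fst_mem_segment hy))
    obtain ⟨t, rfl⟩ := exists_param_of_fst_ne hy (fun h' =>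
      (hg i j).right' (by rw [← h', ← hxy]; exact fst_mem_segment hx))
    exact ⟨_, (iff_over _ _ hxy).2 hlt, s, t, rfl, hxy.symm⟩
  have mem : ∀ (k : Fin 2) (i : ZMod (L.comp k).n) s, L.point ⟨k, i, s⟩ ∈
      segment ℝ ((L.comp k).vertex i) ((L.comp k).vertex (i + 1)) := fun k i s =>
    PolygonPair.point_mem_edgeSet L.toPolygonPair ⟨k, i, s⟩
  choose! f hf using key
  refine Finset.card_bij (fun e _ => f e) ?_ ?_ ?_
  · intro e he
    simpa using (hf e (Finset.mem_filter.1 he).2).1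
  · intro e he e' he' hee
    obtain ⟨-, s, t, h1, h2⟩ := hf e (Finset.mem_filter.1 he).2
    obtain ⟨-, s', t', h1', h2'⟩ := hf e' (Finset.mem_filter.1 he').2
    have hu := unique_of_point_eq (D := D) (x := f e) (a := (π.toParam ⟨0, e.1, s⟩).2)
      (b := (π.toParam ⟨1, e.2, t⟩).2) (a' := (π.toParam ⟨0, e'.1, s'⟩).2)
      (b' := (π.toParam ⟨1, e'.2, t'⟩).2) ((π.point_toParam ⟨0, e.1, s⟩).trans h1)
      ((π.point_toParam ⟨1, e.2, t⟩).trans h2)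
      ((π.point_toParam ⟨0, e'.1, s'⟩).trans (h1'.trans hee.symm))
      ((π.point_toParam ⟨1, e'.2, t'⟩).trans (h2'.trans hee.symm))
    have e0 : (⟨0, e.1, s⟩ : L.Param) = ⟨0, e'.1, s'⟩ :=
      hπ.1 (congrArg (Sigma.mk (0 : Fin 2)) hu.1)
    have e1 : (⟨1, e.2, t⟩ : L.Param) = ⟨1, e'.2, t'⟩ :=
      hπ.1 (congrArg (Sigma.mk (1 : Fin 2)) hu.2)
    exact Prod.ext (Prod.ext_iff.1 (eq_of_heq (Sigma.mk.inj_iff.1 e0).2)).1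
      (Prod.ext_iff.1 (eq_of_heq (Sigma.mk.inj_iff.1 e1).2)).1
  · intro x hx
    have hx' : D.Over x := by simpa using hx
    obtain ⟨a, b, h1, h2, -⟩ := id hx'
    obtain ⟨⟨k, i, s⟩, hp⟩ := hπ.2 ⟨0, a⟩
    obtain ⟨⟨l, j, t⟩, hq⟩ := hπ.2 ⟨1, b⟩
    obtain rfl : k = 0 := congrArg Sigma.fst hp
    obtain rfl : l = 1 := congrArg Sigma.fst hq
    have hpx : (L.point ⟨0, i, s⟩).1 = x := by rw [← π.point_toParam, hp, h1]
    have hqx : (L.point ⟨1, j, t⟩).1 = x := by rw [← π.point_toParam, hq, h2]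
    have hlt := (iff_over (i, s) (j, t) (hpx.trans hqx.symm)).1 (by rw [hpx]; exact hx')
    have hc : Crosses (· > ·) ((L.comp 0).vertex i) ((L.comp 0).vertex (i + 1))
          ((L.comp 1).vertex j) ((L.comp 1).vertex (j + 1)) :=
      ⟨_, mem 0 i s, _, mem 1 j t, hpx.trans hqx.symm, hlt⟩
    refine ⟨(i, j), Finset.mem_filter.2 ⟨Finset.mem_univ _, hc⟩, ?_⟩
    obtain ⟨-, s', t', h1', h2'⟩ := hf (i, j) hc
    have hu := params_unique (D := D) (i := π.edge 0 i) (j := π.edge 1 j)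
      (s := (π.toParam ⟨0, i, s⟩).2.2) (t := (π.toParam ⟨1, j, t⟩).2.2)
      (s' := (π.toParam ⟨0, i, s'⟩).2.2) (t' := (π.toParam ⟨1, j, t'⟩).2.2)
      ((π.point_toParam ⟨0, i, s⟩).trans
        ((hpx.trans hqx.symm).trans (π.point_toParam ⟨1, j, t⟩).symm))
      ((π.point_toParam ⟨0, i, s'⟩).trans
        ((h1'.trans h2'.symm).trans (π.point_toParam ⟨1, j, t'⟩).symm))
    have e0 : π.toParam ⟨0, i, s⟩ = π.toParam ⟨0, i, s'⟩ :=
      congrArg (fun r => (⟨0, π.edge 0 i, r⟩ : D.Param)) hu.1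
    rw [← h1', ← hpx, hπ.1 e0]

theorem IsDiagramOf.eventually_parity_eq (h : D.IsDiagramOf L) :
    ∀ᶠ ε : ℝ in 𝓝 0, L.parity ε = D.overParity := by
  have hall : ∀ᶠ ε : ℝ in 𝓝 0, ∀ (i : ZMod (L.comp 0).n) (j : ZMod (L.comp 1).n),
      (Crosses (· > ·) (shear ε ((L.comp 0).vertex i)) (shear ε ((L.comp 0).vertex (i + 1)))
        (shear ε ((L.comp 1).vertex j)) (shear ε ((L.comp 1).vertex (j + 1))) ↔
      Crosses (· > ·) ((L.comp 0).vertex i) ((L.comp 0).vertex (i + 1))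
        ((L.comp 1).vertex j) ((L.comp 1).vertex (j + 1))) := by
    obtain ⟨π, hπ, hv, -⟩ := h
    exact eventually_all.2 fun i => eventually_all.2 fun j =>
      eventually_crosses_iff (π.generalPair hπ.1 hv i j) (L.edges_disjoint (by simp) i j)
  filter_upwards [hall] with ε hε
  rw [← h.crossParity_eq]
  exact Finset.sum_congr rfl fun i _ => Finset.sum_congr rfl fun j _ => ind_congr (hε i j)

/-- The diagram gives the parity for all small shears, triviality gives zero for all small nonzero
ones; one common shear suffices. -/
theorem IsDiagramOf.overParity_eq_zero (h : D.IsDiagramOf L) (hL : L.IsTrivial) :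
    D.overParity = 0 := by
  have h0 : ∀ᶠ ε : ℝ in 𝓝[≠] 0, L.parity ε = D.overParity :=
    nhdsWithin_le_nhds h.eventually_parity_eq
  obtain ⟨ε, h1, h2⟩ := (h0.and hL.eventually_parity_eq_zero).exists
  exact h1.symm.trans h2

end LinkDiagram

end RegionCrossing

theorem theorem1p2 (D : RegionCrossing.LinkDiagram) (hD : IsConnected D.support) :
    D.Unknottable ↔ Even D.linkingNumber := by
  rw [RegionCrossing.LinkDiagram.even_linkingNumber_iff]
  constructor
  · rintro ⟨D', hD', L, hL, hT⟩
    rw [← RegionCrossing.LinkDiagram.overParity_eq_of_reflTransGen hD']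
    exact hL.overParity_eq_zero hT
  · exact RegionCrossing.LinkDiagram.unknottable_of_even hD
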